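/- Let $(\varepsilon_t)_{t\in\mathbb Z}$ be i.i.d. real random variables with the distribution of $\varepsilon$, put $\nu=\sup\{p>1:\|\varepsilon\|_{L^p(\mathbf P)}<\infty\}$, and assume $\nu>1$; put $\alpha=\min(2,\nu)$. Let $d\in(0,1-1/\alpha)$, let $(a_j)_{j\ge 0}$ be real numbers such that $n^{1-d}a_n$ converges to a finite nonzero limit, and let $X_t=\sum_{j=0}^\infty a_j\varepsilon_{t-j}$, $t\in\mathbb Z$ (the partial sums converge almost surely). Assume that the distribution function $F_\varepsilon$ of $\varepsilon$ is in $C^2(\mathbb R)$, that $\varepsilon$ has a symmetric distribution, and that one of the following holds: (i) $\mathbf E[\varepsilon^2]<\infty$ (so $\alpha=2$) and, for some $\delta'>0$, $(1+|s|)^{\delta'}\,\mathbf E[e^{\mathrm i s\varepsilon}]$ is bounded in $s\in\mathbb R$; (ii) $\alpha\in(1,2)$, there is $A\in(0,\infty)$ with $\lim_{x\to\infty}x^\alpha\mathbf P[\varepsilon>x]=\lim_{x\to\infty}x^\alpha\mathbf P[\varepsilon<-x]=A/2$, and there is a constant $C_\varepsilon>0$ such that the density $f_\varepsilon\in C^1(\mathbb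 R)$ satisfies $|f_\varepsilon'(x)|\le C_\varepsilon(1+|x|)^{-\alpha}$ for all $x$, and $|f_\varepsilon'(x)-f_\varepsilon'(y)|\le C_\varepsilon|x-y|(1+|x|)^{-\alpha}$ for all $|x-y|<1$. Let $G_n:\mathbb R\to\mathbb R$, $n\ge1$, be measurable functions with $|G_n(x)|\le C_G(1+|x|)^{\gamma_G}\mathbf 1\{x>u_n\}$ for all $x\in\mathbb R$ and $n\ge 1$, where $C_G$ is a constant, $\gamma_G\ge0$ and $(u_n)$ is a real sequence with $u_n\to\infty$. Define $$(\gamma_0,r_0,\kappa_0)=\begin{cases}\left(\dfrac{d}{1-d},\ \alpha(1-d),\ \dfrac1{\alpha(1-d)}\right)&\text{if }\dfrac{1}{(1-d)(1-2d)}<\alpha,\\[10pt]\left(\dfrac{\alpha(1-d)-1}{\alpha(1-d)+1},\ \dfrac12\Big(\alpha+\dfrac1{1-d}\Big),\ d+(1-d)\dfrac{3-\alpha(1-d)}{\alpha(1-d)+1}\right)&\text{otherwise.}\end{cases}$$ Suppose that $\gamma_G<\gamma_0$. Then $G_n(X_0+x)$ is integrable for all $n\ge 1$ and $x\in\mathbb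 R$, the derivative $G_{\infty,n}'(0):=\frac{\mathrm d}{\mathrm dx}\mathbf E[G_n(X_0+x)]\big|_{x=0}$ exists for all $n\ge 1$, and for every $\delta>0$ there is a constant $C$ such that for all $n\ge1$ $$\left\|\sum_{t=1}^n\big(G_n(X_t)-\mathbf E[G_n(X_0)]\big)-G_{\infty,n}'(0)\sum_{t=1}^nX_t\right\|_{L^{r_0}(\mathbf P)}\le C\,n^{\kappa_0+\delta}.$$ Consequently, if $G_{\infty,n}'(0)\ne0$ for all sufficiently large $n$ and if, for some $\delta>0$, $n^{\kappa_0+\delta-d-1/\alpha}/G_{\infty,n}'(0)\to0$ as $n\to\infty$, then $$\frac{n^{-d-1/\alpha}}{G_{\infty,n}'(0)}\sum_{t=1}^n\big(G_n(X_t)-\mathbf E[G_n(X_0)]\big)-n^{-d-1/\alpha}\sum_{t=1}^nX_t\longrightarrow0\quad\text{in }L^{r_0}(\mathbf P).$$ -/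

import Mathlib

open MeasureTheory ProbabilityTheory Filter Topology
open scoped ENNReal

noncomputable section

/-- The number of finite moments `sup {p > 1 | ‖Z‖_{L^p} < ∞}` of a real random variable `Z`,
the supremum being over finite exponents and taken in `[0, ∞]`. -/
def momentIndex {Ω : Type*} [MeasurableSpace Ω] (P : Measure Ω) (Z : Ω → ℝ) : ℝ≥0∞ :=
  sSup {p : ℝ≥0∞ | 1 < p ∧ p ≠ ∞ ∧ eLpNorm Z p P < ∞}

/-- `α = min 2 ν`, where `ν` is the number of finite moments. -/
def tailIndex {Ω : Type*} [MeasurableSpace Ω] (P : Measure Ω) (Z : Ω → ℝ) : ℝ :=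
  (min 2 (momentIndex P Z)).toReal

/-- The linear process `X_t = ∑_{j ≥ 0} a_j ε_{t-j}`. The series is only conditionally
convergent in the long memory regime, so it is the pointwise limit of its partial sums
(and not an unconditional sum). -/
def linearProcess {Ω : Type*} (a : ℕ → ℝ) (ε : ℤ → Ω → ℝ) (t : ℤ) (ω : Ω) : ℝ :=
  limUnder atTop (fun N : ℕ => ∑ j ∈ Finset.range N, a j * ε (t - (j : ℤ)) ω)

/-- Long memory with parameter `d` of a coefficient sequence `a`, for innovations distributed
as `Z`. -/
structure LongMemory {Ω : Type*} [MeasurableSpace Ω] (P : Measure Ω) (Z : Ω → ℝ)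
    (a : ℕ → ℝ) (d : ℝ) : Prop where
  one_lt_momentIndex : 1 < momentIndex P Z
  d_pos : 0 < d
  d_lt : d < 1 - 1 / tailIndex P Z
  coeff : ∃ c : ℝ, c ≠ 0 ∧ Tendsto (fun n : ℕ => (n : ℝ) ^ (1 - d) * a n) atTop (𝓝 c)

/-- The transformations `G_n`, `n ≥ 1`, are measurable and `|G_n(x)| ≲ (1 + |x|)^γ 1{x > u_n}`
uniformly in `n` and `x`, with `γ ≥ 0` and `u_n → ∞`. -/
structure RegularTransforms (G : ℕ → ℝ → ℝ) (u : ℕ → ℝ) (γ : ℝ) : Prop where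
  measurable : ∀ n : ℕ, 1 ≤ n → Measurable (G n)
  nonneg : 0 ≤ γ
  tendsto_threshold : Tendsto u atTop atTop
  bound : ∃ C : ℝ, ∀ n : ℕ, 1 ≤ n → ∀ x : ℝ,
    |G n x| ≤ C * (1 + |x|) ^ γ * (Set.Ioi (u n)).indicator (fun _ => (1 : ℝ)) x

/-- The distribution function `F_Z(x) = P[Z ≤ x]`. -/
def distFun {Ω : Type*} [MeasurableSpace Ω] (P : Measure Ω) (Z : Ω → ℝ) (x : ℝ) : ℝ :=
  P.real {ω | Z ω ≤ x}

/-- The density `f_Z = F_Z'`; used only for continuously differentiable `F_Z`. -/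
def density {Ω : Type*} [MeasurableSpace Ω] (P : Measure Ω) (Z : Ω → ℝ) : ℝ → ℝ :=
  deriv (distFun P Z)

/-- Finite variance alternative: second moment and polynomial decay of the characteristic
function. -/
def FiniteVarianceCase {Ω : Type*} [MeasurableSpace Ω] (P : Measure Ω) (Z : Ω → ℝ) : Prop :=
  MemLp Z 2 P ∧
  ∃ δ : ℝ, 0 < δ ∧ ∃ C : ℝ, ∀ s : ℝ, (1 + |s|) ^ δ * ‖charFun (P.map Z) s‖ ≤ C

/-- Heavy-tailed alternative: `1 < α < 2`, balanced exact power tails of index `α`, and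
a continuously differentiable density with the stated decay. -/
def HeavyTailCase {Ω : Type*} [MeasurableSpace Ω] (P : Measure Ω) (Z : Ω → ℝ) : Prop :=
  1 < tailIndex P Z ∧ tailIndex P Z < 2 ∧
  (∃ A : ℝ, 0 < A ∧
    Tendsto (fun x : ℝ => x ^ tailIndex P Z * P.real {ω | x < Z ω}) atTop (𝓝 (A / 2)) ∧
    Tendsto (fun x : ℝ => x ^ tailIndex P Z * P.real {ω | Z ω < -x}) atTop (𝓝 (A / 2))) ∧
  ContDiff ℝ 1 (density P Z) ∧
  ∃ C : ℝ, 0 < C ∧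
    (∀ x : ℝ, |deriv (density P Z) x| ≤ C * (1 + |x|) ^ (-tailIndex P Z)) ∧
    (∀ x y : ℝ, |x - y| < 1 →
      |deriv (density P Z) x - deriv (density P Z) y|
        ≤ C * |x - y| * (1 + |x|) ^ (-tailIndex P Z))

/-- Regularity of the innovation distribution. -/
structure RegularInnovation {Ω : Type*} [MeasurableSpace Ω] (P : Measure Ω) (Z : Ω → ℝ) :
    Prop where
  contDiff_distFun : ContDiff ℝ 2 (distFun P Z)
  symmetric : IdentDistrib Z (fun ω => -Z ω) P P
  cases : FiniteVarianceCase P Z ∨ HeavyTailCase P Z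

/-- `γ₀` as a function of `α` and `d`. -/
def gammaOpt (α d : ℝ) : ℝ :=
  if 1 / ((1 - d) * (1 - 2 * d)) < α then d / (1 - d)
  else (α * (1 - d) - 1) / (α * (1 - d) + 1)

/-- `r₀` as a function of `α` and `d`. -/
def rOpt (α d : ℝ) : ℝ :=
  if 1 / ((1 - d) * (1 - 2 * d)) < α then α * (1 - d)
  else (1 / 2) * (α + 1 / (1 - d))

/-- `κ₀` as a function of `α` and `d`. -/
def kappaOpt (α d : ℝ) : ℝ :=
  if 1 / ((1 - d) * (1 - 2 * d)) < α then 1 / (α * (1 - d))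
  else d + (1 - d) * ((3 - α * (1 - d)) / (α * (1 - d) + 1))

/-- `G_∞(x) = E[g(Y + x)]`. -/
def shiftedMean {Ω : Type*} [MeasurableSpace Ω] (P : Measure Ω) (g : ℝ → ℝ) (Y : Ω → ℝ)
    (x : ℝ) : ℝ :=
  ∫ ω, g (Y ω + x) ∂P

/-- `G_∞'(0)`, the derivative at `0` of `x ↦ E[g(Y + x)]`. -/
def linCoeff {Ω : Type*} [MeasurableSpace Ω] (P : Measure Ω) (g : ℝ → ℝ) (Y : Ω → ℝ) : ℝ :=
  deriv (shiftedMean P g Y) 0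

/-- The centered subordinated partial sum `∑_{t=1}^n (g(X_t) - E[g(X_0)])`. -/
def centeredSum {Ω : Type*} [MeasurableSpace Ω] (P : Measure Ω) (g : ℝ → ℝ)
    (X : ℤ → Ω → ℝ) (n : ℕ) (ω : Ω) : ℝ :=
  ∑ t ∈ Finset.Icc 1 n, (g (X (t : ℤ) ω) - ∫ ω', g (X 0 ω') ∂P)

/-- The partial sum `∑_{t=1}^n X_t`. -/
def partialSum {Ω : Type*} (X : ℤ → Ω → ℝ) (n : ℕ) (ω : Ω) : ℝ :=
  ∑ t ∈ Finset.Icc 1 n, X (t : ℤ) ω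

end

/-! Write `s = 1 - d`, `K_j(y) = E[G(y + ∑_{i<j} a_i ε_i)]` (`partialMean`), `Y_j = ∑_{i≥j} a_i
ε_{t-i}` (`tailSum`) and `c = G_∞'(0)` (`linCoeff`). Since `K_0(Y_0) = G(X_t)` and averaging out one
more innovation turns `K_j` into `K_{j+1}`, the error `G(X_t) - E[G(X_0)] - c X_t` telescopes into
terms `K_j(Y_{j+1} + a_j e) - K_{j+1}(Y_{j+1}) - c a_j e` (`innovation`). Each has mean zero given
the past, and the remainder vanishes in the limit.

Although `G` is merely measurable, `K_j` is smooth once finitely many innovations are averaged out: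
one innovation with a good density suffices in the heavy-tailed case, several with a decaying
characteristic function in the finite variance case. From then on `SmoothGrowth` holds with
constants uniform in `j` and in all `G` with the same growth bound, which is why the final constant
does not depend on `n`.

For `p < α`, the von Bahr–Esseen inequality gives `‖Y_j‖_p ≲ j^(1/p - s)`. A Taylor expansion of
order `p/r` bounds an innovation in `L^r` by `|a_j|^(p/r)` plus `|a_j|` times the size of
`K_j'(Y_{j+1}) - c`. Because `c = E[K_j'(Y_j)]`, the latter is again of order `j^(1/p - s)`. Hence
innovations decay like `j^(-θ)` for `θ ≤ s p / r` and `θ ≤ 2 s - 1/p`.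

After summation over `t ≤ n`, the terms are regrouped by the innovation they come from. The groups
are martingale differences, so von Bahr–Esseen applies again and yields `n^(1 - θ + 1/r)`
(`exists_eLpNorm_centeredSum_sub_le`). The values `γ₀, r₀, κ₀` correspond to `p = α` and `θ =
α(1-d)/r₀`; the strict inequality for the growth exponent and the loss `δ` allow `p` and `θ`
slightly below these. -/

/-! ### Elementary inequalities for real powers and polynomial weights. -/

theorem Real.abs_rpow_sub_rpow_le {q s t : ℝ} (hq : 0 ≤ q) (hq1 : q ≤ 1) (hs : 0 ≤ s)
    (ht : 0 ≤ t) : |s ^ q - t ^ q| ≤ |s - t| ^ q := by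
  wlog h : t ≤ s generalizing s t
  · rw [abs_sub_comm, abs_sub_comm s t]
    exact this ht hs (le_of_not_ge h)
  rw [abs_of_nonneg (sub_nonneg.2 (Real.rpow_le_rpow ht h hq)), abs_of_nonneg (sub_nonneg.2 h)]
  have := Real.rpow_add_le_add_rpow ht (sub_nonneg.2 h) hq hq1
  rw [add_sub_cancel] at this
  linarith

theorem abs_rpow_sub_two_mul_of_nonneg {p x : ℝ} (hp : 1 < p) (hx : 0 ≤ x) :
    |x| ^ (p - 2) * x = x ^ (p - 1) := by
  rcases hx.eq_or_lt with rfl | hx'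
  · rw [mul_zero, Real.zero_rpow (by linarith)]
  · rw [abs_of_pos hx', ← Real.rpow_add_one hx'.ne']
    congr 1; ring

theorem abs_abs_rpow_sub_two_mul {p x : ℝ} (hp : 1 < p) :
    |(|x| ^ (p - 2) * x)| = |x| ^ (p - 1) := by
  rw [abs_mul, abs_of_nonneg (Real.rpow_nonneg (abs_nonneg x) _)]
  simpa using abs_rpow_sub_two_mul_of_nonneg hp (abs_nonneg x)

/-- Hölder continuity of the derivative of `|x|^p / p`. For equal signs it is subadditivity of `x ↦
x^(p-1)`; for opposite signs `|s|` and `|t|` are both at most `|s - t|`, whence the constant 2. -/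
theorem abs_rpow_sub_two_mul_sub_le {p : ℝ} (hp : 1 < p) (hp2 : p ≤ 2) (s t : ℝ) :
    |(|s| ^ (p - 2) * s) - |t| ^ (p - 2) * t| ≤ 2 * |s - t| ^ (p - 1) := by
  have key : ∀ s t : ℝ, 0 ≤ s →
      |(|s| ^ (p - 2) * s) - |t| ^ (p - 2) * t| ≤ 2 * |s - t| ^ (p - 1) := by
    intro s t hs
    rcases le_total 0 t with ht | ht
    · rw [abs_rpow_sub_two_mul_of_nonneg hp hs, abs_rpow_sub_two_mul_of_nonneg hp ht]
      have := Real.abs_rpow_sub_rpow_le (q := p - 1) (by linarith) (by linarith) hs ht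
      have h0 := Real.rpow_nonneg (abs_nonneg (s - t)) (p - 1)
      linarith
    · have h1 := abs_sub (|s| ^ (p - 2) * s) (|t| ^ (p - 2) * t)
      rw [abs_abs_rpow_sub_two_mul hp, abs_abs_rpow_sub_two_mul hp] at h1
      have h2 : |s| ^ (p - 1) ≤ |s - t| ^ (p - 1) := by
        apply Real.rpow_le_rpow (abs_nonneg _) _ (by linarith)
        rw [abs_of_nonneg hs]; exact (by linarith : s ≤ s - t).trans (le_abs_self _)
      have h3 : |t| ^ (p - 1) ≤ |s - t| ^ (p - 1) := by
        apply Real.rpow_le_rpow (abs_nonneg _) _ (by linarith)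
        rw [abs_of_nonpos ht]; exact (by linarith : -t ≤ s - t).trans (le_abs_self _)
      linarith
  rcases le_total 0 s with hs | hs
  · exact key s t hs
  · have := key (-s) (-t) (by linarith)
    rw [abs_neg, abs_neg] at this
    calc _ = |(|s| ^ (p - 2) * -s) - |t| ^ (p - 2) * -t| := by
          rw [← abs_neg]; congr 1; ring
      _ ≤ _ := this
      _ = _ := by rw [← abs_neg (s - t)]; congr 3; ring

/-- The pointwise inequality behind the von Bahr–Esseen moment bound. -/
theorem abs_add_rpow_le {p : ℝ} (hp : 1 < p) (hp2 : p ≤ 2) (x y : ℝ) :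
    |x + y| ^ p ≤ |x| ^ p + p * (|x| ^ (p - 2) * x) * y + 2 * p * |y| ^ p := by
  let f : ℝ → ℝ := fun s => |x + s * y| ^ p
  have hf : ∀ s, HasDerivAt f (p * |x + s * y| ^ (p - 2) * (x + s * y) * y) s := by
    intro s
    have h1 : HasDerivAt (fun s : ℝ => x + s * y) y s := by
      simpa using ((hasDerivAt_id s).mul_const y).const_add x
    exact (hasDerivAt_abs_rpow (x + s * y) hp).comp s h1
  -- The mean value theorem along the segment from `x` to `x + y`; the derivative at the
  -- intermediate point is then compared with the one at `x`.
  obtain ⟨c, hc, hce⟩ := exists_hasDerivAt_eq_slope f _ (zero_lt_one)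
    (fun s _ => (hf s).continuousAt.continuousWithinAt) (fun s _ => hf s)
  have h2 : f 1 - f 0 = p * |x + c * y| ^ (p - 2) * (x + c * y) * y := by
    rw [hce]; simp
  have hf1 : f 1 = |x + y| ^ p := by simp [f]
  have hf0 : f 0 = |x| ^ p := by simp [f]
  have h3 := abs_rpow_sub_two_mul_sub_le hp hp2 (x + c * y) x
  have h4 : |x + c * y - x| ^ (p - 1) ≤ |y| ^ (p - 1) := by
    apply Real.rpow_le_rpow (abs_nonneg _) _ (by linarith)
    rw [add_sub_cancel_left, abs_mul, abs_of_pos hc.1]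
    exact mul_le_of_le_one_left (abs_nonneg _) hc.2.le
  have h5 : (|x + c * y| ^ (p - 2) * (x + c * y) - |x| ^ (p - 2) * x) * y ≤ 2 * |y| ^ p := by
    calc _ ≤ |(|x + c * y| ^ (p - 2) * (x + c * y) - |x| ^ (p - 2) * x) * y| := le_abs_self _
      _ ≤ 2 * |y| ^ (p - 1) * |y| := by
        rw [abs_mul]; exact mul_le_mul_of_nonneg_right (by linarith) (abs_nonneg _)
      _ = 2 * |y| ^ p := by
        rcases eq_or_ne y 0 with rfl | hy
        · simp [Real.zero_rpow (by linarith : p ≠ 0)]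
        · rw [mul_assoc, ← Real.rpow_add_one (abs_ne_zero.2 hy)]; simp
  rw [hf1, hf0] at h2
  nlinarith

theorem one_add_abs_add_rpow_le {γ : ℝ} (hγ : 0 ≤ γ) (x y : ℝ) :
    (1 + |x + y|) ^ γ ≤ (1 + |x|) ^ γ * (1 + |y|) ^ γ := by
  rw [← Real.mul_rpow (by positivity) (by positivity)]
  apply Real.rpow_le_rpow (by positivity) _ hγ
  nlinarith [abs_add_le x y, abs_nonneg x, abs_nonneg y]

/-- Peetre's inequality for negative exponents. -/
theorem one_add_abs_rpow_neg_le {β : ℝ} (hβ : 0 ≤ β) (x y : ℝ) :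
    (1 + |x + y|) ^ (-β) ≤ (1 + |x|) ^ (-β) * (1 + |y|) ^ β := by
  rw [Real.rpow_neg (by positivity), Real.rpow_neg (by positivity)]
  have h := one_add_abs_add_rpow_le hβ (x + y) (-y)
  rw [add_neg_cancel_right, abs_neg] at h
  have h1 : 0 < (1 + |x|) ^ β := by positivity
  have h2 : 0 < (1 + |x + y|) ^ β := by positivity
  rw [inv_mul_eq_div, inv_eq_one_div, div_le_div_iff₀ h2 h1]
  linarith

theorem integrable_one_add_abs_rpow {β : ℝ} (hβ : 1 < β) :
    Integrable (fun x : ℝ => (1 + |x|) ^ (-β)) := by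
  simpa using integrable_one_add_norm (E := ℝ) (μ := volume) (r := β) (by simpa using hβ)

/-! ### Moments, the von Bahr–Esseen inequality and convergence of random series. -/

theorem MeasureTheory.MemLp.integrable_abs_rpow {Ω : Type*} [MeasurableSpace Ω] {P : Measure Ω}
    {f : Ω → ℝ} {r : ℝ} (hr : 0 < r) (hf : MemLp f (ENNReal.ofReal r) P) :
    Integrable (fun ω => |f ω| ^ r) P := by
  have := hf.integrable_norm_rpow (by simpa using hr) ENNReal.ofReal_ne_top
  simpa [ENNReal.toReal_ofReal hr.le] using this

theorem MeasureTheory.MemLp.eLpNorm_eq_ofReal_integral {Ω : Type*} [MeasurableSpace Ω]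
    {P : Measure Ω} {f : Ω → ℝ} {r : ℝ} (hr : 0 < r) (hf : MemLp f (ENNReal.ofReal r) P) :
    eLpNorm f (ENNReal.ofReal r) P = ENNReal.ofReal ((∫ ω, |f ω| ^ r ∂P) ^ (1 / r)) := by
  have := hf.eLpNorm_eq_integral_rpow_norm (by simpa using hr) ENNReal.ofReal_ne_top
  simpa [ENNReal.toReal_ofReal hr.le] using this

theorem MeasureTheory.MemLp.integral_abs_rpow_eq {Ω : Type*} [MeasurableSpace Ω]
    {P : Measure Ω} {f : Ω → ℝ} {r : ℝ} (hr : 0 < r) (hf : MemLp f (ENNReal.ofReal r) P) :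
    ∫ ω, |f ω| ^ r ∂P = (eLpNorm f (ENNReal.ofReal r) P).toReal ^ r := by
  have h0 : 0 ≤ ∫ ω, |f ω| ^ r ∂P := integral_nonneg fun ω => Real.rpow_nonneg (abs_nonneg _) _
  rw [hf.eLpNorm_eq_ofReal_integral hr, ENNReal.toReal_ofReal (Real.rpow_nonneg h0 _),
    ← Real.rpow_mul h0, one_div_mul_cancel hr.ne', Real.rpow_one]

/-- One step of the von Bahr–Esseen inequality: adding a variable with vanishing conditional
mean given the past. -/
theorem integral_abs_add_rpow_le_of_indepFun {Ω E : Type*} [MeasurableSpace Ω] [MeasurableSpace E]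
    {P : Measure Ω} [IsProbabilityMeasure P] {Y : Ω → E} {e : Ω → ℝ} (hY : Measurable Y)
    (he : Measurable e) (hind : IndepFun Y e P) {s : E → ℝ} (hs : Measurable s)
    {g : E → ℝ → ℝ} (hg : Measurable (Function.uncurry g))
    (hg0 : ∀ x, ∫ y, g x y ∂(P.map e) = 0) {r : ℝ} (hr : 1 < r) (hr2 : r ≤ 2)
    (hS : MemLp (fun ω => s (Y ω)) (ENNReal.ofReal r) P)
    (hD : MemLp (fun ω => g (Y ω) (e ω)) (ENNReal.ofReal r) P) :
    ∫ ω, |s (Y ω) + g (Y ω) (e ω)| ^ r ∂P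
      ≤ ∫ ω, |s (Y ω)| ^ r ∂P + 2 * r * ∫ ω, |g (Y ω) (e ω)| ^ r ∂P := by
  have hr0 : 0 < r := by linarith
  have hSi := hS.integrable_abs_rpow hr0
  have hDi := hD.integrable_abs_rpow hr0
  have hgm : Measurable fun ω => g (Y ω) (e ω) := hg.comp (hY.prodMk he)
  have hφm : Measurable fun x : ℝ => |x| ^ (r - 2) * x := by fun_prop
  let F : E × ℝ → ℝ := fun z => (|s z.1| ^ (r - 2) * s z.1) * g z.1 z.2
  have hFm : Measurable F := ((hφm.comp hs).comp measurable_fst).mul hg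
  -- The cross term is integrable because `u^(r-1) v ≤ u^r + v^r`, by comparing `u` and `v`.
  have hFi : Integrable (fun ω => F (Y ω, e ω)) P := by
    refine (hSi.add hDi).mono' (hFm.comp (hY.prodMk he)).aestronglyMeasurable
      (Eventually.of_forall fun ω => ?_)
    simp only [F, Real.norm_eq_abs, Pi.add_apply]
    rw [abs_mul, abs_abs_rpow_sub_two_mul hr]
    set u := |s (Y ω)|
    set v := |g (Y ω) (e ω)|
    have hu : 0 ≤ u := abs_nonneg _
    have hv : 0 ≤ v := abs_nonneg _
    have hmul : ∀ w : ℝ, 0 ≤ w → w ^ (r - 1) * w = w ^ r := by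
      intro w hw
      rcases hw.eq_or_lt with rfl | hw
      · simp [Real.zero_rpow hr0.ne']
      · rw [← Real.rpow_add_one hw.ne']; congr 1; ring
    rcases le_total u v with h | h
    · have := mul_le_mul_of_nonneg_right
        (Real.rpow_le_rpow hu h (by linarith : 0 ≤ r - 1)) hv
      rw [hmul v hv] at this
      have := Real.rpow_nonneg hu r
      linarith
    · have := mul_le_mul_of_nonneg_left h (Real.rpow_nonneg hu (r - 1))
      rw [hmul u hu] at this
      have := Real.rpow_nonneg hv r
      linarith
  -- Fubini: for a fixed value of `Y` the first factor is constant and `g` integrates to zero.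
  have hF0 : ∫ ω, F (Y ω, e ω) ∂P = 0 := by
    have hmap := (indepFun_iff_map_prod_eq_prod_map_map hY.aemeasurable he.aemeasurable).1 hind
    have : IsProbabilityMeasure (P.map e) := Measure.isProbabilityMeasure_map he.aemeasurable
    have : IsProbabilityMeasure (P.map Y) := Measure.isProbabilityMeasure_map hY.aemeasurable
    rw [← integral_map (hY.prodMk he).aemeasurable hFm.aestronglyMeasurable, hmap,
      integral_prod]
    · simp only [F, integral_const_mul, hg0, mul_zero, integral_zero]
    · rw [← hmap]
      exact (integrable_map_measure hFm.aestronglyMeasurable (hY.prodMk he).aemeasurable).2 hFi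
  calc ∫ ω, |s (Y ω) + g (Y ω) (e ω)| ^ r ∂P
      ≤ ∫ ω, (|s (Y ω)| ^ r + r * F (Y ω, e ω) + 2 * r * |g (Y ω) (e ω)| ^ r) ∂P := by
        refine integral_mono ((hS.add hD).integrable_abs_rpow hr0)
          ((hSi.add (hFi.const_mul r)).add (hDi.const_mul (2 * r))) fun ω => ?_
        have := abs_add_rpow_le hr hr2 (s (Y ω)) (g (Y ω) (e ω))
        simp only [F]
        linarith
    _ = _ := by
        have hi : Integrable (fun ω => |s (Y ω)| ^ r + r * F (Y ω, e ω)) P :=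
          hSi.add (hFi.const_mul r)
        rw [integral_add hi (hDi.const_mul (2 * r)), integral_add hSi (hFi.const_mul r), integral_const_mul, integral_const_mul, hF0]
        ring

/-- The von Bahr–Esseen inequality for sums of independent centred variables. -/
theorem integral_abs_sum_rpow_le_of_iIndepFun {Ω : Type*} [MeasurableSpace Ω]
    {P : Measure Ω} [IsProbabilityMeasure P] {η : ℕ → Ω → ℝ} (hη : ∀ i, Measurable (η i))
    (hind : iIndepFun η P) (h0 : ∀ i, ∫ ω, η i ω ∂P = 0) {r : ℝ} (hr : 1 < r) (hr2 : r ≤ 2)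
    (hL : ∀ i, MemLp (η i) (ENNReal.ofReal r) P) (m : ℕ) :
    ∫ ω, |∑ i ∈ Finset.range m, η i ω| ^ r ∂P
      ≤ 2 * r * ∑ i ∈ Finset.range m, ∫ ω, |η i ω| ^ r ∂P := by
  induction m with
  | zero => simp [Real.zero_rpow (by linarith : r ≠ 0)]
  | succ m ih =>
    have hSm : Measurable fun ω => ∑ i ∈ Finset.range m, η i ω :=
      Finset.measurable_sum _ fun i _ => hη i
    have hi : IndepFun (fun ω => ∑ i ∈ Finset.range m, η i ω) (η m) P := by
      have := hind.indepFun_sum_range_succ hη m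
      convert this using 1
      ext ω; simp
    have := integral_abs_add_rpow_le_of_indepFun hSm (hη m) hi measurable_id
      (g := fun _ y => y) measurable_snd (fun x => by
        rw [integral_map (hη m).aemeasurable (by fun_prop)]; exact h0 m) hr hr2
        (memLp_finsetSum _ fun i _ => hL i) (hL m)
    simp only [id] at this
    simp only [Finset.sum_range_succ]
    linarith

/-- The partial sums form a martingale, bounded in `L^r` by von Bahr–Esseen and hence in `L^1`, so
martingale convergence applies. -/
theorem ae_exists_tendsto_sum_of_iIndepFun {Ω : Type*} [MeasurableSpace Ω]
    {P : Measure Ω} [IsProbabilityMeasure P] {η : ℕ → Ω → ℝ} (hη : ∀ i, Measurable (η i))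
    (hind : iIndepFun η P) (h0 : ∀ i, ∫ ω, η i ω ∂P = 0) {r : ℝ} (hr : 1 < r) (hr2 : r ≤ 2)
    (hL : ∀ i, MemLp (η i) (ENNReal.ofReal r) P) {B : ℝ}
    (hB : ∀ m, ∑ i ∈ Finset.range m, ∫ ω, |η i ω| ^ r ∂P ≤ B) :
    ∀ᵐ ω ∂P, ∃ l, Tendsto (fun N : ℕ => ∑ i ∈ Finset.range N, η i ω) atTop (𝓝 l) := by
  have hr0 : 0 < r := by linarith
  have hsm : ∀ i, StronglyMeasurable (η i) := fun i => (hη i).stronglyMeasurable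
  let ℱ := Filtration.natural η hsm
  -- The natural filtration at `n` already knows `η n`, hence `n + 1` summands; the shift is undone
  -- in the last line.
  let f : ℕ → Ω → ℝ := fun n ω => ∑ i ∈ Finset.range (n + 1), η i ω
  have h1r : (1 : ℝ≥0∞) ≤ ENNReal.ofReal r := by
    rw [← ENNReal.ofReal_one]; exact ENNReal.ofReal_le_ofReal hr.le
  have hint : ∀ i, Integrable (η i) P := fun i => (hL i).integrable h1r
  have hfL : ∀ n, MemLp (f n) (ENNReal.ofReal r) P := fun n => memLp_finsetSum _ fun i _ => hL i
  have hmart : Martingale f ℱ P := by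
    refine martingale_nat ?_ (fun n => (hfL n).integrable h1r) fun n => ?_
    · intro n
      refine Finset.stronglyMeasurable_fun_sum _ fun i hi => ?_
      exact (Filtration.stronglyAdapted_natural hsm i).mono
        (ℱ.mono (Nat.lt_succ_iff.1 (Finset.mem_range.1 hi)))
    · have hfn : f (n + 1) = f n + η (n + 1) := by
        ext ω; simp [f, Finset.sum_range_succ]
      have h1 : P[f n | ℱ n] = f n := by
        refine condExp_of_stronglyMeasurable (ℱ.le n) ?_ ((hfL n).integrable h1r)
        refine Finset.stronglyMeasurable_fun_sum _ fun i hi => ?_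
        exact (Filtration.stronglyAdapted_natural hsm i).mono
          (ℱ.mono (Nat.lt_succ_iff.1 (Finset.mem_range.1 hi)))
      have h2 := hind.condExp_natural_ae_eq_of_lt hsm (Nat.lt_succ_self n)
      rw [hfn]
      filter_upwards [condExp_add ((hfL n).integrable h1r) (hint (n + 1)) (ℱ n), h2]
        with ω h3 h4
      rw [h3, Pi.add_apply, h1, h4, h0, add_zero]
  have hbdd : ∀ n, eLpNorm (f n) 1 P ≤ ((((2 * r * B) ^ (1 / r)).toNNReal : NNReal) : ℝ≥0∞) := by
    intro n
    refine (eLpNorm_le_eLpNorm_of_exponent_le h1r (hfL n).1).trans ?_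
    rw [(hfL n).eLpNorm_eq_ofReal_integral hr0]
    refine ENNReal.ofReal_le_ofReal (Real.rpow_le_rpow
      (integral_nonneg fun ω => Real.rpow_nonneg (abs_nonneg _) _) ?_ (by positivity))
    refine (integral_abs_sum_rpow_le_of_iIndepFun hη hind h0 hr hr2 hL (n + 1)).trans ?_
    exact mul_le_mul_of_nonneg_left (hB _) (by positivity)
  filter_upwards [hmart.submartingale.ae_tendsto_limitProcess hbdd] with ω hω
  exact ⟨_, (tendsto_add_atTop_iff_nat (f := fun N : ℕ => ∑ i ∈ Finset.range N, η i ω) 1).1 hω⟩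

/-- Fatou's lemma carries the von Bahr–Esseen bound from the partial sums to their limit. -/
theorem eLpNorm_le_of_tendsto_sum_of_iIndepFun {Ω : Type*} [MeasurableSpace Ω]
    {P : Measure Ω} [IsProbabilityMeasure P] {η : ℕ → Ω → ℝ} (hη : ∀ i, Measurable (η i))
    (hind : iIndepFun η P) (h0 : ∀ i, ∫ ω, η i ω ∂P = 0) {r : ℝ} (hr : 1 < r) (hr2 : r ≤ 2)
    (hL : ∀ i, MemLp (η i) (ENNReal.ofReal r) P) {B : ℝ}
    (hB : ∀ m, ∑ i ∈ Finset.range m, ∫ ω, |η i ω| ^ r ∂P ≤ B) {Y : Ω → ℝ}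
    (hY : ∀ᵐ ω ∂P, Tendsto (fun N : ℕ => ∑ i ∈ Finset.range N, η i ω) atTop (𝓝 (Y ω))) :
    eLpNorm Y (ENNReal.ofReal r) P ≤ ENNReal.ofReal ((2 * r * B) ^ (1 / r)) := by
  have hfL : ∀ n, MemLp (fun ω => ∑ i ∈ Finset.range n, η i ω) (ENNReal.ofReal r) P :=
    fun n => memLp_finsetSum _ fun i _ => hL i
  refine (Lp.eLpNorm_lim_le_liminf_eLpNorm (fun n => (hfL n).1) Y hY).trans ?_
  refine liminf_le_of_frequently_le' (Frequently.of_forall fun n => ?_)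
  rw [(hfL n).eLpNorm_eq_ofReal_integral (by linarith)]
  refine ENNReal.ofReal_le_ofReal (Real.rpow_le_rpow
    (integral_nonneg fun ω => Real.rpow_nonneg (abs_nonneg _) _) ?_ (by positivity))
  refine (integral_abs_sum_rpow_le_of_iIndepFun hη hind h0 hr hr2 hL n).trans ?_
  exact mul_le_mul_of_nonneg_left (hB _) (by positivity)

/-! ### Smooth functions of polynomial growth. -/

theorem abs_integral_le_of_abs_le {S : Type*} [MeasurableSpace S] {ρ : Measure S} {f g : S → ℝ}
    (hg : Integrable g ρ) (h : ∀ x, |f x| ≤ g x) : |∫ x, f x ∂ρ| ≤ ∫ x, g x ∂ρ := by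
  rw [← Real.norm_eq_abs]
  exact norm_integral_le_of_norm_le hg (Eventually.of_forall h)

theorem min_self_rpow_le_rpow {γ q t : ℝ} (hγ : γ ≤ q) (hq : q ≤ 1) (ht : 0 ≤ t) :
    min t (t ^ γ) ≤ t ^ q := by
  rcases ht.eq_or_lt with rfl | ht'
  · exact (min_le_left _ _).trans (Real.rpow_nonneg le_rfl _)
  rcases le_total t 1 with h | h
  · refine (min_le_left _ _).trans ?_
    simpa using Real.rpow_le_rpow_of_exponent_ge ht' h hq
  · exact (min_le_right _ _).trans (Real.rpow_le_rpow_of_exponent_le h hγ)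

/-- `K` is differentiable with derivative `K'`, both grow at most like `(1 + |y|) ^ γ`, and the
increments of `K'` are controlled by `(1 + |y|) ^ γ * min |z| (|z| ^ γ)`. -/
structure SmoothGrowth (γ C : ℝ) (K K' : ℝ → ℝ) : Prop where
  hasDerivAt : ∀ y, HasDerivAt K (K' y) y
  abs_le : ∀ y, |K y| ≤ C * (1 + |y|) ^ γ
  abs_deriv_le : ∀ y, |K' y| ≤ C * (1 + |y|) ^ γ
  abs_deriv_sub_le : ∀ y z, |K' (y + z) - K' y| ≤ C * (1 + |y|) ^ γ * min |z| (|z| ^ γ)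

namespace SmoothGrowth

variable {γ C : ℝ} {K K' : ℝ → ℝ}

theorem const_nonneg (h : SmoothGrowth γ C K K') : 0 ≤ C := by
  have := (abs_nonneg _).trans (h.abs_le 0)
  simpa using this

theorem continuous (h : SmoothGrowth γ C K K') : Continuous K :=
  continuous_iff_continuousAt.2 fun y => (h.hasDerivAt y).continuousAt

theorem measurable_deriv (h : SmoothGrowth γ C K K') : Measurable K' := by
  have : K' = deriv K := funext fun y => (h.hasDerivAt y).deriv.symm
  rw [this]; exact _root_.measurable_deriv K

/-- The increment of `K'` is linear for small `z` and of order `|z|^γ` for large `z`, so any power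
`q - 1` in `[γ, 1]` dominates both. This freedom matters: `q` will be `p / r`, which puts `|e|^q` in
`L^r` when `e` has a `p`-th moment. -/
theorem abs_taylor_le (h : SmoothGrowth γ C K K') {q : ℝ} (hq1 : 1 ≤ q) (hq : 1 + γ ≤ q)
    (hq2 : q ≤ 2) (y z : ℝ) :
    |K (y + z) - K y - K' y * z| ≤ C * (1 + |y|) ^ γ * |z| ^ q := by
  let f : ℝ → ℝ := fun s => K (y + s * z)
  have hf : ∀ s, HasDerivAt f (K' (y + s * z) * z) s := by
    intro s
    have h1 : HasDerivAt (fun s : ℝ => y + s * z) z s := by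
      simpa using ((hasDerivAt_id s).mul_const z).const_add y
    exact (h.hasDerivAt (y + s * z)).comp s h1
  obtain ⟨c, hc, hce⟩ := exists_hasDerivAt_eq_slope f _ (zero_lt_one)
    (fun s _ => (hf s).continuousAt.continuousWithinAt) (fun s _ => hf s)
  have h2 : K (y + z) - K y = K' (y + c * z) * z := by rw [hce]; simp [f]
  have h3 := h.abs_deriv_sub_le y (c * z)
  have h4 : min |c * z| (|c * z| ^ γ) ≤ |z| ^ (q - 1) := by
    refine (min_self_rpow_le_rpow (q := q - 1) (by linarith) (by linarith)
      (abs_nonneg _)).trans (Real.rpow_le_rpow (abs_nonneg _) ?_ (by linarith))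
    rw [abs_mul, abs_of_pos hc.1]
    exact mul_le_of_le_one_left (abs_nonneg _) hc.2.le
  rw [h2, ← sub_mul, abs_mul]
  have hw : 0 ≤ C * (1 + |y|) ^ γ := mul_nonneg h.const_nonneg (by positivity)
  calc _ ≤ C * (1 + |y|) ^ γ * |z| ^ (q - 1) * |z| :=
        mul_le_mul_of_nonneg_right (h3.trans (mul_le_mul_of_nonneg_left h4 hw)) (abs_nonneg _)
    _ = C * (1 + |y|) ^ γ * |z| ^ q := by
      rcases eq_or_ne z 0 with rfl | hz
      · simp [Real.zero_rpow (by linarith : q ≠ 0)]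
      · rw [mul_assoc, ← Real.rpow_add_one (abs_ne_zero.2 hz)]; simp

theorem abs_deriv_sub_zero_le (h : SmoothGrowth γ C K K') (z : ℝ) :
    |K' z - K' 0| ≤ C * |z| := by
  have := h.abs_deriv_sub_le 0 z
  simp only [zero_add, abs_zero, add_zero, Real.one_rpow, mul_one] at this
  exact this.trans (mul_le_mul_of_nonneg_left (min_le_left _ _) h.const_nonneg)

theorem abs_sub_zero_le (h : SmoothGrowth γ C K K') {q : ℝ} (hq1 : 1 ≤ q) (hq : 1 + γ ≤ q)
    (hq2 : q ≤ 2) (z : ℝ) : |K z - K 0| ≤ C * |z| + C * |z| ^ q := by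
  have h1 := h.abs_taylor_le hq1 hq hq2 0 z
  have h2 := h.abs_deriv_le 0
  simp only [zero_add, abs_zero, add_zero, Real.one_rpow, mul_one] at h1 h2
  have h3 : |K' 0 * z| ≤ C * |z| := by
    rw [abs_mul]; exact mul_le_mul_of_nonneg_right h2 (abs_nonneg _)
  have : K z - K 0 = (K z - K 0 - K' 0 * z) + K' 0 * z := by ring
  rw [this]
  exact (abs_add_le _ _).trans (by linarith)

theorem integrable_comp_add (h : SmoothGrowth γ C K K') (hγ : 0 ≤ γ) {ρ : Measure ℝ}
    (hρ : Integrable (fun x => (1 + |x|) ^ γ) ρ) (y : ℝ) :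
    Integrable (fun x => K (y + x)) ρ := by
  refine (hρ.const_mul (C * (1 + |y|) ^ γ)).mono'
    (h.continuous.measurable.comp (measurable_const_add y)).aestronglyMeasurable
    (Eventually.of_forall fun x => ?_)
  rw [mul_assoc]
  exact (h.abs_le _).trans
    (mul_le_mul_of_nonneg_left (one_add_abs_add_rpow_le hγ y x) h.const_nonneg)

theorem integrable_deriv_comp_add (h : SmoothGrowth γ C K K') (hγ : 0 ≤ γ) {ρ : Measure ℝ}
    (hρ : Integrable (fun x => (1 + |x|) ^ γ) ρ) (y : ℝ) :
    Integrable (fun x => K' (y + x)) ρ := by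
  refine (hρ.const_mul (C * (1 + |y|) ^ γ)).mono'
    (h.measurable_deriv.comp (measurable_const_add y)).aestronglyMeasurable
    (Eventually.of_forall fun x => ?_)
  rw [mul_assoc]
  exact (h.abs_deriv_le _).trans
    (mul_le_mul_of_nonneg_left (one_add_abs_add_rpow_le hγ y x) h.const_nonneg)

/-- Averaging over translations preserves `SmoothGrowth`. -/
theorem average (h : SmoothGrowth γ C K K') (hγ : 0 ≤ γ) {ρ : Measure ℝ}
    (hρ : Integrable (fun x => (1 + |x|) ^ γ) ρ) {M : ℝ} (hM : ∫ x, (1 + |x|) ^ γ ∂ρ ≤ M) :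
    SmoothGrowth γ (C * M) (fun y => ∫ x, K (y + x) ∂ρ) (fun y => ∫ x, K' (y + x) ∂ρ) := by
  have hC := h.const_nonneg
  have hbound : ∀ (f : ℝ → ℝ) (D : ℝ), 0 ≤ D → (∀ x, |f x| ≤ C * D * (1 + |x|) ^ γ) →
      |∫ x, f x ∂ρ| ≤ C * M * D := by
    intro f D hD hf
    calc |∫ x, f x ∂ρ| ≤ ∫ x, C * D * (1 + |x|) ^ γ ∂ρ :=
          abs_integral_le_of_abs_le (hρ.const_mul _) hf
      _ = C * D * ∫ x, (1 + |x|) ^ γ ∂ρ := integral_const_mul _ _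
      _ ≤ C * D * M := mul_le_mul_of_nonneg_left hM (by positivity)
      _ = C * M * D := by ring
  refine ⟨fun y => ?_, fun y => ?_, fun y => ?_, fun y z => ?_⟩
  -- On the unit ball around `y` the weight of `y'` is at most `(1 + (|y| + 1))^γ`, which gives an
  -- integrable dominating function.
  · refine (hasDerivAt_integral_of_dominated_loc_of_deriv_le (F := fun y x => K (y + x))
      (F' := fun y x => K' (y + x)) (bound := fun x => C * (1 + (|y| + 1)) ^ γ * (1 + |x|) ^ γ)
      (Metric.ball_mem_nhds y one_pos)
      (Eventually.of_forall fun y' => (h.integrable_comp_add hγ hρ y').1)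
      (h.integrable_comp_add hγ hρ y) (h.integrable_deriv_comp_add hγ hρ y).1
      (Eventually.of_forall fun x y' hy' => ?_) (hρ.const_mul _)
      (Eventually.of_forall fun x y' _ => ?_)).2
    · rw [mul_assoc]
      refine (h.abs_deriv_le _).trans (mul_le_mul_of_nonneg_left
        ((one_add_abs_add_rpow_le hγ y' x).trans
          (mul_le_mul_of_nonneg_right ?_ (by positivity))) hC)
      refine Real.rpow_le_rpow (by positivity) ?_ hγ
      have h1 : |y' - y| < 1 := by simpa [Real.dist_eq] using hy'
      have h2 := abs_sub_abs_le_abs_sub y' y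
      linarith
    · exact (h.hasDerivAt (y' + x)).comp_add_const y' x
  · refine hbound _ _ (by positivity) fun x => ?_
    rw [mul_assoc]
    exact (h.abs_le _).trans (mul_le_mul_of_nonneg_left (one_add_abs_add_rpow_le hγ y x) hC)
  · refine hbound _ _ (by positivity) fun x => ?_
    rw [mul_assoc]
    exact (h.abs_deriv_le _).trans
      (mul_le_mul_of_nonneg_left (one_add_abs_add_rpow_le hγ y x) hC)
  · rw [← integral_sub (h.integrable_deriv_comp_add hγ hρ _)
      (h.integrable_deriv_comp_add hγ hρ _), mul_assoc]
    refine hbound _ _ (by positivity) fun x => ?_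
    have h1 := h.abs_deriv_sub_le (y + x) z
    rw [show y + x + z = y + z + x by ring] at h1
    refine h1.trans ?_
    have h2 := mul_le_mul_of_nonneg_left (one_add_abs_add_rpow_le hγ y x) hC
    calc _ ≤ C * ((1 + |y|) ^ γ * (1 + |x|) ^ γ) * min |z| (|z| ^ γ) :=
          mul_le_mul_of_nonneg_right h2 (by positivity)
      _ = _ := by ring

/-- Needed because the smoothing innovation enters multiplied by a coefficient. Of the three factors
`1 + |b|`, one pays for the chain rule, one for the weight and one for the increment. -/
theorem comp_mul (h : SmoothGrowth γ C K K') (hγ : 0 ≤ γ) (hγ1 : γ ≤ 1) (b : ℝ) :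
    SmoothGrowth γ (C * (1 + |b|) ^ 3) (fun y => K (b * y)) (fun y => b * K' (b * y)) := by
  have hC := h.const_nonneg
  have hb := abs_nonneg b
  have hbγ : (1 + |b|) ^ γ ≤ 1 + |b| := by
    simpa using Real.rpow_le_rpow_of_exponent_le (by linarith : 1 ≤ 1 + |b|) hγ1
  have hw : ∀ y, (1 + |b * y|) ^ γ ≤ (1 + |b|) * (1 + |y|) ^ γ := by
    intro y
    calc (1 + |b * y|) ^ γ ≤ ((1 + |b|) * (1 + |y|)) ^ γ := by
          refine Real.rpow_le_rpow (by positivity) ?_ hγ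
          rw [abs_mul]; nlinarith [abs_nonneg y]
      _ = (1 + |b|) ^ γ * (1 + |y|) ^ γ := Real.mul_rpow (by positivity) (by positivity)
      _ ≤ _ := mul_le_mul_of_nonneg_right hbγ (by positivity)
  have hm : ∀ z, min |b * z| (|b * z| ^ γ) ≤ (1 + |b|) * min |z| (|z| ^ γ) := by
    intro z
    rw [mul_min_of_nonneg _ _ (by positivity)]
    refine min_le_min ?_ ?_
    · rw [abs_mul]; nlinarith [abs_nonneg z]
    · rw [abs_mul, Real.mul_rpow (abs_nonneg _) (abs_nonneg _)]
      refine mul_le_mul_of_nonneg_right (le_trans ?_ hbγ) (by positivity)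
      exact Real.rpow_le_rpow (abs_nonneg _) (by linarith) hγ
  have h13 : 1 + |b| ≤ (1 + |b|) ^ 3 := by nlinarith [mul_nonneg hb hb, pow_nonneg hb 3]
  have h23 : |b| * (1 + |b|) ≤ (1 + |b|) ^ 3 := by nlinarith [mul_nonneg hb hb, pow_nonneg hb 3]
  refine ⟨fun y => ?_, fun y => ?_, fun y => ?_, fun y z => ?_⟩
  · have h1 : HasDerivAt (fun y : ℝ => b * y) b y := by
      simpa using (hasDerivAt_id y).const_mul b
    rw [mul_comm b]
    exact (h.hasDerivAt (b * y)).comp y h1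
  · calc _ ≤ C * (1 + |b * y|) ^ γ := h.abs_le _
      _ ≤ C * ((1 + |b|) * (1 + |y|) ^ γ) := mul_le_mul_of_nonneg_left (hw y) hC
      _ ≤ C * ((1 + |b|) ^ 3 * (1 + |y|) ^ γ) := by gcongr
      _ = _ := by ring
  · rw [abs_mul]
    calc _ ≤ |b| * (C * (1 + |b * y|) ^ γ) := mul_le_mul_of_nonneg_left (h.abs_deriv_le _) hb
      _ ≤ |b| * (C * ((1 + |b|) * (1 + |y|) ^ γ)) := by gcongr; exact hw y
      _ = C * (|b| * (1 + |b|)) * (1 + |y|) ^ γ := by ring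
      _ ≤ C * (1 + |b|) ^ 3 * (1 + |y|) ^ γ := by gcongr
  · rw [← mul_sub, abs_mul, mul_add]
    have h1 := h.abs_deriv_sub_le (b * y) (b * z)
    calc _ ≤ |b| * (C * (1 + |b * y|) ^ γ * min |b * z| (|b * z| ^ γ)) := by gcongr
      _ ≤ |b| * (C * ((1 + |b|) * (1 + |y|) ^ γ) * ((1 + |b|) * min |z| (|z| ^ γ))) := by
        gcongr
        · exact hw y
        · exact hm z
      _ = C * (|b| * (1 + |b|) ^ 2) * (1 + |y|) ^ γ * min |z| (|z| ^ γ) := by ring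
      _ ≤ C * (1 + |b|) ^ 3 * (1 + |y|) ^ γ * min |z| (|z| ^ γ) := by
        gcongr
        nlinarith [mul_nonneg hb hb, pow_nonneg hb 3]

end SmoothGrowth

/-! ### Smoothing by convolution with a density. -/

/-- Convolving a function of growth `γ` with a density whose derivative is weighted Lipschitz
with weight `(1 + |x|) ^ (-β)`, `β > 1 + γ`, gives `SmoothGrowth` with uniform constants. -/
theorem exists_smoothGrowth_of_density {γ β Ch CG : ℝ} (hγ : 0 ≤ γ) (hγ1 : γ ≤ 1)
    (hβ : 1 + γ < β) {h h' : ℝ → ℝ} (hh : ∀ x, HasDerivAt h (h' x) x)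
    (hint : Integrable (fun x => (1 + |x|) ^ γ * |h x|))
    (hh' : ∀ x, |h' x| ≤ Ch * (1 + |x|) ^ (-β))
    (hlip : ∀ x y, |x - y| < 1 → |h' x - h' y| ≤ Ch * |x - y| * (1 + |x|) ^ (-β)) :
    ∃ C, ∀ G : ℝ → ℝ, Measurable G → (∀ x, |G x| ≤ CG * (1 + |x|) ^ γ) →
      ∃ K', SmoothGrowth γ C (fun y => ∫ x, G (y + x) * h x) K' := by
  have hCh : 0 ≤ Ch := by simpa using (abs_nonneg _).trans (hh' 0)
  have hβ0 : 0 ≤ β := by linarith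
  have hhc : Continuous h := continuous_iff_continuousAt.2 fun y => (hh y).continuousAt
  have hh'm : Measurable h' := by
    have : h' = deriv h := funext fun y => (hh y).deriv.symm
    rw [this]; exact measurable_deriv h
  set w : ℝ → ℝ := fun x => (1 + |x|) ^ (-(β - γ)) with hwdef
  have hw0 : ∀ x, 0 ≤ w x := fun x => by positivity
  have hwi : Integrable w := integrable_one_add_abs_rpow (by linarith)
  have hww : ∀ x, (1 + |x|) ^ γ * (1 + |x|) ^ (-β) = w x := by
    intro x
    rw [hwdef, ← Real.rpow_add (by positivity)]
    congr 1; ring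
  set W := ∫ x, w x with hW
  have hW0 : 0 ≤ W := integral_nonneg hw0
  set H := ∫ x, (1 + |x|) ^ γ * |h x| with hH
  have hH0 : 0 ≤ H := integral_nonneg fun x => by positivity
  -- `H` controls the function and `Ch * W` its derivative; the factor `2 ^ 2` is needed for
  -- derivative increments with `|z| ≥ 1`.
  refine ⟨|CG| * (H + 2 ^ 2 * Ch * W), fun G hGm hG => ?_⟩
  have hCG : 0 ≤ CG := by simpa using (abs_nonneg _).trans (hG 0)
  rw [abs_of_nonneg hCG]
  have hGy : ∀ x y, |G x| ≤ CG * ((1 + |y|) ^ γ * (1 + |x - y|) ^ γ) := by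
    intro x y
    have := one_add_abs_add_rpow_le hγ y (x - y)
    rw [add_sub_cancel] at this
    exact (hG x).trans (mul_le_mul_of_nonneg_left this hCG)
  have hGh' : ∀ x y, |G x * h' (x - y)| ≤ CG * Ch * (1 + |y|) ^ γ * w (x - y) := by
    intro x y
    rw [abs_mul, ← hww]
    calc _ ≤ CG * ((1 + |y|) ^ γ * (1 + |x - y|) ^ γ) * (Ch * (1 + |x - y|) ^ (-β)) :=
          mul_le_mul (hGy x y) (hh' _) (abs_nonneg _) (by positivity)
      _ = _ := by ring
  have hws : ∀ y, Integrable (fun x => w (x - y)) := fun y => hwi.comp_sub_right y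
  have hws' : ∀ y, ∫ x, w (x - y) = W := fun y => integral_sub_right_eq_self w y
  have hGh'i : ∀ y, Integrable (fun x => G x * h' (x - y)) := fun y =>
    ((hws y).const_mul _).mono'
      (hGm.mul (hh'm.comp (measurable_sub_const y))).aestronglyMeasurable
      (Eventually.of_forall fun x => hGh' x y)
  have hGhi : ∀ y, Integrable (fun x => G x * h (x - y)) := fun y => by
    refine ((hint.comp_sub_right y).const_mul (CG * (1 + |y|) ^ γ)).mono'
      (hGm.mul (hhc.measurable.comp (measurable_sub_const y))).aestronglyMeasurable
      (Eventually.of_forall fun x => ?_)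
    rw [Real.norm_eq_abs, abs_mul]
    calc _ ≤ CG * ((1 + |y|) ^ γ * (1 + |x - y|) ^ γ) * |h (x - y)| :=
          mul_le_mul_of_nonneg_right (hGy x y) (abs_nonneg _)
      _ = _ := by ring
  -- Translation moves the variable `y` from the rough `G` to `h`, so only `h` has to be
  -- differentiated.
  have hKeq : (fun y => ∫ x, G (y + x) * h x) = fun y => ∫ x, G x * h (x - y) := by
    funext y
    rw [← integral_add_left_eq_self (fun x => G x * h (x - y)) y]
    simp
  have hd : ∀ y, |∫ x, G x * h' (x - y)| ≤ CG * Ch * (1 + |y|) ^ γ * W := by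
    intro y
    calc _ ≤ ∫ x, CG * Ch * (1 + |y|) ^ γ * w (x - y) :=
          abs_integral_le_of_abs_le ((hws y).const_mul _) (hGh' · y)
      _ = _ := by rw [integral_const_mul, hws']
  rw [hKeq]
  refine ⟨fun y => ∫ x, -(G x * h' (x - y)), ⟨fun y => ?_, fun y => ?_, fun y => ?_,
    fun y z => ?_⟩⟩
  -- The factor `2 ^ β` is the cost, by Peetre's inequality, of moving the centre of the weight by
  -- less than 1.
  · refine (hasDerivAt_integral_of_dominated_loc_of_deriv_le
      (F := fun y x => G x * h (x - y)) (F' := fun y x => -(G x * h' (x - y)))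
      (bound := fun x => CG * Ch * (1 + |y|) ^ γ * 2 ^ β * w (x - y))
      (Metric.ball_mem_nhds y one_pos) (Eventually.of_forall fun y' => (hGhi y').1)
      (hGhi y) (hGh'i y).neg.1 (Eventually.of_forall fun x y' hy' => ?_)
      ((hws y).const_mul _) (Eventually.of_forall fun x y' _ => ?_)).2
    · have h1 : |y - y'| < 1 := by simpa [Real.dist_eq, abs_sub_comm] using hy'
      have h2 := one_add_abs_rpow_neg_le hβ0 (x - y) (y - y')
      rw [sub_add_sub_cancel] at h2
      have h3 : (1 + |y - y'|) ^ β ≤ 2 ^ β :=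
        Real.rpow_le_rpow (by positivity) (by linarith) hβ0
      rw [norm_neg, Real.norm_eq_abs, abs_mul, ← hww]
      calc _ ≤ CG * ((1 + |y|) ^ γ * (1 + |x - y|) ^ γ)
            * (Ch * ((1 + |x - y|) ^ (-β) * 2 ^ β)) := by
            refine mul_le_mul (hGy x y) ((hh' _).trans (mul_le_mul_of_nonneg_left
              (h2.trans (mul_le_mul_of_nonneg_left h3 (by positivity))) hCh))
              (abs_nonneg _) (by positivity)
        _ = _ := by ring
    · have := ((hh (x - y')).comp_const_sub x y').const_mul (G x)
      rwa [mul_neg] at this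
  · calc _ ≤ ∫ x, CG * (1 + |y|) ^ γ * ((1 + |x - y|) ^ γ * |h (x - y)|) := by
          refine abs_integral_le_of_abs_le ((hint.comp_sub_right y).const_mul _)
            fun x => ?_
          rw [abs_mul]
          calc _ ≤ CG * ((1 + |y|) ^ γ * (1 + |x - y|) ^ γ) * |h (x - y)| :=
                mul_le_mul_of_nonneg_right (hGy x y) (abs_nonneg _)
            _ = _ := by ring
      _ = CG * (1 + |y|) ^ γ * H := by
          rw [integral_const_mul, integral_sub_right_eq_self (fun x => (1 + |x|) ^ γ * |h x|) y]
      _ = CG * H * (1 + |y|) ^ γ := by ring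
      _ ≤ _ := by gcongr; exact le_add_of_nonneg_right (by positivity)
  · rw [integral_neg, abs_neg]
    refine (hd y).trans ?_
    calc _ = CG * (Ch * W) * (1 + |y|) ^ γ := by ring
      _ ≤ _ := by
        gcongr
        nlinarith [mul_nonneg hCh hW0]
  · rw [integral_neg, integral_neg, ← neg_sub_neg, neg_neg, neg_neg]
    rcases lt_or_ge |z| 1 with hz | hz
    · have hmin : min |z| (|z| ^ γ) = |z| := by
        rcases eq_or_ne z 0 with rfl | hz0
        · simpa using Real.rpow_nonneg le_rfl γ
        · refine min_eq_left ?_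
          simpa using Real.rpow_le_rpow_of_exponent_ge (abs_pos.2 hz0) hz.le hγ1
      rw [hmin, ← integral_sub (hGh'i y) (hGh'i (y + z))]
      calc _ ≤ ∫ x, CG * Ch * |z| * (1 + |y|) ^ γ * w (x - y) := by
            refine abs_integral_le_of_abs_le ((hws y).const_mul _) fun x => ?_
            have h1 := hlip (x - y) (x - (y + z)) (by simpa using hz)
            rw [show x - y - (x - (y + z)) = z by ring] at h1
            rw [← mul_sub, abs_mul, ← hww]
            calc _ ≤ CG * ((1 + |y|) ^ γ * (1 + |x - y|) ^ γ)
                  * (Ch * |z| * (1 + |x - y|) ^ (-β)) :=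
                  mul_le_mul (hGy x y) h1 (abs_nonneg _) (by positivity)
              _ = _ := by ring
        _ = CG * (Ch * W) * (1 + |y|) ^ γ * |z| := by
            rw [integral_const_mul, hws']; ring
        _ ≤ _ := by
          gcongr
          nlinarith [mul_nonneg hCh hW0]
    -- For large `z` there is no cancellation to exploit: the two derivatives are bounded
    -- separately, and `1 + 2 |z|^γ ≤ 4 |z|^γ`.
    · have hz0 : (1 : ℝ) ≤ |z| ^ γ := Real.one_le_rpow hz hγ
      have hmin : min |z| (|z| ^ γ) = |z| ^ γ := by
        refine min_eq_right ?_
        simpa using Real.rpow_le_rpow_of_exponent_le hz hγ1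
      have h2 : (1 + |y + z|) ^ γ ≤ (1 + |y|) ^ γ * (2 * |z| ^ γ) := by
        refine (one_add_abs_add_rpow_le hγ y z).trans
          (mul_le_mul_of_nonneg_left ?_ (by positivity))
        calc (1 + |z|) ^ γ ≤ (2 * |z|) ^ γ :=
              Real.rpow_le_rpow (by positivity) (by linarith) hγ
          _ = 2 ^ γ * |z| ^ γ := Real.mul_rpow (by norm_num) (abs_nonneg _)
          _ ≤ 2 * |z| ^ γ := by
            gcongr
            simpa using Real.rpow_le_rpow_of_exponent_le (by norm_num : (1 : ℝ) ≤ 2) hγ1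
      rw [hmin]
      have h3 := abs_sub (∫ x, G x * h' (x - y)) (∫ x, G x * h' (x - (y + z)))
      have h4 := hd y
      have h5 := hd (y + z)
      have hP : 0 ≤ CG * Ch * W := by positivity
      calc _ ≤ CG * Ch * (1 + |y|) ^ γ * W + CG * Ch * ((1 + |y|) ^ γ * (2 * |z| ^ γ)) * W := by
            refine h3.trans (add_le_add h4 (h5.trans ?_))
            gcongr
        _ = CG * Ch * W * (1 + |y|) ^ γ * (1 + 2 * |z| ^ γ) := by ring
        _ ≤ CG * Ch * W * (1 + |y|) ^ γ * (4 * |z| ^ γ) := by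
            gcongr; linarith
        _ = CG * (2 ^ 2 * Ch * W) * (1 + |y|) ^ γ * |z| ^ γ := by ring
        _ ≤ _ := by gcongr; linarith

/-! ### Densities obtained from characteristic functions by Fourier inversion. -/

/-- A finite measure whose characteristic function is the Fourier transform of an integrable
function `h` has density `h`. -/
theorem integral_eq_integral_mul_of_charFun {ρ : Measure ℝ} [IsFiniteMeasure ρ] {h : ℝ → ℝ}
    (hm : Measurable h) (hi : Integrable h)
    (hc : ∀ t : ℝ, charFun ρ t = ∫ x : ℝ, Complex.exp (t * x * Complex.I) * (h x : ℂ))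
    {G : ℝ → ℝ} (hG : Measurable G) (hGi : Integrable fun x => G x * h x) :
    ∫ x, G x ∂ρ = ∫ x, G x * h x := by
  -- The sign of `h` is not known in advance. Splitting into positive and negative parts turns the
  -- claim into the identity `ρ + μm = μp` of finite measures, which follows from uniqueness of
  -- characteristic functions.
  let μp : Measure ℝ := volume.withDensity fun x => ENNReal.ofReal (h x)
  let μm : Measure ℝ := volume.withDensity fun x => ENNReal.ofReal (-h x)
  have hmp : Measurable fun x => ENNReal.ofReal (h x) := hm.ennreal_ofReal
  have hmm : Measurable fun x => ENNReal.ofReal (-h x) := hm.neg.ennreal_ofReal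
  have hpf : IsFiniteMeasure μp := isFiniteMeasure_withDensity_ofReal hi.2
  have hmf : IsFiniteMeasure μm := isFiniteMeasure_withDensity_ofReal hi.neg.2
  have hsub : ∀ x, (ENNReal.ofReal (h x)).toReal - (ENNReal.ofReal (-h x)).toReal = h x := by
    intro x
    rcases le_total 0 (h x) with h0 | h0
    · rw [ENNReal.toReal_ofReal h0, ENNReal.ofReal_of_nonpos (by linarith)]; simp
    · rw [ENNReal.ofReal_of_nonpos h0, ENNReal.toReal_ofReal (by linarith)]; simp
  have habs : ∀ x, (ENNReal.ofReal (h x)).toReal ≤ |h x|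
      ∧ (ENNReal.ofReal (-h x)).toReal ≤ |h x| := by
    intro x
    constructor
    · rw [ENNReal.toReal_ofReal']; exact max_le (le_abs_self _) (abs_nonneg _)
    · rw [ENNReal.toReal_ofReal']; exact max_le (neg_le_abs _) (abs_nonneg _)
  have hp_int : ∀ f : ℝ → ℂ, ∫ x, f x ∂μp = ∫ x, (ENNReal.ofReal (h x)).toReal • f x := fun f =>
    integral_withDensity_eq_integral_toReal_smul hmp (by simp) f
  have hm_int : ∀ f : ℝ → ℂ, ∫ x, f x ∂μm = ∫ x, (ENNReal.ofReal (-h x)).toReal • f x := fun f =>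
    integral_withDensity_eq_integral_toReal_smul hmm (by simp) f
  have heq : ρ + μm = μp := by
    refine Measure.ext_of_charFun (funext fun t => ?_)
    have hb : ∀ ν : Measure ℝ, IsFiniteMeasure ν →
        Integrable (fun x : ℝ => Complex.exp (t * x * Complex.I)) ν := by
      intro ν _
      refine (integrable_const (1 : ℝ)).mono' (by fun_prop) (Eventually.of_forall fun x => ?_)
      rw [show (t * x * Complex.I : ℂ) = ((t * x : ℝ) : ℂ) * Complex.I by push_cast; ring,
        Complex.norm_exp_ofReal_mul_I]
    have hbv : ∀ k : ℝ → ℝ, Measurable k → (∀ x, |k x| ≤ |h x|) →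
        Integrable (fun x : ℝ => k x • Complex.exp (t * x * Complex.I)) := by
      intro k hk hkh
      refine hi.abs.mono' (by fun_prop) (Eventually.of_forall fun x => ?_)
      rw [norm_smul, show (t * x * Complex.I : ℂ) = ((t * x : ℝ) : ℂ) * Complex.I by
        push_cast; ring, Complex.norm_exp_ofReal_mul_I, mul_one]
      exact hkh x
    rw [charFun_apply_real, integral_add_measure (hb _ inferInstance) (hb _ hmf),
      ← charFun_apply_real, hc, charFun_apply_real, hp_int, hm_int, ← eq_sub_iff_add_eq,
      ← integral_sub]
    · congr 1
      funext x
      rw [← sub_smul, hsub, mul_comm]; simp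
    · refine hbv _ hmp.ennreal_toReal fun x => ?_
      rw [abs_of_nonneg ENNReal.toReal_nonneg]; exact (habs x).1
    · refine hbv _ hmm.ennreal_toReal fun x => ?_
      rw [abs_of_nonneg ENNReal.toReal_nonneg]; exact (habs x).2
  have hGv : ∀ k : ℝ → ℝ, Measurable k → (∀ x, |k x| ≤ |h x|) →
      Integrable (fun x : ℝ => k x • G x) := by
    intro k hk hkh
    refine hGi.abs.mono' (by fun_prop) (Eventually.of_forall fun x => ?_)
    rw [norm_smul, abs_mul, mul_comm]
    exact mul_le_mul_of_nonneg_left (hkh x) (abs_nonneg _)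
  have hGp := hGv _ hmp.ennreal_toReal fun x => by
    rw [abs_of_nonneg ENNReal.toReal_nonneg]; exact (habs x).1
  have hGm := hGv _ hmm.ennreal_toReal fun x => by
    rw [abs_of_nonneg ENNReal.toReal_nonneg]; exact (habs x).2
  have hGμp : Integrable G μp :=
    (integrable_withDensity_iff_integrable_smul' hmp (by simp)).2 hGp
  have hGμm : Integrable G μm :=
    (integrable_withDensity_iff_integrable_smul' hmm (by simp)).2 hGm
  have hGρ : Integrable G ρ := by
    rw [← heq] at hGμp
    exact hGμp.left_of_add_measure
  have h1 : ∫ x, G x ∂ρ + ∫ x, G x ∂μm = ∫ x, G x ∂μp := by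
    rw [← heq, integral_add_measure hGρ hGμm]
  rw [eq_sub_of_add_eq h1, integral_withDensity_eq_integral_toReal_smul hmp (by simp),
    integral_withDensity_eq_integral_toReal_smul hmm (by simp), ← integral_sub hGp hGm]
  congr 1
  funext x
  rw [← sub_smul, hsub, smul_eq_mul, mul_comm]

/-- If the characteristic function of `ρ` (in the normalization of the Fourier transform) has two
derivatives decaying like `(1 + |s|) ^ (-4)`, then `ρ` has a density with derivative decaying
like `(1 + |x|) ^ (-2)` and weighted Lipschitz. -/
theorem exists_density_of_charFun_decay {ρ : Measure ℝ} [IsFiniteMeasure ρ] {f : ℝ → ℂ}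
    (hf : ∀ s, f s = charFun ρ (2 * Real.pi * s)) (hf2 : ContDiff ℝ 2 f) {C : ℝ}
    (hfC : ∀ n ≤ 2, ∀ s, ‖iteratedFDeriv ℝ n f s‖ ≤ C * (1 + |s|) ^ (-4 : ℝ)) :
    ∃ (h h' : ℝ → ℝ) (D : ℝ), (∀ x, HasDerivAt h (h' x) x)
      ∧ (∀ x, |h x| ≤ D * (1 + |x|) ^ (-2 : ℝ)) ∧ (∀ x, |h' x| ≤ D * (1 + |x|) ^ (-2 : ℝ))
      ∧ (∀ x y, |x - y| < 1 → |h' x - h' y| ≤ D * |x - y| * (1 + |x|) ^ (-2 : ℝ))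
      ∧ ∀ G : ℝ → ℝ, Measurable G → Integrable (fun x => G x * h x) →
        ∫ x, G x ∂ρ = ∫ x, G x * h x := by
  have hC : 0 ≤ C := by simpa using (norm_nonneg _).trans (hfC 0 (by norm_num) 0)
  have hw2 : Integrable (fun x : ℝ => (1 + |x|) ^ (-2 : ℝ)) :=
    integrable_one_add_abs_rpow (by norm_num)
  -- Decay of order 4 leaves order 2, which is integrable, after multiplication by `|v|^2`.
  have hfi : ∀ k n : ℕ, k ≤ 2 → n ≤ 2 →
      Integrable (fun v : ℝ => ‖v‖ ^ k * ‖iteratedFDeriv ℝ n f v‖) := by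
    intro k n hk hn
    have hcont : Continuous (iteratedFDeriv ℝ n f) :=
      hf2.continuous_iteratedFDeriv (by exact_mod_cast hn)
    refine (hw2.const_mul C).mono' (by fun_prop) (Eventually.of_forall fun v => ?_)
    rw [Real.norm_of_nonneg (by positivity), Real.norm_eq_abs]
    calc |v| ^ k * ‖iteratedFDeriv ℝ n f v‖
        ≤ (1 + |v|) ^ (2 : ℝ) * (C * (1 + |v|) ^ (-4 : ℝ)) := by
          refine mul_le_mul ?_ (hfC n hn v) (norm_nonneg _) (by positivity)
          calc |v| ^ k ≤ (1 + |v|) ^ k := by gcongr; linarith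
            _ ≤ (1 + |v|) ^ 2 := pow_le_pow_right₀ (by linarith [abs_nonneg v]) hk
            _ = _ := by norm_cast
      _ = C * ((1 + |v|) ^ (2 : ℝ) * (1 + |v|) ^ (-4 : ℝ)) := by ring
      _ = C * (1 + |v|) ^ (-2 : ℝ) := by
          rw [← Real.rpow_add (by positivity)]; norm_num
  -- `g` is the candidate density. Two moments of `f` make `g` twice differentiable, and two
  -- integrable derivatives of `f` make `g`, `g'`, `g''` decay quadratically.
  open FourierTransform in
  let g : ℝ → ℂ := 𝓕 f
  have hg2 : ContDiff ℝ 2 g := by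
    refine Real.contDiff_fourier (N := 2) fun n hn => ?_
    have := hfi n 0 (by exact_mod_cast hn) (by norm_num)
    simpa using this
  obtain ⟨B, hB0, hB⟩ : ∃ B, 0 ≤ B ∧ ∀ k ≤ 2, ∀ n ≤ 2, ∀ w : ℝ,
      ‖w‖ ^ n * ‖iteratedFDeriv ℝ k g w‖ ≤ B := by
    let b : ℕ → ℕ → ℝ := fun k n => (2 * Real.pi) ^ k * (2 * k + 2) ^ n *
      ∑ p ∈ Finset.range (k + 1) ×ˢ Finset.range (n + 1),
        ∫ v, ‖v‖ ^ p.1 * ‖iteratedFDeriv ℝ p.2 f v‖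
    have hb : ∀ k n, 0 ≤ b k n := fun k n =>
      mul_nonneg (by have := Real.pi_pos; positivity)
        (Finset.sum_nonneg fun p _ => integral_nonneg fun v => by positivity)
    refine ⟨∑ k ∈ Finset.range 3, ∑ n ∈ Finset.range 3, b k n,
      Finset.sum_nonneg fun k _ => Finset.sum_nonneg fun n _ => hb k n, fun k hk n hn w => ?_⟩
    refine (Real.pow_mul_norm_iteratedFDeriv_fourier_le (K := 2) (N := 2) hf2
      (fun k n hk hn => hfi k n (by exact_mod_cast hk) (by exact_mod_cast hn))
      (by exact_mod_cast hk) (by exact_mod_cast hn) w).trans ?_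
    refine (Finset.single_le_sum (f := fun n => b k n) (fun n _ => hb k n)
      (Finset.mem_range.2 (Nat.lt_succ_of_le hn))).trans ?_
    exact Finset.single_le_sum (f := fun k => ∑ n ∈ Finset.range 3, b k n)
      (fun k _ => Finset.sum_nonneg fun n _ => hb k n) (Finset.mem_range.2 (Nat.lt_succ_of_le hk))
  -- The powers 0 and 2 are combined through `(1 + |w|)^2 ≤ 2 (1 + |w|^2)`.
  have hdec : ∀ k ≤ 2, ∀ w : ℝ, ‖iteratedDeriv k g w‖ ≤ 4 * B * (1 + |w|) ^ (-2 : ℝ) := by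
    intro k hk w
    rw [← norm_iteratedFDeriv_eq_norm_iteratedDeriv, Real.rpow_neg (by positivity),
      ← div_eq_mul_inv, le_div_iff₀ (by positivity)]
    have h0 := hB k hk 0 (by norm_num) w
    have h2 := hB k hk 2 le_rfl w
    rw [Real.norm_eq_abs] at h2
    norm_num at h0 ⊢
    nlinarith [norm_nonneg (iteratedFDeriv ℝ k g w), sq_nonneg (|w| - 1), abs_nonneg w,
      mul_nonneg (norm_nonneg (iteratedFDeriv ℝ k g w)) (sq_nonneg (|w| - 1))]
  have hd1 : ∀ x, HasDerivAt g (deriv g x) x := fun x =>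
    ((hg2.differentiable (by norm_num)) x).hasDerivAt
  have hd2 : ∀ x, HasDerivAt (deriv g) (deriv (deriv g) x) x := fun x => by
    have : ContDiff ℝ 1 (deriv g) := by
      have h2 : ContDiff ℝ (1 + 1) g := by norm_num; exact hg2
      exact (contDiff_succ_iff_deriv.1 h2).2.2
    exact ((this.differentiable (by norm_num)) x).hasDerivAt
  have hb0 := hdec 0 (by norm_num)
  have hb1 := hdec 1 (by norm_num)
  have hb2 := hdec 2 le_rfl
  simp only [iteratedDeriv_zero, iteratedDeriv_one] at hb0 hb1
  have hb2' : ∀ w, ‖deriv (deriv g) w‖ ≤ 4 * B * (1 + |w|) ^ (-2 : ℝ) := by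
    intro w
    have := hb2 w
    rwa [iteratedDeriv_succ, iteratedDeriv_one] at this
  -- `g` is real because a characteristic function at `-t` is the conjugate of its value at `t`.
  have hre : ∀ x, ((g x).re : ℂ) = g x := by
    intro x
    rw [← Complex.conj_eq_iff_re]
    simp only [g]
    rw [Real.fourier_eq', ← integral_conj, ← integral_neg_eq_self]
    congr 1
    funext v
    rw [hf, hf, mul_neg, charFun_neg]
    simp [← Complex.exp_conj, Complex.conj_ofNat]
  have hgi : Integrable g := (hw2.const_mul (4 * B)).mono' hg2.continuous.aestronglyMeasurable
    (Eventually.of_forall hb0)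
  have hhi : Integrable fun x => (g x).re := hgi.re
  refine ⟨fun x => (g x).re, fun x => (deriv g x).re, 16 * B, fun x => ?_, fun x => ?_,
    fun x => ?_, fun x y hxy => ?_, fun G hG hGi => ?_⟩
  · exact Complex.reCLM.hasFDerivAt.comp_hasDerivAt x (hd1 x)
  · refine (Complex.abs_re_le_norm _).trans ((hb0 x).trans ?_)
    gcongr; norm_num
  · refine (Complex.abs_re_le_norm _).trans ((hb1 x).trans ?_)
    gcongr; norm_num
  -- Recentring the weight from `z` to `x` at distance at most 1 costs `2^2`, which turns `4 * B`
  -- into `16 * B`.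
  · have hseg : ∀ z ∈ segment ℝ x y, ‖deriv (deriv g) z‖ ≤ 16 * B * (1 + |x|) ^ (-2 : ℝ) := by
      intro z hz
      have hzx : |z - x| ≤ 1 := by
        have h1 := norm_sub_le_of_mem_segment hz
        rw [Real.norm_eq_abs, Real.norm_eq_abs] at h1
        rw [abs_sub_comm] at hxy
        linarith
      have h2 := one_add_abs_rpow_neg_le (β := 2) (by norm_num) x (z - x)
      rw [add_sub_cancel] at h2
      have h3 : (1 + |z - x|) ^ (2 : ℝ) ≤ 4 := by
        norm_num; nlinarith [abs_nonneg (z - x)]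
      calc _ ≤ 4 * B * (1 + |z|) ^ (-2 : ℝ) := hb2' z
        _ ≤ 4 * B * ((1 + |x|) ^ (-2 : ℝ) * 4) := by
          gcongr
          exact h2.trans (mul_le_mul_of_nonneg_left h3 (by positivity))
        _ = _ := by ring
    have := (convex_segment x y).norm_image_sub_le_of_norm_hasDerivWithin_le
      (fun z _ => (hd2 z).hasDerivWithinAt) hseg (right_mem_segment ℝ x y)
      (left_mem_segment ℝ x y)
    rw [← Complex.sub_re]
    refine (Complex.abs_re_le_norm _).trans (this.trans (le_of_eq ?_))
    rw [Real.norm_eq_abs]; ring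
  · refine integral_eq_integral_mul_of_charFun
      (Complex.measurable_re.comp hg2.continuous.measurable) hhi (fun t => ?_) hG hGi
    have hfint : Integrable f := by
      have := hfi 0 0 (by norm_num) (by norm_num)
      simp only [pow_zero, one_mul, norm_iteratedFDeriv_zero] at this
      exact (integrable_norm_iff hf2.continuous.aestronglyMeasurable).1 this
    -- The argument `t / (2π)` undoes the normalization in `hf`.
    have hinv := congrFun (hf2.continuous.fourierInv_fourier_eq hfint hgi) (t / (2 * Real.pi))
    rw [hf, mul_div_cancel₀ _ (by positivity)] at hinv
    rw [← hinv, Real.fourierInv_eq']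
    congr 1
    funext x
    change _ • g x = _ * (((g x).re : ℝ) : ℂ)
    rw [hre, smul_eq_mul]
    congr 2
    simp only [RCLike.inner_apply, conj_trivial]
    push_cast
    have : (Real.pi : ℂ) ≠ 0 := by exact_mod_cast Real.pi_ne_zero
    field_simp

/-! ### Decay of products of dilated characteristic functions. -/

/-- `f` is twice continuously differentiable and `f`, `f'`, `f''` decay like `w ^ N`, `w ^ (N - 1)`
and `w ^ (N - 2)`. -/
def DerivDecay (w : ℝ → ℝ) (N : ℕ) (f : ℝ → ℂ) : Prop :=
  ∃ f' f'' : ℝ → ℂ, Continuous f'' ∧ (∀ t, HasDerivAt f (f' t) t) ∧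
    (∀ t, HasDerivAt f' (f'' t) t) ∧ ∃ C : ℝ, ∀ t, w t ^ 2 * ‖f t‖ ≤ C * w t ^ (N + 2) ∧
      w t ^ 2 * ‖f' t‖ ≤ C * w t ^ (N + 1) ∧ w t ^ 2 * ‖f'' t‖ ≤ C * w t ^ N

/-- Leibniz rule. The derivatives of a factor `φ` are only bounded, so every derivative falling on
it forfeits its decay `w^e`; with `e ≤ 1` this loses at most one power of `w` per derivative, as
`DerivDecay` permits. The factor `w ^ 2` on the left there keeps all exponents natural numbers. -/
theorem DerivDecay.mul {w : ℝ → ℝ} (hw : ∀ t, 0 < w t) (hw1 : ∀ t, w t ≤ 1) {N e : ℕ}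
    (he : e ≤ 1) {f : ℝ → ℂ} (hf : DerivDecay w N f) {φ φ' φ'' : ℝ → ℂ} (hφc : Continuous φ'')
    (hφ : ∀ t, HasDerivAt φ (φ' t) t) (hφ' : ∀ t, HasDerivAt φ' (φ'' t) t) {D : ℝ}
    (h0 : ∀ t, ‖φ t‖ ≤ D * w t ^ e) (h1 : ∀ t, ‖φ' t‖ ≤ D) (h2 : ∀ t, ‖φ'' t‖ ≤ D) :
    DerivDecay w (N + e) (fun t => f t * φ t) := by
  obtain ⟨f', f'', hc, hd, hd', C, hC⟩ := hf
  have hfc : Continuous f := continuous_iff_continuousAt.2 fun y => (hd y).continuousAt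
  have hfc' : Continuous f' := continuous_iff_continuousAt.2 fun y => (hd' y).continuousAt
  have hpc : Continuous φ := continuous_iff_continuousAt.2 fun y => (hφ y).continuousAt
  have hpc' : Continuous φ' := continuous_iff_continuousAt.2 fun y => (hφ' y).continuousAt
  have hD : 0 ≤ D := (norm_nonneg _).trans (h1 0)
  have hC0 : 0 ≤ C := by
    have := (hC 0).1
    have h3 : 0 ≤ C * w 0 ^ (N + 2) :=
      (mul_nonneg (sq_nonneg _) (norm_nonneg _)).trans this
    exact nonneg_of_mul_nonneg_left h3 (pow_pos (hw 0) _)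
  have key : ∀ (u v : ℂ) (t : ℝ) (m : ℕ) (k : ℕ), w t ^ 2 * ‖u‖ ≤ C * w t ^ m →
      ‖v‖ ≤ D * w t ^ k → ∀ l ≤ m + k, w t ^ 2 * ‖u * v‖ ≤ C * D * w t ^ l := by
    intro u v t m k hu hv l hl
    calc w t ^ 2 * ‖u * v‖ = (w t ^ 2 * ‖u‖) * ‖v‖ := by rw [norm_mul]; ring
      _ ≤ (C * w t ^ m) * (D * w t ^ k) :=
        mul_le_mul hu hv (norm_nonneg _) (mul_nonneg hC0 (pow_nonneg (hw t).le _))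
      _ = C * D * w t ^ (m + k) := by rw [pow_add]; ring
      _ ≤ C * D * w t ^ l := mul_le_mul_of_nonneg_left
          (pow_le_pow_of_le_one (hw t).le (hw1 t) hl) (mul_nonneg hC0 hD)
  have hadd : ∀ (u v : ℂ) (t : ℝ) (A B X : ℝ), w t ^ 2 * ‖u‖ ≤ A * X → w t ^ 2 * ‖v‖ ≤ B * X →
      w t ^ 2 * ‖u + v‖ ≤ (A + B) * X := by
    intro u v t A B X hu hv
    have := mul_le_mul_of_nonneg_left (norm_add_le u v) (sq_nonneg (w t))
    linarith
  refine ⟨fun t => f' t * φ t + f t * φ' t,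
    fun t => (f'' t * φ t + f' t * φ' t) + (f' t * φ' t + f t * φ'' t), by fun_prop,
    fun t => (hd t).mul (hφ t),
    fun t => ((hd' t).mul (hφ t)).add ((hd t).mul (hφ' t)),
    C * D + C * D + (C * D + C * D), fun t => ⟨?_, ?_, ?_⟩⟩
  · refine (key _ _ t _ _ (hC t).1 (h0 t) (N + e + 2) (by omega)).trans ?_
    have : 0 ≤ C * D := mul_nonneg hC0 hD
    exact mul_le_mul_of_nonneg_right (by linarith) (pow_nonneg (hw t).le _)
  · have h3 := hadd _ _ t _ _ _ (key _ _ t _ _ (hC t).2.1 (h0 t) (N + e + 1) (by omega))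
      (key _ _ t _ 0 (hC t).1 (by simpa using h1 t) (N + e + 1) (by omega))
    refine h3.trans ?_
    have : 0 ≤ C * D := mul_nonneg hC0 hD
    exact mul_le_mul_of_nonneg_right (by linarith) (pow_nonneg (hw t).le _)
  · exact hadd _ _ t _ _ _
      (hadd _ _ t _ _ _ (key _ _ t _ _ (hC t).2.2 (h0 t) (N + e) (by omega))
        (key _ _ t _ 0 (hC t).2.1 (by simpa using h1 t) (N + e) (by omega)))
      (hadd _ _ t _ _ _ (key _ _ t _ 0 (hC t).2.1 (by simpa using h1 t) (N + e) (by omega))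
        (key _ _ t _ 0 (hC t).1 (by simpa using h2 t) (N + e) (by omega)))

theorem DerivDecay.one {w : ℝ → ℝ} (hw : ∀ t, 0 < w t) : DerivDecay w 0 (fun _ => 1) :=
  ⟨fun _ => 0, fun _ => 0, continuous_const, fun t => hasDerivAt_const t _,
    fun t => hasDerivAt_const t _, 1, fun t => by simp [(hw t).le]⟩

/-- The first two derivatives of a dilated characteristic function with finite variance are
bounded. -/
theorem exists_deriv_charFun_dilate {μ : Measure ℝ} [IsProbabilityMeasure μ] (hμ : MemLp id 2 μ)
    (b : ℝ) : ∃ (φ' φ'' : ℝ → ℂ) (D : ℝ), Continuous φ'' ∧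
      (∀ t, HasDerivAt (fun t => charFun μ (b * t)) (φ' t) t) ∧ (∀ t, HasDerivAt φ' (φ'' t) t) ∧
      (∀ t, ‖φ' t‖ ≤ D) ∧ ∀ t, ‖φ'' t‖ ≤ D := by
  have hc : ContDiff ℝ 2 (charFun μ) := contDiff_charFun (n := 2) (by exact_mod_cast hμ)
  have hbd : ∀ n ≤ 2, ∃ D : ℝ, ∀ t, ‖iteratedDeriv n (charFun μ) t‖ ≤ D := by
    intro n hn
    refine ⟨∫ x, ‖x‖ ^ n ∂μ, fun t => ?_⟩
    have hint : MemLp id n μ := hμ.mono_exponent (by exact_mod_cast hn)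
    rw [iteratedDeriv_charFun hint, norm_mul, norm_pow, Complex.norm_I, one_pow, one_mul]
    refine (norm_integral_le_integral_norm _).trans (le_of_eq ?_)
    congr 1
    funext x
    rw [norm_mul, show (t * x * Complex.I : ℂ) = ((t * x : ℝ) : ℂ) * Complex.I by
      push_cast; ring, Complex.norm_exp_ofReal_mul_I, mul_one, norm_pow, Complex.norm_real]
  obtain ⟨D1, h1⟩ := hbd 1 (by norm_num)
  obtain ⟨D2, h2⟩ := hbd 2 le_rfl
  have hd1 : ∀ x, HasDerivAt (charFun μ) (iteratedDeriv 1 (charFun μ) x) x := fun x => by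
    rw [iteratedDeriv_one]
    exact ((hc.differentiable (by norm_num)) x).hasDerivAt
  have hd2 : ∀ x, HasDerivAt (iteratedDeriv 1 (charFun μ)) (iteratedDeriv 2 (charFun μ) x) x := by
    intro x
    rw [iteratedDeriv_succ (n := 1)]
    exact ((hc.differentiable_iteratedDeriv 1 (by norm_num)) x).hasDerivAt
  have hb : ∀ t : ℝ, HasDerivAt (fun t : ℝ => b * t) b t := fun t => by
    simpa using (hasDerivAt_id t).const_mul b
  have hD1 := (norm_nonneg _).trans (h1 0)
  have hD2 := (norm_nonneg _).trans (h2 0)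
  refine ⟨fun t => b • iteratedDeriv 1 (charFun μ) (b * t),
    fun t => b • b • iteratedDeriv 2 (charFun μ) (b * t), |b| * D1 + |b| * (|b| * D2), ?_,
    fun t => (hd1 (b * t)).scomp t (hb t), fun t => ((hd2 (b * t)).scomp t (hb t)).const_smul b,
    fun t => ?_, fun t => ?_⟩
  · have := hc.continuous_iteratedDeriv 2 le_rfl
    fun_prop
  · rw [norm_smul, Real.norm_eq_abs]
    have := mul_le_mul_of_nonneg_left (h1 (b * t)) (abs_nonneg b)
    have : 0 ≤ |b| * (|b| * D2) := by positivity
    linarith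
  · rw [norm_smul, norm_smul, Real.norm_eq_abs]
    have := mul_le_mul_of_nonneg_left
      (mul_le_mul_of_nonneg_left (h2 (b * t)) (abs_nonneg b)) (abs_nonneg b)
    have : 0 ≤ |b| * D1 := by positivity
    linarith

/-- Each factor with a nonzero coefficient contributes one power of `w`. The factors before `i0`,
where coefficients may vanish, are only used through boundedness (`e = 0`), so `i0 + N` factors
suffice. -/
theorem exists_derivDecay_prod_charFun {μ : Measure ℝ} [IsProbabilityMeasure μ]
    (hμ : MemLp id 2 μ) {δ C : ℝ} (hδ : 0 < δ)
    (hC : ∀ s, (1 + |s|) ^ δ * ‖charFun μ s‖ ≤ C) {b : ℕ → ℝ} (hb : ∀ᶠ i in atTop, b i ≠ 0)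
    (N : ℕ) : ∃ J, DerivDecay (fun t => (1 + |t|) ^ (-δ)) N
      (fun t => ∏ i ∈ Finset.range J, charFun μ (b i * t)) := by
  have hw : ∀ t : ℝ, 0 < (1 + |t|) ^ (-δ) := fun t => by positivity
  have hw1 : ∀ t : ℝ, (1 + |t|) ^ (-δ) ≤ 1 := fun t =>
    Real.rpow_le_one_of_one_le_of_nonpos (by linarith [abs_nonneg t]) (by linarith)
  obtain ⟨i0, hi0⟩ := eventually_atTop.1 hb
  have hstep0 : ∀ J, DerivDecay (fun t => (1 + |t|) ^ (-δ)) 0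
      (fun t => ∏ i ∈ Finset.range J, charFun μ (b i * t)) := by
    intro J
    induction J with
    | zero => simpa using DerivDecay.one hw
    | succ J ih =>
      obtain ⟨φ', φ'', D, h1, h2, h3, h4, h5⟩ := exists_deriv_charFun_dilate hμ (b J)
      simp only [Finset.prod_range_succ]
      refine ih.mul hw hw1 (e := 0) (by norm_num) h1 h2 h3 (D := max 1 D) (fun t => ?_)
        (fun t => (h4 t).trans (le_max_right _ _)) (fun t => (h5 t).trans (le_max_right _ _))
      simpa using Or.inl (norm_charFun_le_one (μ := μ) (b J * t))
  refine ⟨i0 + N, ?_⟩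
  induction N with
  | zero => exact hstep0 i0
  | succ N ih =>
    have hbN : b (i0 + N) ≠ 0 := hi0 _ (by omega)
    obtain ⟨φ', φ'', D, h1, h2, h3, h4, h5⟩ := exists_deriv_charFun_dilate hμ (b (i0 + N))
    simp only [← Nat.add_assoc, Finset.prod_range_succ]
    set β := b (i0 + N)
    -- Chosen so that `1 + |t| ≤ m (1 + |β t|)`.
    set m := 1 + 1 / |β|
    have hβ : 0 < |β| := abs_pos.2 hbN
    have hm : 1 ≤ m := by simp only [m]; linarith [one_div_pos.2 hβ]
    refine ih.mul hw hw1 (e := 1) le_rfl h1 h2 h3 (D := max (m ^ δ * C) D) (fun t => ?_)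
        (fun t => (h4 t).trans (le_max_right _ _)) (fun t => (h5 t).trans (le_max_right _ _))
    rw [pow_one, Real.rpow_neg (by positivity), ← div_eq_mul_inv, le_div_iff₀ (by positivity)]
    refine le_trans ?_ (le_max_left _ _)
    have h6 : (1 + |t|) ^ δ ≤ m ^ δ * (1 + |β * t|) ^ δ := by
      rw [← Real.mul_rpow (by positivity) (by positivity)]
      refine Real.rpow_le_rpow (by positivity) ?_ hδ.le
      rw [abs_mul]
      have : |t| = 1 / |β| * (|β| * |t|) := by field_simp
      have h7 : 0 ≤ |β| * |t| := by positivity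
      have h8 := one_div_pos.2 hβ
      simp only [m]
      nlinarith
    calc ‖charFun μ (β * t)‖ * (1 + |t|) ^ δ
        ≤ ‖charFun μ (β * t)‖ * (m ^ δ * (1 + |β * t|) ^ δ) := by gcongr
      _ = m ^ δ * ((1 + |β * t|) ^ δ * ‖charFun μ (β * t)‖) := by ring
      _ ≤ m ^ δ * C := by gcongr; exact hC _

/-- Starting from `N + 2`, even the second derivative keeps `w^N = (1 + |t|)^(-δ N)`, which is at
most `(1 + |t|)^(-4)`. -/
theorem DerivDecay.exists_iteratedFDeriv_le {δ : ℝ} {N : ℕ} (hN : 4 ≤ δ * N)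
    {f : ℝ → ℂ} (hf : DerivDecay (fun t => (1 + |t|) ^ (-δ)) (N + 2) f) :
    ContDiff ℝ 2 f ∧ ∃ C, ∀ n ≤ 2, ∀ s, ‖iteratedFDeriv ℝ n f s‖ ≤ C * (1 + |s|) ^ (-4 : ℝ) := by
  obtain ⟨f', f'', hc, hd, hd', C, hC⟩ := hf
  have hδ : 0 ≤ δ := by
    by_contra h
    have : δ * N ≤ 0 := mul_nonpos_of_nonpos_of_nonneg (by linarith) (Nat.cast_nonneg N)
    linarith
  have hw : ∀ t : ℝ, 0 < (1 + |t|) ^ (-δ) := fun t => by positivity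
  have hw1 : ∀ t : ℝ, (1 + |t|) ^ (-δ) ≤ 1 := fun t =>
    Real.rpow_le_one_of_one_le_of_nonpos (by linarith [abs_nonneg t]) (by linarith)
  have e1 : deriv f = f' := funext fun t => (hd t).deriv
  have e2 : deriv f' = f'' := funext fun t => (hd' t).deriv
  have hC0 : 0 ≤ C := by
    have := (mul_nonneg (sq_nonneg _) (norm_nonneg _)).trans (hC 0).2.2
    simpa using this
  have hcd : ContDiff ℝ 2 f := by
    have h1 : ContDiff ℝ 1 f' := by
      rw [contDiff_one_iff_deriv, e2]; exact ⟨fun t => (hd' t).differentiableAt, hc⟩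
    have h2 : ContDiff ℝ (1 + 1) f := by
      rw [contDiff_succ_iff_deriv, e1]
      exact ⟨fun t => (hd t).differentiableAt, by simp, h1⟩
    norm_num at h2; exact h2
  have hfin : ∀ (t : ℝ) (u : ℂ) (k : ℕ), N + 2 ≤ k →
      ((1 + |t|) ^ (-δ)) ^ 2 * ‖u‖ ≤ C * ((1 + |t|) ^ (-δ)) ^ k →
      ‖u‖ ≤ C * (1 + |t|) ^ (-4 : ℝ) := by
    intro t u k hk hu
    have h1 : ((1 + |t|) ^ (-δ)) ^ 2 * ‖u‖
        ≤ ((1 + |t|) ^ (-δ)) ^ 2 * (C * ((1 + |t|) ^ (-δ)) ^ N) := by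
      refine hu.trans ?_
      calc _ ≤ C * ((1 + |t|) ^ (-δ)) ^ (N + 2) :=
            mul_le_mul_of_nonneg_left (pow_le_pow_of_le_one (hw t).le (hw1 t) hk) hC0
        _ = _ := by rw [pow_add]; ring
    have h2 := le_of_mul_le_mul_left h1 (pow_pos (hw t) 2)
    refine h2.trans (mul_le_mul_of_nonneg_left ?_ hC0)
    rw [← Real.rpow_natCast, ← Real.rpow_mul (by positivity)]
    exact Real.rpow_le_rpow_of_exponent_le (by linarith [abs_nonneg t]) (by linarith)
  refine ⟨hcd, C, fun n hn s => ?_⟩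
  rw [norm_iteratedFDeriv_eq_norm_iteratedDeriv]
  interval_cases n
  · rw [iteratedDeriv_zero]; exact hfin s _ _ (by omega) (hC s).1
  · rw [iteratedDeriv_one, e1]; exact hfin s _ _ (by omega) (hC s).2.1
  · rw [iteratedDeriv_succ, iteratedDeriv_one, e1, e2]; exact hfin s _ _ le_rfl (hC s).2.2

theorem charFun_map_sum_mul {Ω : Type*} [MeasurableSpace Ω] {P : Measure Ω}
    [IsProbabilityMeasure P] {η : ℕ → Ω → ℝ} (hη : ∀ i, Measurable (η i)) (hind : iIndepFun η P)
    {μ : Measure ℝ} (hμ : ∀ i, P.map (η i) = μ) (b : ℕ → ℝ) (J : ℕ) (t : ℝ) :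
    charFun (P.map fun ω => ∑ i ∈ Finset.range J, b i * η i ω) t
      = ∏ i ∈ Finset.range J, charFun μ (b i * t) := by
  induction J with
  | zero => simp
  | succ J ih =>
    have hm : ∀ i, Measurable fun ω => b i * η i ω := fun i => (hη i).const_mul _
    have hi : IndepFun (fun ω => ∑ i ∈ Finset.range J, b i * η i ω) (fun ω => b J * η J ω) P := by
      have h1 : iIndepFun (fun i ω => b i * η i ω) P :=
        hind.comp (fun i x => b i * x) fun i => measurable_const_mul _
      convert h1.indepFun_sum_range_succ hm J using 1
      ext ω; simp
    have := hi.charFun_map_fun_add_eq_mul (Finset.measurable_sum _ fun i _ => hm i).aemeasurable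
      (hm J).aemeasurable
    simp only [Finset.prod_range_succ, Finset.sum_range_succ]
    rw [this, Pi.mul_apply, ih, charFun_map_mul_comp (hη J).aemeasurable, hμ]

/-! ### Sums of powers. -/

/-- The first term is at most `x^(1-q)` since `x ≥ 1`; the others are compared with the integral. -/
theorem sum_range_add_rpow_neg_le {q x : ℝ} (hq : 1 < q) (hx : 1 ≤ x) (M : ℕ) :
    ∑ i ∈ Finset.range M, (x + i) ^ (-q) ≤ (1 + 1 / (q - 1)) * x ^ (1 - q) := by
  have hx0 : 0 < x := by linarith
  have hq1 : 0 < q - 1 := by linarith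
  have hanti : AntitoneOn (fun y : ℝ => y ^ (-q)) (Set.Icc x (x + M)) := by
    intro y hy z _ hyz
    exact Real.rpow_le_rpow_of_nonpos (by linarith [hy.1]) hyz (by linarith)
  have h1 := hanti.sum_le_integral
  have h2 : ∫ y in x..x + M, y ^ (-q) ≤ 1 / (q - 1) * x ^ (1 - q) := by
    rw [integral_rpow (Or.inr ⟨by linarith, by
      rw [Set.uIcc_of_le (by linarith [Nat.cast_nonneg (α := ℝ) M])]
      exact fun h => by linarith [h.1]⟩)]
    rw [show -q + 1 = -(q - 1) by ring, div_neg, ← neg_div, neg_sub, div_le_iff₀ hq1,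
      show 1 - q = -(q - 1) by ring]
    have := Real.rpow_nonneg (by positivity : 0 ≤ x + M) (-(q - 1))
    field_simp
    linarith
  have h3 : x ^ (-q) ≤ x ^ (1 - q) := Real.rpow_le_rpow_of_exponent_le hx (by linarith)
  have h4 : ∑ i ∈ Finset.range M, (x + i) ^ (-q)
      ≤ ∑ i ∈ Finset.range (M + 1), (x + i) ^ (-q) :=
    Finset.sum_le_sum_of_subset_of_nonneg (Finset.range_mono (Nat.le_succ M))
      fun i _ _ => by positivity
  rw [Finset.sum_range_succ'] at h4
  simp only [Nat.cast_zero, add_zero] at h4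
  linarith

/-- The right-hand side telescopes: weighted AM-GM for `M^(1-θ) (M+1)^θ` gives `(1-θ) (M+1)^(-θ) ≤
(M+1)^(1-θ) - M^(1-θ)`. -/
theorem sum_range_succ_rpow_neg_le {θ : ℝ} (hθ0 : 0 ≤ θ) (hθ : θ < 1) (M : ℕ) :
    ∑ i ∈ Finset.range M, ((i : ℝ) + 1) ^ (-θ) ≤ 1 / (1 - θ) * (M : ℝ) ^ (1 - θ) := by
  have hθ1 : 0 < 1 - θ := by linarith
  induction M with
  | zero => simp; positivity
  | succ M ih =>
    rw [Finset.sum_range_succ]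
    have hM : (0 : ℝ) ≤ M := Nat.cast_nonneg M
    have h1 : (1 - θ) * ((M : ℝ) + 1) ^ (-θ) ≤ ((M : ℝ) + 1) ^ (1 - θ) - (M : ℝ) ^ (1 - θ) := by
      have hy : (0 : ℝ) < (M : ℝ) + 1 := by positivity
      have h2 := Real.geom_mean_le_arith_mean2_weighted (w₁ := 1 - θ) (w₂ := θ) hθ1.le hθ0
        hM hy.le (by ring)
      have h3 : ((M : ℝ) + 1) ^ (1 - θ) = ((M : ℝ) + 1) ^ (-θ) * (M + 1) := by
        rw [← Real.rpow_add_one hy.ne']; congr 1; ring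
      have h4 : (M : ℝ) ^ (1 - θ)
          ≤ ((1 - θ) * M + θ * (M + 1)) * ((M : ℝ) + 1) ^ (-θ) := by
        rw [Real.rpow_neg hy.le, ← div_eq_mul_inv, le_div_iff₀ (by positivity)]
        exact h2
      rw [h3]
      nlinarith
    push_cast
    have h5 : ((M : ℝ) + 1) ^ (-θ)
        ≤ 1 / (1 - θ) * (((M : ℝ) + 1) ^ (1 - θ) - (M : ℝ) ^ (1 - θ)) := by
      rw [div_mul_eq_mul_div, one_mul, le_div_iff₀ hθ1]; linarith
    linarith

/-! ### Centred noise, hyperbolic coefficients and tails of the linear series. -/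

/-- The history of a two-sided sequence up to time `k`. -/
def histAt {Ω : Type*} (ε : ℤ → Ω → ℝ) (k : ℤ) (ω : Ω) : ℕ → ℝ := fun i => ε (k - i) ω

/-- The tail `∑_{i ≥ 0} a_{j+i} x_i` of a conditionally convergent linear series. -/
noncomputable def tailSum (a : ℕ → ℝ) (j : ℕ) (x : ℕ → ℝ) : ℝ :=
  limUnder atTop fun M : ℕ => ∑ i ∈ Finset.range M, a (j + i) * x i

theorem measurable_tailSum (a : ℕ → ℝ) (j : ℕ) : Measurable (tailSum a j) := by
  refine (StronglyMeasurable.limUnder (f := fun (M : ℕ) (x : ℕ → ℝ) =>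
    ∑ i ∈ Finset.range M, a (j + i) * x i) fun M => ?_).measurable
  exact (Finset.measurable_sum _ fun i _ => (measurable_pi_apply i).const_mul _).stronglyMeasurable

/-- Independent, identically distributed, centred noise with finite `p`-th moment. -/
structure CenteredNoise {Ω : Type*} [MeasurableSpace Ω] (P : Measure Ω) (ε : ℤ → Ω → ℝ)
    (μ : Measure ℝ) (p : ℝ) : Prop where
  measurable : ∀ t, Measurable (ε t)
  indep : iIndepFun ε P
  law : ∀ t, P.map (ε t) = μ
  memLp : MemLp id (ENNReal.ofReal p) μ
  mean : ∫ x, x ∂μ = 0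

namespace CenteredNoise

variable {Ω : Type*} [MeasurableSpace Ω] {P : Measure Ω} {ε : ℤ → Ω → ℝ} {μ : Measure ℝ} {p : ℝ}

theorem isProbabilityMeasure (h : CenteredNoise P ε μ p) : IsProbabilityMeasure P :=
  h.indep.isProbabilityMeasure

theorem isProbabilityMeasure_law (h : CenteredNoise P ε μ p) : IsProbabilityMeasure μ := by
  have := h.isProbabilityMeasure
  rw [← h.law 0]
  exact Measure.isProbabilityMeasure_map (h.measurable 0).aemeasurable

theorem measurable_histAt (h : CenteredNoise P ε μ p) (k : ℤ) : Measurable (histAt ε k) :=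
  measurable_pi_lambda _ fun i => h.measurable (k - i)

theorem indepFun_histAt (h : CenteredNoise P ε μ p) (k : ℤ) :
    IndepFun (histAt ε (k - 1)) (ε k) P := by
  have h1 := indep_iSup_of_disjoint (m := fun t => MeasurableSpace.comap (ε t) inferInstance)
    (fun t => (h.measurable t).comap_le) ((iIndepFun_iff_iIndep _ _ _).1 h.indep)
    (S := Set.Iio k) (T := {k}) (by simp)
  rw [IndepFun_iff_Indep]
  refine indep_of_indep_of_le_right (indep_of_indep_of_le_left h1 ?_) ?_
  · rw [← measurable_iff_comap_le]
    refine @measurable_pi_lambda _ _ _ (_) _ _ fun i => ?_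
    refine measurable_iff_comap_le.2 ?_
    exact le_iSup₂_of_le (k - 1 - i) (by simp only [Set.mem_Iio]; omega) le_rfl
  · exact le_iSup₂_of_le k rfl le_rfl

theorem memLp_coord (h : CenteredNoise P ε μ p) (t : ℤ) : MemLp (ε t) (ENNReal.ofReal p) P := by
  have := h.memLp
  rw [← h.law t] at this
  exact (memLp_map_measure_iff (by fun_prop) (h.measurable t).aemeasurable).1 this

theorem integral_coord (h : CenteredNoise P ε μ p) (t : ℤ) : ∫ ω, ε t ω ∂P = 0 := by
  rw [← h.mean, ← h.law t, integral_map (h.measurable t).aemeasurable (by fun_prop)]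

theorem integral_abs_rpow_coord (h : CenteredNoise P ε μ p) (t : ℤ) :
    ∫ ω, |ε t ω| ^ p ∂P = ∫ x, |x| ^ p ∂μ := by
  rw [← h.law t, integral_map (h.measurable t).aemeasurable]
  exact (by fun_prop : Measurable fun x : ℝ => |x| ^ p).aestronglyMeasurable

/-- The weighted sequence along an injective sequence of times satisfies the hypotheses of the
von Bahr–Esseen bounds. -/
theorem weighted (h : CenteredNoise P ε μ p) {τ : ℕ → ℤ}
    (hτ : Function.Injective τ) (b : ℕ → ℝ) :
    (∀ i, Measurable fun ω => b i * ε (τ i) ω) ∧ iIndepFun (fun i ω => b i * ε (τ i) ω) P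
      ∧ (∀ i, ∫ ω, b i * ε (τ i) ω ∂P = 0)
      ∧ (∀ i, MemLp (fun ω => b i * ε (τ i) ω) (ENNReal.ofReal p) P)
      ∧ ∀ i, ∫ ω, |b i * ε (τ i) ω| ^ p ∂P = |b i| ^ p * ∫ x, |x| ^ p ∂μ := by
  refine ⟨fun i => (h.measurable _).const_mul _, ?_, fun i => ?_,
    fun i => (h.memLp_coord _).const_mul _, fun i => ?_⟩
  · exact (h.indep.precomp hτ).comp (fun i x => b i * x) fun i => measurable_const_mul _
  · rw [integral_const_mul, h.integral_coord, mul_zero]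
  · simp_rw [abs_mul, Real.mul_rpow (abs_nonneg _) (abs_nonneg _)]
    rw [integral_const_mul, h.integral_abs_rpow_coord]

end CenteredNoise

/-- Hyperbolic decay `|a_j| ≤ A (j + 1) ^ (-s)`. -/
def HyperbolicDecay (a : ℕ → ℝ) (A s : ℝ) : Prop := ∀ j : ℕ, |a j| ≤ A * ((j : ℝ) + 1) ^ (-s)

theorem HyperbolicDecay.nonneg {a : ℕ → ℝ} {A s : ℝ} (h : HyperbolicDecay a A s) : 0 ≤ A := by
  simpa using (abs_nonneg _).trans (h 0)

theorem HyperbolicDecay.sum_abs_rpow_le {a : ℕ → ℝ} {A s p : ℝ} (h : HyperbolicDecay a A s)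
    (hp : 0 < p) (hs : 1 < s * p) (j M : ℕ) :
    ∑ i ∈ Finset.range M, |a (j + i)| ^ p
      ≤ A ^ p * (1 + 1 / (s * p - 1)) * ((j : ℝ) + 1) ^ (1 - s * p) := by
  calc _ ≤ ∑ i ∈ Finset.range M, A ^ p * (((j : ℝ) + 1) + i) ^ (-(s * p)) := by
        refine Finset.sum_le_sum fun i _ => ?_
        have h1 := Real.rpow_le_rpow (abs_nonneg _) (h (j + i)) hp.le
        rw [Real.mul_rpow h.nonneg (by positivity), ← Real.rpow_mul (by positivity)] at h1
        push_cast at h1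
        rw [neg_mul] at h1
        rw [show (j : ℝ) + 1 + i = j + i + 1 by ring]
        exact h1
    _ = A ^ p * ∑ i ∈ Finset.range M, (((j : ℝ) + 1) + i) ^ (-(s * p)) := by
        rw [Finset.mul_sum]
    _ ≤ A ^ p * ((1 + 1 / (s * p - 1)) * ((j : ℝ) + 1) ^ (1 - s * p)) :=
        mul_le_mul_of_nonneg_left (sum_range_add_rpow_neg_le hs (by simp) M) (Real.rpow_nonneg h.nonneg _)
    _ = _ := by ring

namespace CenteredNoise

variable {Ω : Type*} [MeasurableSpace Ω] {P : Measure Ω} {ε : ℤ → Ω → ℝ} {μ : Measure ℝ} {p : ℝ}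
  {a : ℕ → ℝ} {A s : ℝ}

theorem injective_sub_natCast (k : ℤ) : Function.Injective fun i : ℕ => k - (i : ℤ) := by
  intro i j hij
  simp only at hij
  omega

theorem sum_integral_le (h : CenteredNoise P ε μ p) (hp : 1 < p)
    (ha : HyperbolicDecay a A s) (hs : 1 < s * p) {τ : ℕ → ℤ} (hτ : Function.Injective τ)
    (j M : ℕ) : ∑ i ∈ Finset.range M, ∫ ω, |a (j + i) * ε (τ i) ω| ^ p ∂P
      ≤ A ^ p * (1 + 1 / (s * p - 1)) * (∫ x, |x| ^ p ∂μ) * ((j : ℝ) + 1) ^ (1 - s * p) := by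
  have := ha.sum_abs_rpow_le (by linarith) hs j M
  simp_rw [(h.weighted hτ fun i => a (j + i)).2.2.2.2]
  rw [← Finset.sum_mul]
  have h0 : 0 ≤ ∫ x, |x| ^ p ∂μ := integral_nonneg fun x => Real.rpow_nonneg (abs_nonneg _) _
  nlinarith [mul_le_mul_of_nonneg_right this h0]

/-- Almost sure convergence of the tails of the linear series. -/
theorem ae_tendsto_tailSum (h : CenteredNoise P ε μ p) (hp : 1 < p) (hp2 : p ≤ 2)
    (ha : HyperbolicDecay a A s) (hs : 1 < s * p) (j : ℕ) (k : ℤ) :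
    ∀ᵐ ω ∂P, Tendsto (fun M : ℕ => ∑ i ∈ Finset.range M, a (j + i) * ε (k - i) ω) atTop
      (𝓝 (tailSum a j (histAt ε k ω))) := by
  have := h.isProbabilityMeasure
  have hw := h.weighted (injective_sub_natCast k) fun i => a (j + i)
  filter_upwards [ae_exists_tendsto_sum_of_iIndepFun hw.1 hw.2.1 hw.2.2.1 hp hp2 hw.2.2.2.1
    (h.sum_integral_le hp ha hs (injective_sub_natCast k) j)] with ω hω
  exact tendsto_nhds_limUnder hω

/-- By von Bahr–Esseen the `p`-th moment is of order `∑_{i≥j} (i+1)^(-sp)`, hence of order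
`(j+1)^(1-sp)`; the exponent is the `p`-th root of this. -/
theorem exists_eLpNorm_tailSum_le (h : CenteredNoise P ε μ p) (hp : 1 < p) (hp2 : p ≤ 2)
    (ha : HyperbolicDecay a A s) (hs : 1 < s * p) :
    ∃ C, 0 ≤ C ∧ ∀ (j : ℕ) (k : ℤ), eLpNorm (fun ω => tailSum a j (histAt ε k ω))
      (ENNReal.ofReal p) P ≤ ENNReal.ofReal (C * ((j : ℝ) + 1) ^ (1 / p - s)) := by
  have := h.isProbabilityMeasure
  have h0 : 0 ≤ ∫ x, |x| ^ p ∂μ := integral_nonneg fun x => Real.rpow_nonneg (abs_nonneg _) _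
  have hs1 : 0 < s * p - 1 := by linarith
  have hA := ha.nonneg
  set B := 2 * p * (A ^ p * (1 + 1 / (s * p - 1)) * (∫ x, |x| ^ p ∂μ)) with hB
  have hB0 : 0 ≤ B := by positivity
  refine ⟨B ^ (1 / p), by positivity, fun j k => ?_⟩
  have hw := h.weighted (injective_sub_natCast k) fun i => a (j + i)
  refine (eLpNorm_le_of_tendsto_sum_of_iIndepFun hw.1 hw.2.1 hw.2.2.1 hp hp2 hw.2.2.2.1
    (h.sum_integral_le hp ha hs (injective_sub_natCast k) j)
    (h.ae_tendsto_tailSum hp hp2 ha hs j k)).trans (le_of_eq ?_)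
  rw [← mul_assoc, ← hB, Real.mul_rpow hB0 (by positivity), ← Real.rpow_mul (by positivity)]
  congr 3
  field_simp

/-- Uniformity over all blocks of coefficients is what keeps the smoothness constants of
`partialMean` bounded in `j`. -/
theorem exists_integral_abs_sum_rpow_le (h : CenteredNoise P ε μ p) (hp : 1 < p) (hp2 : p ≤ 2)
    (ha : HyperbolicDecay a A s) (hs : 1 < s * p) :
    ∃ C, ∀ j M : ℕ, ∫ ω, |∑ i ∈ Finset.range M, a (j + i) * ε (i : ℤ) ω| ^ p ∂P ≤ C := by
  have := h.isProbabilityMeasure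
  have h0 : 0 ≤ ∫ x, |x| ^ p ∂μ := integral_nonneg fun x => Real.rpow_nonneg (abs_nonneg _) _
  have hs1 : 0 < s * p - 1 := by linarith
  have hA := ha.nonneg
  refine ⟨2 * p * (A ^ p * (1 + 1 / (s * p - 1)) * (∫ x, |x| ^ p ∂μ)), fun j M => ?_⟩
  have hτ : Function.Injective fun i : ℕ => (i : ℤ) := Nat.cast_injective
  have hw := h.weighted hτ fun i => a (j + i)
  refine (integral_abs_sum_rpow_le_of_iIndepFun hw.1 hw.2.1 hw.2.2.1 hp hp2 hw.2.2.2.1 M).trans ?_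
  refine mul_le_mul_of_nonneg_left ((h.sum_integral_le hp ha hs hτ j M).trans ?_) (by positivity)
  refine mul_le_of_le_one_right (by positivity) ?_
  exact Real.rpow_le_one_of_one_le_of_nonpos (by linarith [Nat.cast_nonneg (α := ℝ) j])
    (by linarith)

/-- Splitting off the most recent innovation. -/
theorem ae_tailSum_eq (h : CenteredNoise P ε μ p) (hp : 1 < p) (hp2 : p ≤ 2)
    (ha : HyperbolicDecay a A s) (hs : 1 < s * p) (j : ℕ) (k : ℤ) :
    ∀ᵐ ω ∂P, tailSum a j (histAt ε k ω)
      = a j * ε k ω + tailSum a (j + 1) (histAt ε (k - 1) ω) := by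
  filter_upwards [h.ae_tendsto_tailSum hp hp2 ha hs j k,
    h.ae_tendsto_tailSum hp hp2 ha hs (j + 1) (k - 1)] with ω h1 h2
  have h3 := (tendsto_add_atTop_iff_nat 1).2 h1
  refine tendsto_nhds_unique h3 ?_
  have h4 := h2.const_add (a j * ε k ω)
  refine h4.congr fun M => ?_
  rw [Finset.sum_range_succ', add_comm]
  congr 1
  · refine Finset.sum_congr rfl fun i _ => ?_
    rw [show j + (i + 1) = j + 1 + i by omega]
    congr 2
    push_cast; ring
  · simp

end CenteredNoise

/-! ### Integration over independent innovations and partial means. -/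

theorem IndepFun.integrable_prod_iff {Ω E : Type*} [MeasurableSpace Ω] [MeasurableSpace E]
    {P : Measure Ω} [IsProbabilityMeasure P] {Y : Ω → E} {e : Ω → ℝ} (hY : Measurable Y)
    (he : Measurable e) (hind : IndepFun Y e P) {F : E → ℝ → ℝ}
    (hF : Measurable (Function.uncurry F)) :
    Integrable (fun ω => F (Y ω) (e ω)) P
      ↔ Integrable (Function.uncurry F) ((P.map Y).prod (P.map e)) := by
  rw [← (indepFun_iff_map_prod_eq_prod_map_map hY.aemeasurable he.aemeasurable).1 hind]
  exact (integrable_map_measure hF.aestronglyMeasurable (hY.prodMk he).aemeasurable).symm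

theorem IndepFun.integral_eq_integral_integral {Ω E : Type*} [MeasurableSpace Ω]
    [MeasurableSpace E] {P : Measure Ω} [IsProbabilityMeasure P] {Y : Ω → E} {e : Ω → ℝ}
    (hY : Measurable Y) (he : Measurable e) (hind : IndepFun Y e P) {F : E → ℝ → ℝ}
    (hF : Measurable (Function.uncurry F)) (hFi : Integrable (fun ω => F (Y ω) (e ω)) P) :
    ∫ ω, F (Y ω) (e ω) ∂P = ∫ ω, ∫ x, F (Y ω) x ∂(P.map e) ∂P := by
  have : IsProbabilityMeasure (P.map e) := Measure.isProbabilityMeasure_map he.aemeasurable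
  have : IsProbabilityMeasure (P.map Y) := Measure.isProbabilityMeasure_map hY.aemeasurable
  have hmap := (indepFun_iff_map_prod_eq_prod_map_map hY.aemeasurable he.aemeasurable).1 hind
  have h1 := (IndepFun.integrable_prod_iff hY he hind hF).1 hFi
  calc _ = ∫ z, Function.uncurry F z ∂(P.map fun ω => (Y ω, e ω)) :=
        (integral_map (hY.prodMk he).aemeasurable hF.aestronglyMeasurable).symm
    _ = ∫ y, ∫ x, F y x ∂(P.map e) ∂(P.map Y) := by rw [hmap, integral_prod _ h1]; rfl
    _ = _ := integral_map hY.aemeasurable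
      (hF.stronglyMeasurable.integral_prod_right (ν := P.map e)).aestronglyMeasurable

theorem IndepFun.integral_eq_integral_integral_symm {Ω E : Type*} [MeasurableSpace Ω]
    [MeasurableSpace E] {P : Measure Ω} [IsProbabilityMeasure P] {Y : Ω → E} {e : Ω → ℝ}
    (hY : Measurable Y) (he : Measurable e) (hind : IndepFun Y e P) {F : E → ℝ → ℝ}
    (hF : Measurable (Function.uncurry F)) (hFi : Integrable (fun ω => F (Y ω) (e ω)) P) :
    ∫ ω, F (Y ω) (e ω) ∂P = ∫ x, ∫ ω, F (Y ω) x ∂P ∂(P.map e) := by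
  have : IsProbabilityMeasure (P.map e) := Measure.isProbabilityMeasure_map he.aemeasurable
  have : IsProbabilityMeasure (P.map Y) := Measure.isProbabilityMeasure_map hY.aemeasurable
  have hmap := (indepFun_iff_map_prod_eq_prod_map_map hY.aemeasurable he.aemeasurable).1 hind
  have h1 := (IndepFun.integrable_prod_iff hY he hind hF).1 hFi
  calc _ = ∫ z, Function.uncurry F z ∂(P.map fun ω => (Y ω, e ω)) :=
        (integral_map (hY.prodMk he).aemeasurable hF.aestronglyMeasurable).symm
    _ = ∫ x, ∫ y, F y x ∂(P.map Y) ∂(P.map e) := by rw [hmap, integral_prod_symm _ h1]; rfl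
    _ = _ := by
      congr 1
      funext x
      exact integral_map hY.aemeasurable (hF.comp measurable_prodMk_right).aestronglyMeasurable

theorem one_add_abs_rpow_le_one_add_abs {γ : ℝ} (hγ1 : γ ≤ 1) (x : ℝ) :
    (1 + |x|) ^ γ ≤ 1 + |x| := by
  simpa using Real.rpow_le_rpow_of_exponent_le (by linarith [abs_nonneg x] : 1 ≤ 1 + |x|) hγ1

theorem MeasureTheory.Integrable.one_add_abs_rpow {S : Type*} [MeasurableSpace S] {ρ : Measure S}
    [IsFiniteMeasure ρ] {Y : S → ℝ} (hY : Integrable Y ρ) {γ : ℝ} (hγ1 : γ ≤ 1) :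
    Integrable (fun x => (1 + |Y x|) ^ γ) ρ := by
  refine ((integrable_const (1 : ℝ)).add hY.abs).mono' ?_ (Eventually.of_forall fun x => ?_)
  · exact ((by fun_prop : Measurable fun y : ℝ => (1 + |y|) ^ γ).comp_aemeasurable
      hY.1.aemeasurable).aestronglyMeasurable
  · rw [Real.norm_of_nonneg (by positivity)]
    exact one_add_abs_rpow_le_one_add_abs hγ1 (Y x)

/-- Measurable functions with `|g x| ≤ C (1 + |x|) ^ γ`. -/
structure GrowthBound (γ C : ℝ) (g : ℝ → ℝ) : Prop where
  measurable : Measurable g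
  abs_le : ∀ x, |g x| ≤ C * (1 + |x|) ^ γ

namespace GrowthBound

variable {γ C : ℝ} {g : ℝ → ℝ}

theorem nonneg (h : GrowthBound γ C g) : 0 ≤ C := by
  simpa using (abs_nonneg _).trans (h.abs_le 0)

theorem abs_add_le (h : GrowthBound γ C g) (hγ : 0 ≤ γ) (x y : ℝ) :
    |g (x + y)| ≤ C * (1 + |x|) ^ γ * (1 + |y|) ^ γ := by
  rw [mul_assoc]
  exact (h.abs_le _).trans
    (mul_le_mul_of_nonneg_left (one_add_abs_add_rpow_le hγ x y) h.nonneg)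

theorem integrable_add (h : GrowthBound γ C g) (hγ : 0 ≤ γ) (hγ1 : γ ≤ 1) {S : Type*}
    [MeasurableSpace S] {ρ : Measure S} [IsFiniteMeasure ρ] {Y : S → ℝ} (hY : Integrable Y ρ)
    (x : ℝ) : Integrable (fun ω => g (x + Y ω)) ρ := by
  refine ((hY.one_add_abs_rpow hγ1).const_mul (C * (1 + |x|) ^ γ)).mono' ?_
    (Eventually.of_forall fun ω => h.abs_add_le hγ x (Y ω))
  exact (h.measurable.comp_aemeasurable
    (hY.1.aemeasurable.const_add x)).aestronglyMeasurable

theorem average (h : GrowthBound γ C g) (hγ : 0 ≤ γ) (hγ1 : γ ≤ 1) {ρ : Measure ℝ}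
    [IsFiniteMeasure ρ] (hρ : Integrable id ρ) (b : ℝ) :
    GrowthBound γ (C * ∫ e, (1 + |b * e|) ^ γ ∂ρ) (fun y => ∫ e, g (y + b * e) ∂ρ) := by
  refine ⟨?_, fun y => ?_⟩
  · have hm : Measurable (Function.uncurry fun y e : ℝ => g (y + b * e)) :=
      h.measurable.comp (by fun_prop)
    exact (hm.stronglyMeasurable.integral_prod_right (ν := ρ)).measurable
  · have hi : Integrable (fun e : ℝ => (1 + |b * e|) ^ γ) ρ :=
      (hρ.const_mul b).one_add_abs_rpow hγ1
    calc _ ≤ ∫ e, C * (1 + |y|) ^ γ * (1 + |b * e|) ^ γ ∂ρ :=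
          abs_integral_le_of_abs_le (hi.const_mul _) fun e => h.abs_add_le hγ y (b * e)
      _ = _ := by rw [integral_const_mul]; ring

end GrowthBound

/-- The function obtained from `G` by averaging out the first `j` innovations:
`y ↦ E[G(y + ∑_{i < j} a_i ε_i)]`. -/
noncomputable def partialMean (μ : Measure ℝ) (a : ℕ → ℝ) (G : ℝ → ℝ) : ℕ → ℝ → ℝ
  | 0 => G
  | j + 1 => fun y => ∫ e, partialMean μ a G j (y + a j * e) ∂μ

/-- The constant may grow with `j` but is the same for every `G` with the given growth bound; it
serves for measurability, integrability and finitely many early lags. -/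
theorem GrowthBound.partialMean {μ : Measure ℝ} [IsFiniteMeasure μ] (hμ : Integrable id μ)
    (a : ℕ → ℝ) {γ CG : ℝ} (hγ : 0 ≤ γ) (hγ1 : γ ≤ 1) (j : ℕ) :
    ∃ C, ∀ G, GrowthBound γ CG G → GrowthBound γ C (partialMean μ a G j) := by
  induction j with
  | zero => exact ⟨CG, fun G hG => hG⟩
  | succ j ih =>
    obtain ⟨C, hC⟩ := ih
    exact ⟨_, fun G hG => (hC G hG).average hγ hγ1 hμ (a j)⟩

namespace CenteredNoise

variable {Ω : Type*} [MeasurableSpace Ω] {P : Measure Ω} {ε : ℤ → Ω → ℝ} {μ : Measure ℝ} {p : ℝ}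
  {a : ℕ → ℝ} {A s γ CG : ℝ} {G : ℝ → ℝ}

theorem one_le_ofReal (hp : 1 < p) : (1 : ℝ≥0∞) ≤ ENNReal.ofReal p := by
  rw [← ENNReal.ofReal_one]; exact ENNReal.ofReal_le_ofReal hp.le

theorem integrable_id (h : CenteredNoise P ε μ p) (hp : 1 < p) : Integrable id μ := by
  have := h.isProbabilityMeasure_law
  exact h.memLp.integrable (one_le_ofReal hp)

theorem integrable_coord (h : CenteredNoise P ε μ p) (hp : 1 < p) (t : ℤ) :
    Integrable (ε t) P := by
  have := h.isProbabilityMeasure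
  exact (h.memLp_coord t).integrable (one_le_ofReal hp)

theorem integrable_sum (h : CenteredNoise P ε μ p) (hp : 1 < p) (b : ℕ → ℝ) (m : ℕ) :
    Integrable (fun ω => ∑ i ∈ Finset.range m, b i * ε (i : ℤ) ω) P :=
  integrable_finsetSum _ fun i _ => (h.integrable_coord hp i).const_mul _

/-- Unfolds the iterated integrals into one expectation over an independent block. As the noise is
identically distributed, `ε 0, …, ε (m-1)` can represent the innovations with weights `a J, …, a
(J+m-1)`. -/
theorem partialMean_add (h : CenteredNoise P ε μ p) (hp : 1 < p) (hγ : 0 ≤ γ) (hγ1 : γ ≤ 1)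
    (hG : GrowthBound γ CG G) (J m : ℕ) (y : ℝ) :
    partialMean μ a G (J + m) y
      = ∫ ω, partialMean μ a G J (y + ∑ i ∈ Finset.range m, a (J + i) * ε (i : ℤ) ω) ∂P := by
  have := h.isProbabilityMeasure
  have := h.isProbabilityMeasure_law
  obtain ⟨C, hC⟩ := GrowthBound.partialMean (h.integrable_id hp) a (CG := CG) hγ hγ1 J
  have hK := hC G hG
  induction m generalizing y with
  | zero => simp
  | succ m ih =>
    have hw := h.weighted (τ := fun i : ℕ => (i : ℤ)) Nat.cast_injective fun i => a (J + i)
    have hSm : Measurable fun ω => ∑ i ∈ Finset.range m, a (J + i) * ε (i : ℤ) ω :=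
      Finset.measurable_sum _ fun i _ => hw.1 i
    have hi : IndepFun (fun ω => ∑ i ∈ Finset.range m, a (J + i) * ε (i : ℤ) ω)
        (ε (m : ℤ)) P := by
      have h1 : iIndepFun (fun i : ℕ => ε (i : ℤ)) P := h.indep.precomp Nat.cast_injective
      have hψ : Measurable fun x : ({m} : Finset ℕ) → ℝ => x ⟨m, by simp⟩ :=
        measurable_pi_apply _
      have h2 := (h1.indepFun_finset (Finset.range m) {m} (by simp)
        (fun i => h.measurable i)).comp
        (φ := fun x : Finset.range m → ℝ => ∑ i : Finset.range m, a (J + (i : ℕ)) * x i)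
        (Finset.measurable_sum _ fun i _ => (measurable_pi_apply i).const_mul _)
        hψ
      convert h2 using 1
      swap
      · rfl
      ext ω
      simp only [Function.comp_apply]
      exact (Finset.sum_coe_sort (Finset.range m) fun i => a (J + i) * ε (i : ℤ) ω).symm
    have hF : Measurable (Function.uncurry fun u e : ℝ =>
        partialMean μ a G J (y + (u + a (J + m) * e))) := hK.measurable.comp (by fun_prop)
    have hFi : Integrable (fun ω => partialMean μ a G J
        (y + ((∑ i ∈ Finset.range m, a (J + i) * ε (i : ℤ) ω) + a (J + m) * ε (m : ℤ) ω))) P :=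
      hK.integrable_add hγ hγ1 ((h.integrable_sum hp (fun i => a (J + i)) m).add
        ((h.integrable_coord hp m).const_mul _)) y
    have := IndepFun.integral_eq_integral_integral_symm hSm (h.measurable m) hi hF hFi
    simp only [Finset.sum_range_succ]
    rw [this, h.law, ← Nat.add_assoc]
    simp only [partialMean, ih]
    congr 1
    funext e
    congr 1
    funext ω
    congr 1
    ring

theorem memLp_tailSum (h : CenteredNoise P ε μ p) (hp : 1 < p) (hp2 : p ≤ 2)
    (ha : HyperbolicDecay a A s) (hs : 1 < s * p) (j : ℕ) (k : ℤ) :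
    MemLp (fun ω => tailSum a j (histAt ε k ω)) (ENNReal.ofReal p) P := by
  obtain ⟨C, -, hC⟩ := h.exists_eLpNorm_tailSum_le hp hp2 ha hs
  exact ⟨((measurable_tailSum a j).comp (h.measurable_histAt k)).aestronglyMeasurable,
    (hC j k).trans_lt ENNReal.ofReal_lt_top⟩

/-- The tower property, integrating out one innovation at a time. It replaces the rough `G` by a
smooth partial mean when differentiating in `x`. -/
theorem integral_partialMean_tailSum (h : CenteredNoise P ε μ p) (hp : 1 < p) (hp2 : p ≤ 2)
    (ha : HyperbolicDecay a A s) (hs : 1 < s * p) (hγ : 0 ≤ γ) (hγ1 : γ ≤ 1)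
    (hG : GrowthBound γ CG G) (t : ℤ) (x : ℝ) (j : ℕ) :
    ∫ ω, G (x + tailSum a 0 (histAt ε t ω)) ∂P
      = ∫ ω, partialMean μ a G j (x + tailSum a j (histAt ε (t - j) ω)) ∂P := by
  have := h.isProbabilityMeasure
  have := h.isProbabilityMeasure_law
  induction j with
  | zero => simp [partialMean]
  | succ j ih =>
    obtain ⟨C, hC⟩ := GrowthBound.partialMean (h.integrable_id hp) a (CG := CG) hγ hγ1 j
    have hK := hC G hG
    rw [ih]
    have h1 : ∫ ω, partialMean μ a G j (x + tailSum a j (histAt ε (t - j) ω)) ∂P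
        = ∫ ω, partialMean μ a G j (x + tailSum a (j + 1) (histAt ε (t - j - 1) ω)
          + a j * ε (t - j) ω) ∂P := by
      refine integral_congr_ae ?_
      filter_upwards [h.ae_tailSum_eq hp hp2 ha hs j (t - j)] with ω hω
      rw [hω]
      congr 1
      ring
    have hF : Measurable (Function.uncurry fun (z : ℕ → ℝ) (e : ℝ) =>
        partialMean μ a G j (x + tailSum a (j + 1) z + a j * e)) :=
      hK.measurable.comp ((((measurable_tailSum a (j + 1)).comp measurable_fst).const_add
        x).add (measurable_snd.const_mul _))
    have hFi : Integrable (fun ω => partialMean μ a G j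
        (x + tailSum a (j + 1) (histAt ε (t - j - 1) ω) + a j * ε (t - j) ω)) P := by
      have := hK.integrable_add hγ hγ1 (((h.memLp_tailSum hp hp2 ha hs (j + 1)
        (t - j - 1)).integrable (one_le_ofReal hp)).add
        ((h.integrable_coord hp (t - j)).const_mul (a j))) x
      simpa [add_assoc] using this
    rw [h1, IndepFun.integral_eq_integral_integral (h.measurable_histAt _) (h.measurable _)
      (h.indepFun_histAt (t - j)) hF hFi, h.law]
    simp only [partialMean]
    congr 1
    funext ω
    congr 1
    funext e
    rw [show t - ((j + 1 : ℕ) : ℤ) = t - j - 1 by push_cast; ring]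

/-- Once the averaged function is smooth, it stays smooth with uniform constants. -/
theorem exists_smoothGrowth_partialMean (h : CenteredNoise P ε μ p) (hp : 1 < p) (hp2 : p ≤ 2)
    (ha : HyperbolicDecay a A s) (hs : 1 < s * p) (hγ : 0 ≤ γ) (hγ1 : γ ≤ 1) {J : ℕ} {C : ℝ}
    (hJ : ∀ G, GrowthBound γ CG G → ∃ K', SmoothGrowth γ C (partialMean μ a G J) K') :
    ∃ C', ∀ G, GrowthBound γ CG G → ∃ K' : ℕ → ℝ → ℝ,
      ∀ j, J ≤ j → SmoothGrowth γ C' (partialMean μ a G j) (K' j) := by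
  have := h.isProbabilityMeasure
  obtain ⟨B, hB⟩ := h.exists_integral_abs_sum_rpow_le hp hp2 ha hs
  refine ⟨C * (2 + B), fun G hG => ?_⟩
  have key : ∀ j, ∃ K', J ≤ j → SmoothGrowth γ (C * (2 + B)) (partialMean μ a G j) K' := by
    intro j
    by_cases hj : J ≤ j
    · obtain ⟨m, rfl⟩ := Nat.exists_eq_add_of_le hj
      obtain ⟨K', hK⟩ := hJ G hG
      let S : Ω → ℝ := fun ω => ∑ i ∈ Finset.range m, a (J + i) * ε (i : ℤ) ω
      have hw := h.weighted (τ := fun i : ℕ => (i : ℤ)) Nat.cast_injective fun i => a (J + i)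
      have hSm : Measurable S := Finset.measurable_sum _ fun i _ => hw.1 i
      have hSi : Integrable S P := h.integrable_sum hp (fun i => a (J + i)) m
      have hSp : Integrable (fun ω => |S ω| ^ p) P :=
        (memLp_finsetSum _ fun i _ => hw.2.2.2.1 i).integrable_abs_rpow (by linarith)
      have hwm : Measurable fun x : ℝ => (1 + |x|) ^ γ := by fun_prop
      have hi : Integrable (fun x : ℝ => (1 + |x|) ^ γ) (P.map S) :=
        (integrable_map_measure hwm.aestronglyMeasurable hSm.aemeasurable).2
          (hSi.one_add_abs_rpow hγ1)
      -- Uses `(1 + |S|)^γ ≤ 1 + |S| ≤ 2 + |S|^p`.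
      have hM : ∫ x, (1 + |x|) ^ γ ∂(P.map S) ≤ 2 + B := by
        rw [integral_map hSm.aemeasurable hwm.aestronglyMeasurable]
        calc ∫ ω, (1 + |S ω|) ^ γ ∂P ≤ ∫ ω, (2 + |S ω| ^ p) ∂P := by
              refine integral_mono (hSi.one_add_abs_rpow hγ1) ((integrable_const 2).add hSp)
                fun ω => ?_
              refine (one_add_abs_rpow_le_one_add_abs hγ1 _).trans ?_
              rcases le_total (|S ω|) 1 with h1 | h1
              · linarith [Real.rpow_nonneg (abs_nonneg (S ω)) p]
              · have := Real.rpow_le_rpow_of_exponent_le h1 hp.le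
                rw [Real.rpow_one] at this
                linarith
          _ = 2 + ∫ ω, |S ω| ^ p ∂P := by
              rw [integral_add (integrable_const 2) hSp]; simp
          _ ≤ _ := by linarith [hB J m]
      -- Later partial means are translation averages of the one at `J`, so `SmoothGrowth.average`
      -- gives a bound independent of `m`.
      suffices hfun : partialMean μ a G (J + m)
          = fun y => ∫ x, partialMean μ a G J (y + x) ∂(P.map S) by
        rw [hfun]
        exact ⟨_, fun _ => hK.average hγ hi hM⟩
      funext y
      rw [h.partialMean_add hp hγ hγ1 hG J m y, integral_map hSm.aemeasurable]
      exact (hK.continuous.measurable.comp (measurable_const_add y)).aestronglyMeasurable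
    · exact ⟨0, fun h => absurd h hj⟩
  choose K' hK' using key
  exact ⟨K', hK'⟩

end CenteredNoise

/-! ### Smoothing by innovations in the two distributional cases. -/

/-- A probability measure with continuously differentiable distribution function is given by the
derivative of the latter. -/
theorem eq_withDensity_deriv_of_contDiff {μ : Measure ℝ} [IsProbabilityMeasure μ]
    (hF : ContDiff ℝ 1 fun x => μ.real (Set.Iic x)) :
    (∀ x, 0 ≤ deriv (fun x => μ.real (Set.Iic x)) x) ∧
      μ = volume.withDensity fun x => ENNReal.ofReal (deriv (fun x => μ.real (Set.Iic x)) x) := by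
  set F : ℝ → ℝ := fun x => μ.real (Set.Iic x)
  have hmono : Monotone F := fun x y hxy => measureReal_mono (Set.Iic_subset_Iic.2 hxy)
  have hc : Continuous (deriv F) := hF.continuous_deriv le_rfl
  have h0 : ∀ x, 0 ≤ deriv F x := fun x => hmono.deriv_nonneg
  refine ⟨h0, Measure.ext_of_Ioc _ _ fun a b hab => ?_⟩
  rw [withDensity_apply _ measurableSet_Ioc, ← ofReal_integral_eq_lintegral_ofReal
    (hc.integrableOn_Ioc) (Eventually.of_forall h0), ← intervalIntegral.integral_of_le hab.le,
    intervalIntegral.integral_deriv_eq_sub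
      (fun x _ => (hF.differentiable (by norm_num)) x) (hc.intervalIntegrable _ _)]
  rw [← Set.Iic_sdiff_Iic, measure_sdiff (Set.Iic_subset_Iic.2 hab.le)
    measurableSet_Iic.nullMeasurableSet (measure_ne_top _ _), ENNReal.ofReal_sub _ measureReal_nonneg]
  simp [F]

theorem partialMean_of_forall_lt {μ : Measure ℝ} [IsProbabilityMeasure μ] {a : ℕ → ℝ} {m : ℕ}
    (hm : ∀ i < m, a i = 0) (G : ℝ → ℝ) : partialMean μ a G m = G := by
  induction m with
  | zero => rfl
  | succ m ih =>
    funext y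
    simp only [partialMean, hm m (Nat.lt_succ_self m), zero_mul, add_zero, integral_const,
      probReal_univ, one_smul]
    rw [ih fun i hi => hm i (Nat.lt_succ_of_lt hi)]

/-- Smoothing by a single innovation with a weighted Lipschitz derivative of its density. -/
theorem exists_smoothGrowth_of_contDiff_distFun {μ : Measure ℝ} [IsProbabilityMeasure μ]
    (hμ : Integrable id μ) {a : ℕ → ℝ} (ha : ∃ i, a i ≠ 0) {γ β Ch CG : ℝ} (hγ : 0 ≤ γ)
    (hγ1 : γ ≤ 1) (hβ : 1 + γ < β) (hF : ContDiff ℝ 1 fun x => μ.real (Set.Iic x))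
    {f : ℝ → ℝ} (hfF : f = deriv fun x => μ.real (Set.Iic x)) (hf : ContDiff ℝ 1 f)
    (hf' : ∀ x, |deriv f x| ≤ Ch * (1 + |x|) ^ (-β))
    (hlip : ∀ x y, |x - y| < 1 → |deriv f x - deriv f y| ≤ Ch * |x - y| * (1 + |x|) ^ (-β)) :
    ∃ J C, ∀ G, GrowthBound γ CG G → ∃ K', SmoothGrowth γ C (partialMean μ a G J) K' := by
  classical
  obtain ⟨hf0, hμf⟩ := eq_withDensity_deriv_of_contDiff hF
  rw [← hfF] at hf0 hμf
  -- `m` is the first index with `a m ≠ 0`: the earlier innovations do not act, and this one already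
  -- smooths.
  let m := Nat.find ha
  have hm : a m ≠ 0 := Nat.find_spec ha
  have hm0 : ∀ i < m, a i = 0 := fun i hi => not_not.1 (Nat.find_min ha hi)
  have hfm : Measurable fun x => ENNReal.ofReal (f x) := hf.continuous.measurable.ennreal_ofReal
  have hint : Integrable fun x => (1 + |x|) ^ γ * |f x| := by
    have h1 : Integrable (fun x : ℝ => (1 + |x|) ^ γ) μ := hμ.one_add_abs_rpow hγ1
    rw [hμf, integrable_withDensity_iff_integrable_smul' hfm (by simp)] at h1
    refine h1.congr (Eventually.of_forall fun x => ?_)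
    simp only [smul_eq_mul]
    rw [ENNReal.toReal_ofReal (hf0 x), abs_of_nonneg (hf0 x), mul_comm]
  obtain ⟨C, hC⟩ := exists_smoothGrowth_of_density (CG := CG * (1 + |a m|) ^ γ) hγ hγ1 hβ
    (fun x => ((hf.differentiable (by norm_num)) x).hasDerivAt) hint hf' hlip
  refine ⟨m + 1, C * (1 + |(a m)⁻¹|) ^ 3, fun G hG => ?_⟩
  obtain ⟨K', hK⟩ := hC (fun u => G (a m * u)) (hG.measurable.comp (measurable_const_mul _))
    fun u => by
      refine (hG.abs_le _).trans ?_
      rw [mul_assoc]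
      refine mul_le_mul_of_nonneg_left ?_ hG.nonneg
      rw [← Real.mul_rpow (by positivity) (by positivity)]
      refine Real.rpow_le_rpow (by positivity) ?_ hγ
      rw [abs_mul]
      nlinarith [abs_nonneg (a m), abs_nonneg u]
  have h2 := hK.comp_mul hγ hγ1 (a m)⁻¹
  -- `G (y + a_m x)` is the dilated function `u ↦ G (a_m u)` at `a_m⁻¹ y + x`, so the convolution
  -- result applies and `comp_mul` undoes the scaling.
  have hfun : partialMean μ a G (m + 1)
      = fun y => ∫ x, G (a m * ((a m)⁻¹ * y + x)) * f x := by
    funext y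
    simp only [partialMean, partialMean_of_forall_lt hm0]
    rw [hμf, integral_withDensity_eq_integral_toReal_smul hfm (by simp)]
    congr 1
    funext x
    rw [ENNReal.toReal_ofReal (hf0 x), smul_eq_mul, mul_comm, mul_add, mul_inv_cancel_left₀ hm]
  rw [hfun]
  exact ⟨_, h2⟩

namespace CenteredNoise

variable {Ω : Type*} [MeasurableSpace Ω] {P : Measure Ω} {ε : ℤ → Ω → ℝ} {μ : Measure ℝ} {p : ℝ}
  {a : ℕ → ℝ} {γ CG : ℝ}

/-- Smoothing by finitely many innovations with finite variance and decaying characteristic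
function. -/
theorem exists_smoothGrowth_of_charFun (h : CenteredNoise P ε μ p) (hp : 1 < p)
    (hμ : MemLp id 2 μ) {δ D : ℝ} (hδ : 0 < δ) (hD : ∀ s, (1 + |s|) ^ δ * ‖charFun μ s‖ ≤ D)
    (ha : ∀ᶠ i in atTop, a i ≠ 0) (hγ : 0 ≤ γ) (hγ1 : γ < 1) :
    ∃ J C, ∀ G, GrowthBound γ CG G → ∃ K', SmoothGrowth γ C (partialMean μ a G J) K' := by
  have := h.isProbabilityMeasure
  have := h.isProbabilityMeasure_law
  obtain ⟨N, hN⟩ := exists_nat_ge (4 / δ)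
  have hN' : 4 ≤ δ * N := by rw [div_le_iff₀ hδ] at hN; linarith
  -- The factor `2π` matches the Fourier normalization in `exists_density_of_charFun_decay`.
  have hb : ∀ᶠ i in atTop, 2 * Real.pi * a i ≠ 0 := by
    filter_upwards [ha] with i hi
    have := Real.pi_ne_zero
    positivity
  obtain ⟨J, hJ⟩ := exists_derivDecay_prod_charFun hμ hδ hD hb (N + 2)
  obtain ⟨hc2, C, hC⟩ := hJ.exists_iteratedFDeriv_le hN'
  let S : Ω → ℝ := fun ω => ∑ i ∈ Finset.range J, a i * ε (i : ℤ) ω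
  have hSm : Measurable S := Finset.measurable_sum _ fun i _ => (h.measurable i).const_mul _
  have hSp : IsProbabilityMeasure (P.map S) := Measure.isProbabilityMeasure_map hSm.aemeasurable
  have hchar : ∀ t, charFun (P.map S) t = ∏ i ∈ Finset.range J, charFun μ (a i * t) := fun t =>
    charFun_map_sum_mul (η := fun i : ℕ => ε (i : ℤ)) (fun i => h.measurable i)
      (h.indep.precomp Nat.cast_injective) (fun i => h.law i) a J t
  obtain ⟨f, f', D, hd, hf, hf', hlip, hdens⟩ := exists_density_of_charFun_decay (ρ := P.map S)
    (fun s => by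
      rw [hchar]
      refine Finset.prod_congr rfl fun i _ => ?_
      congr 1; ring) hc2 hC
  have hfm : Measurable f :=
    (continuous_iff_continuousAt.2 fun y => (hd y).continuousAt).measurable
  have hint : Integrable fun x => (1 + |x|) ^ γ * |f x| := by
    refine ((integrable_one_add_abs_rpow (β := 2 - γ) (by linarith)).const_mul D).mono'
      (by fun_prop) (Eventually.of_forall fun x => ?_)
    rw [Real.norm_of_nonneg (by positivity)]
    calc _ ≤ (1 + |x|) ^ γ * (D * (1 + |x|) ^ (-2 : ℝ)) :=
          mul_le_mul_of_nonneg_left (hf x) (by positivity)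
      _ = D * ((1 + |x|) ^ γ * (1 + |x|) ^ (-2 : ℝ)) := by ring
      _ = _ := by rw [← Real.rpow_add (by positivity)]; congr 2; ring
  obtain ⟨C', hC'⟩ := exists_smoothGrowth_of_density (CG := CG) hγ hγ1.le (by linarith) hd hint
    hf' hlip
  refine ⟨J, C', fun G hG => ?_⟩
  obtain ⟨K', hK⟩ := hC' G hG.measurable hG.abs_le
  refine ⟨K', ?_⟩
  have hfun : partialMean μ a G J = fun y => ∫ x, G (y + x) * f x := by
    funext y
    have h1 := h.partialMean_add (a := a) hp hγ hγ1.le hG 0 J y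
    simp only [zero_add] at h1
    have hGy : Measurable fun x => G (y + x) := hG.measurable.comp (measurable_const_add y)
    rw [h1, ← hdens (fun x => G (y + x)) hGy, integral_map hSm.aemeasurable
      hGy.aestronglyMeasurable]
    · rfl
    · refine (hint.const_mul (CG * (1 + |y|) ^ γ)).mono' (hGy.mul hfm).aestronglyMeasurable
        (Eventually.of_forall fun x => ?_)
      rw [Real.norm_eq_abs, abs_mul, ← mul_assoc]
      exact mul_le_mul_of_nonneg_right (hG.abs_add_le hγ y x) (abs_nonneg _)
  rw [hfun]
  exact hK

end CenteredNoise

/-! ### Innovations and their decay in `L^r`. -/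

/-- Independence makes the norm multiplicative at one exponent `r`, so history and innovation need
no extra moments as they would with Hölder. -/
theorem eLpNorm_mul_of_indepFun {Ω E : Type*} [MeasurableSpace Ω] [MeasurableSpace E]
    {P : Measure Ω} {Y : Ω → E} {e : Ω → ℝ} (hY : Measurable Y) (he : Measurable e)
    (hind : IndepFun Y e P) {f : E → ℝ} {g : ℝ → ℝ} (hf : Measurable f) (hg : Measurable g)
    {r : ℝ} (hr : 0 < r) :
    eLpNorm (fun ω => f (Y ω) * g (e ω)) (ENNReal.ofReal r) P
      = eLpNorm (fun ω => f (Y ω)) (ENNReal.ofReal r) P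
        * eLpNorm (fun ω => g (e ω)) (ENNReal.ofReal r) P := by
  have h0 : ENNReal.ofReal r ≠ 0 := by simpa using hr
  simp only [eLpNorm_eq_lintegral_rpow_enorm_toReal h0 ENNReal.ofReal_ne_top,
    ENNReal.toReal_ofReal hr.le]
  rw [← ENNReal.mul_rpow_of_nonneg _ _ (by positivity : 0 ≤ 1 / r)]
  congr 1
  have := lintegral_mul_eq_lintegral_mul_lintegral_of_indepFun (μ := P)
    (f := fun ω => ‖f (Y ω)‖ₑ ^ r) (g := fun ω => ‖g (e ω)‖ₑ ^ r)
    ((hf.comp hY).enorm.pow_const r) ((hg.comp he).enorm.pow_const r)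
    (hind.comp (hf.enorm.pow_const r) (hg.enorm.pow_const r))
  rw [← this]
  refine lintegral_congr fun ω => ?_
  rw [Pi.mul_apply, enorm_mul, ENNReal.mul_rpow_of_nonneg _ _ hr.le]

/-- The Taylor polynomial at `y` has mean `K y` because the noise is centred, so only the remainder,
its mean and `(K' y - c) b e` survive. The last is controlled by passing from `y` to `0` and from
`K' 0` to `c`. -/
theorem SmoothGrowth.abs_centred_increment_le {γ C : ℝ} {K K' : ℝ → ℝ}
    (h : SmoothGrowth γ C K K') (hγ : 0 ≤ γ) (hγ1 : γ ≤ 1) {μ : Measure ℝ}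
    [IsProbabilityMeasure μ] (hμ : Integrable id μ) (hμ0 : ∫ x, x ∂μ = 0) {q : ℝ} (hq1 : 1 ≤ q)
    (hq : 1 + γ ≤ q) (hq2 : q ≤ 2) (hμq : Integrable (fun x => |x| ^ q) μ) {c β : ℝ}
    (hc : |K' 0 - c| ≤ β) (b y e : ℝ) :
    |K (y + b * e) - ∫ x, K (y + b * x) ∂μ - c * (b * e)|
      ≤ (C * |b| ^ q * (1 + |y|)) * (|e| ^ q + ∫ x, |x| ^ q ∂μ) + (|b| * (C * |y| + β)) * |e| := by
  have hC := h.const_nonneg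
  set R : ℝ → ℝ := fun e => K (y + b * e) - K y - K' y * (b * e) with hR
  have hRb : ∀ e, |R e| ≤ (C * |b| ^ q * (1 + |y|)) * |e| ^ q := by
    intro e
    have h1 := h.abs_taylor_le hq1 hq hq2 y (b * e)
    rw [abs_mul, Real.mul_rpow (abs_nonneg _) (abs_nonneg _)] at h1
    refine h1.trans ?_
    calc _ ≤ C * (1 + |y|) * (|b| ^ q * |e| ^ q) := by
          gcongr
          exact one_add_abs_rpow_le_one_add_abs hγ1 y
      _ = _ := by ring
  have hKi : Integrable (fun x => K (y + b * x)) μ :=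
    (GrowthBound.mk h.continuous.measurable h.abs_le).integrable_add hγ hγ1 (hμ.const_mul b) y
  have hlin : Integrable (fun x : ℝ => K' y * (b * x)) μ := (hμ.const_mul b).const_mul (K' y)
  have hint : ∫ x, R x ∂μ = ∫ x, K (y + b * x) ∂μ - K y := by
    have hKi2 : Integrable (fun x => K (y + b * x) - K y) μ := hKi.sub (integrable_const _)
    simp only [hR]
    rw [integral_sub hKi2 hlin, integral_sub hKi (integrable_const _), integral_const_mul,
      integral_const_mul, hμ0]
    simp
  have hRi : |∫ x, R x ∂μ| ≤ (C * |b| ^ q * (1 + |y|)) * ∫ x, |x| ^ q ∂μ := by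
    rw [← integral_const_mul]
    exact abs_integral_le_of_abs_le (hμq.const_mul _) hRb
  have h3 : |(K' y - c) * (b * e)| ≤ (|b| * (C * |y| + β)) * |e| := by
    rw [abs_mul, abs_mul]
    have h4 : |K' y - c| ≤ C * |y| + β := by
      have h5 := abs_add_le (K' y - K' 0) (K' 0 - c)
      rw [sub_add_sub_cancel] at h5
      linarith [h.abs_deriv_sub_zero_le y]
    calc _ ≤ (C * |y| + β) * (|b| * |e|) := by gcongr
      _ = _ := by ring
  have hsplit : K (y + b * e) - ∫ x, K (y + b * x) ∂μ - c * (b * e)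
      = R e - ∫ x, R x ∂μ + (K' y - c) * (b * e) := by
    rw [hint]; simp only [hR]; ring
  rw [hsplit]
  have h6 := abs_add_le (R e - ∫ x, R x ∂μ) ((K' y - c) * (b * e))
  have h7 := abs_sub (R e) (∫ x, R x ∂μ)
  have h8 := hRb e
  rw [mul_add]
  linarith

/-- The contribution of the innovation `e` arriving `j` steps ago to the linearization error,
given the history `z` before it. -/
noncomputable def innovation (μ : Measure ℝ) (a : ℕ → ℝ) (G : ℝ → ℝ) (c : ℝ) (j : ℕ)
    (z : ℕ → ℝ) (e : ℝ) : ℝ :=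
  partialMean μ a G j (tailSum a (j + 1) z + a j * e)
    - partialMean μ a G (j + 1) (tailSum a (j + 1) z) - c * (a j * e)

namespace CenteredNoise

variable {Ω : Type*} [MeasurableSpace Ω] {P : Measure Ω} {ε : ℤ → Ω → ℝ} {μ : Measure ℝ} {p : ℝ}
  {a : ℕ → ℝ} {A s γ CG : ℝ} {G : ℝ → ℝ}

theorem measurable_innovation (h : CenteredNoise P ε μ p) (hp : 1 < p) (hγ : 0 ≤ γ)
    (hγ1 : γ ≤ 1) (hG : GrowthBound γ CG G) (c : ℝ) (j : ℕ) :
    Measurable (Function.uncurry (innovation μ a G c j)) := by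
  have := h.isProbabilityMeasure_law
  obtain ⟨_, h1⟩ := GrowthBound.partialMean (h.integrable_id hp) a (CG := CG) hγ hγ1 j
  obtain ⟨_, h2⟩ := GrowthBound.partialMean (h.integrable_id hp) a (CG := CG) hγ hγ1 (j + 1)
  have ht : Measurable fun x : (ℕ → ℝ) × ℝ => tailSum a (j + 1) x.1 :=
    (measurable_tailSum a (j + 1)).comp measurable_fst
  exact (((h1 G hG).measurable.comp (ht.add (measurable_snd.const_mul _))).sub
    ((h2 G hG).measurable.comp ht)).sub ((measurable_snd.const_mul _).const_mul _)

theorem integral_innovation (h : CenteredNoise P ε μ p) (hp : 1 < p) (hγ : 0 ≤ γ)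
    (hγ1 : γ ≤ 1) (hG : GrowthBound γ CG G) (c : ℝ) (j : ℕ) (z : ℕ → ℝ) :
    ∫ e, innovation μ a G c j z e ∂μ = 0 := by
  have := h.isProbabilityMeasure_law
  obtain ⟨_, h1⟩ := GrowthBound.partialMean (h.integrable_id hp) a (CG := CG) hγ hγ1 j
  have hi : Integrable (fun e => partialMean μ a G j (tailSum a (j + 1) z + a j * e)) μ :=
    (h1 G hG).integrable_add hγ hγ1 ((h.integrable_id hp).const_mul (a j)) _
  have hi2 : Integrable (fun e => partialMean μ a G j (tailSum a (j + 1) z + a j * e)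
      - partialMean μ a G (j + 1) (tailSum a (j + 1) z)) μ := hi.sub (integrable_const _)
  have hl : Integrable (fun e : ℝ => c * (a j * e)) μ :=
    ((h.integrable_id hp).const_mul (a j)).const_mul c
  unfold innovation
  rw [integral_sub hi2 hl, integral_sub hi (integrable_const _), integral_const_mul,
    integral_const_mul, h.mean]
  simp [partialMean]

/-- The derivative at the origin of `x ↦ E[G(X_t + x)]`. -/
theorem hasDerivAt_shiftedMean (h : CenteredNoise P ε μ p) (hp : 1 < p) (hp2 : p ≤ 2)
    (ha : HyperbolicDecay a A s) (hs : 1 < s * p) (hγ : 0 ≤ γ) (hγ1 : γ ≤ 1)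
    (hG : GrowthBound γ CG G) {C : ℝ} {K' : ℝ → ℝ} {j : ℕ}
    (hK : SmoothGrowth γ C (partialMean μ a G j) K') (t : ℤ) :
    HasDerivAt (shiftedMean P G fun ω => tailSum a 0 (histAt ε t ω))
      (∫ ω, K' (tailSum a j (histAt ε (t - j) ω)) ∂P) 0 := by
  have := h.isProbabilityMeasure
  set Y : Ω → ℝ := fun ω => tailSum a j (histAt ε (t - j) ω)
  have hYm : Measurable Y := (measurable_tailSum a j).comp (h.measurable_histAt _)
  have hYi : Integrable Y P :=
    (h.memLp_tailSum hp hp2 ha hs j (t - j)).integrable (one_le_ofReal hp)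
  have hi : Integrable (fun x : ℝ => (1 + |x|) ^ γ) (P.map Y) :=
    (integrable_map_measure (by fun_prop : Measurable fun x : ℝ =>
      (1 + |x|) ^ γ).aestronglyMeasurable hYm.aemeasurable).2 (hYi.one_add_abs_rpow hγ1)
  have h1 := (hK.average hγ hi le_rfl).hasDerivAt 0
  -- `G` itself need not be differentiable; its shifted mean is an average of the smooth partial
  -- mean over the law of the tail.
  have h2 : (fun y => ∫ x, partialMean μ a G j (y + x) ∂(P.map Y))
      = shiftedMean P G fun ω => tailSum a 0 (histAt ε t ω) := by
    funext y
    have hm : Measurable fun x => partialMean μ a G j (y + x) :=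
      hK.continuous.measurable.comp (measurable_const_add y)
    simp_rw [shiftedMean, add_comm _ y]
    rw [integral_map hYm.aemeasurable hm.aestronglyMeasurable,
      ← h.integral_partialMean_tailSum hp hp2 ha hs hγ hγ1 hG t y j]
  rw [h2] at h1
  simp only [zero_add] at h1
  rwa [integral_map hYm.aemeasurable hK.measurable_deriv.aestronglyMeasurable] at h1

theorem integral_abs_le_of_eLpNorm_le {Y : Ω → ℝ} [IsProbabilityMeasure P] (hp : 1 < p)
    (hY : AEStronglyMeasurable Y P) {B : ℝ} (hB : 0 ≤ B)
    (hYB : eLpNorm Y (ENNReal.ofReal p) P ≤ ENNReal.ofReal B) : ∫ ω, |Y ω| ∂P ≤ B := by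
  have h1 := (eLpNorm_le_eLpNorm_of_exponent_le (one_le_ofReal hp) hY).trans hYB
  rw [eLpNorm_one_eq_lintegral_enorm] at h1
  have h2 := integral_norm_eq_lintegral_enorm hY
  simp only [Real.norm_eq_abs] at h2
  rw [h2]
  exact ENNReal.toReal_le_of_le_ofReal hB h1

/-- Comparison of the linear coefficient with the derivative of the averaged function. -/
theorem exists_abs_deriv_sub_linCoeff_le (h : CenteredNoise P ε μ p) (hp : 1 < p) (hp2 : p ≤ 2)
    (ha : HyperbolicDecay a A s) (hs : 1 < s * p) (hγ : 0 ≤ γ) (hγ1 : γ ≤ 1) (C : ℝ) :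
    ∃ D, 0 ≤ D ∧ ∀ G K' j, GrowthBound γ CG G → SmoothGrowth γ C (partialMean μ a G j) K' →
      |K' 0 - linCoeff P G fun ω => tailSum a 0 (histAt ε 0 ω)|
        ≤ D * ((j : ℝ) + 1) ^ (1 / p - s) := by
  have := h.isProbabilityMeasure
  obtain ⟨B, hB0, hB⟩ := h.exists_eLpNorm_tailSum_le hp hp2 ha hs
  refine ⟨|C| * B, by positivity, fun G K' j hG hK => ?_⟩
  have hC := hK.const_nonneg
  -- The linear coefficient is the mean of `K'` at the tail, so its distance to `K' 0` is at most
  -- `C` times the first absolute moment of the tail.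
  rw [linCoeff, (h.hasDerivAt_shiftedMean hp hp2 ha hs hγ hγ1 hG hK 0).deriv, abs_of_nonneg hC]
  set Y : Ω → ℝ := fun ω => tailSum a j (histAt ε (0 - j) ω)
  have hYm : Measurable Y := (measurable_tailSum a j).comp (h.measurable_histAt _)
  have hYi : Integrable Y P :=
    (h.memLp_tailSum hp hp2 ha hs j (0 - j)).integrable (one_le_ofReal hp)
  have hb : ∀ ω, |K' 0 - K' (Y ω)| ≤ C * |Y ω| := fun ω => by
    rw [abs_sub_comm]; exact hK.abs_deriv_sub_zero_le _
  have hKY : Integrable (fun ω => K' (Y ω)) P := by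
    refine ((integrable_const |K' 0|).add (hYi.abs.const_mul C)).mono'
      (hK.measurable_deriv.comp hYm).aestronglyMeasurable (Eventually.of_forall fun ω => ?_)
    have h1 := abs_sub_abs_le_abs_sub (K' (Y ω)) (K' 0)
    have h2 := hK.abs_deriv_sub_zero_le (Y ω)
    simp only [Real.norm_eq_abs, Pi.add_apply]
    linarith
  have h3 : K' 0 - ∫ ω, K' (Y ω) ∂P = ∫ ω, (K' 0 - K' (Y ω)) ∂P := by
    rw [integral_sub (integrable_const _) hKY]; simp
  rw [h3]
  calc _ ≤ ∫ ω, C * |Y ω| ∂P := abs_integral_le_of_abs_le (hYi.abs.const_mul C) hb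
    _ = C * ∫ ω, |Y ω| ∂P := integral_const_mul _ _
    _ ≤ C * (B * ((j : ℝ) + 1) ^ (1 / p - s)) := mul_le_mul_of_nonneg_left
        (integral_abs_le_of_eLpNorm_le hp hYm.aestronglyMeasurable (by positivity)
          (hB j (0 - j))) hC
    _ = _ := by ring

end CenteredNoise

theorem eLpNorm_affine_abs_le {Ω : Type*} [MeasurableSpace Ω] {P : Measure Ω}
    [IsProbabilityMeasure P] {Y : Ω → ℝ} (hY : AEStronglyMeasurable Y P) {r p : ℝ} (hr : 1 ≤ r)
    (hrp : r ≤ p) {B u v : ℝ} (hu : 0 ≤ u) (hv : 0 ≤ v) (hB : 0 ≤ B)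
    (hYB : eLpNorm Y (ENNReal.ofReal p) P ≤ ENNReal.ofReal B) :
    eLpNorm (fun ω => u + v * |Y ω|) (ENNReal.ofReal r) P ≤ ENNReal.ofReal (u + v * B) := by
  have h1r : (1 : ℝ≥0∞) ≤ ENNReal.ofReal r := by
    rw [← ENNReal.ofReal_one]; exact ENNReal.ofReal_le_ofReal hr
  have h1 : AEStronglyMeasurable (fun ω => |Y ω|) P := hY.norm
  calc _ ≤ eLpNorm (fun _ : Ω => u) (ENNReal.ofReal r) P
        + eLpNorm (fun ω => v * |Y ω|) (ENNReal.ofReal r) P :=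
        eLpNorm_add_le aestronglyMeasurable_const (h1.const_mul v) h1r
    _ ≤ ENNReal.ofReal u + ENNReal.ofReal (v * B) := by
        gcongr
        · rw [eLpNorm_const u (by positivity) (NeZero.ne P)]
          simp [Real.enorm_of_nonneg hu]
        · have h2 := eLpNorm_const_smul v (fun ω => |Y ω|) (ENNReal.ofReal r) P
          change eLpNorm (fun ω => v * |Y ω|) _ P = _ at h2
          rw [h2, Real.enorm_of_nonneg hv, ENNReal.ofReal_mul hv]
          gcongr
          have h3 := eLpNorm_norm Y (p := ENNReal.ofReal r) (μ := P)
          simp only [Real.norm_eq_abs] at h3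
          rw [h3]
          exact (eLpNorm_le_eLpNorm_of_exponent_le (ENNReal.ofReal_le_ofReal hrp) hY).trans hYB
    _ = _ := (ENNReal.ofReal_add hu (by positivity)).symm

namespace CenteredNoise

variable {Ω : Type*} [MeasurableSpace Ω] {P : Measure Ω} {ε : ℤ → Ω → ℝ} {μ : Measure ℝ} {p : ℝ}
  {a : ℕ → ℝ} {A s γ CG : ℝ} {G : ℝ → ℝ}

theorem eLpNorm_comp_coord (h : CenteredNoise P ε μ p) {g : ℝ → ℝ} (hg : Measurable g)
    (q : ℝ≥0∞) (t : ℤ) : eLpNorm (fun ω => g (ε t ω)) q P = eLpNorm g q μ := by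
  rw [← h.law t, eLpNorm_map_measure hg.aestronglyMeasurable (h.measurable t).aemeasurable]
  rfl

theorem eLpNorm_coord_le (h : CenteredNoise P ε μ p) (t : ℤ) :
    eLpNorm (ε t) (ENNReal.ofReal p) P
      ≤ ENNReal.ofReal (eLpNorm id (ENNReal.ofReal p) μ).toReal := by
  rw [ENNReal.ofReal_toReal h.memLp.2.ne]
  exact (h.eLpNorm_comp_coord measurable_id _ t).le

theorem memLp_abs_rpow_add (h : CenteredNoise P ε μ p) {r : ℝ} (hr : 0 < r) (hp : 0 < p)
    (m : ℝ) : MemLp (fun x => |x| ^ (p / r) + m) (ENNReal.ofReal r) μ := by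
  have := h.isProbabilityMeasure_law
  have h1 := h.memLp.norm_rpow_div (ENNReal.ofReal (p / r))
  rw [← ENNReal.ofReal_div_of_pos (by positivity), div_div_cancel₀ hp.ne',
    ENNReal.toReal_ofReal (by positivity)] at h1
  exact h1.add (memLp_const m)

/-- Decay of the innovations in the smooth regime. -/
theorem exists_eLpNorm_innovation_le_of_le (h : CenteredNoise P ε μ p) (hp : 1 < p)
    (hp2 : p ≤ 2) (ha : HyperbolicDecay a A s) (hs : 1 < s * p) (hγ : 0 ≤ γ) (hγ1 : γ ≤ 1)
    {r θ : ℝ} (hr : 1 < r) (hrγ : r * (1 + γ) ≤ p) (hpr : p ≤ 2 * r) (hθ1 : θ ≤ s * (p / r))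
    (hθ2 : θ ≤ 2 * s - 1 / p) (J : ℕ) (C : ℝ) :
    ∃ D, 0 ≤ D ∧ ∀ G, GrowthBound γ CG G →
      (∃ K' : ℕ → ℝ → ℝ, ∀ j, J ≤ j → SmoothGrowth γ C (partialMean μ a G j) (K' j)) →
      ∀ j, J ≤ j → ∀ k,
      eLpNorm (fun ω => innovation μ a G (linCoeff P G fun ω => tailSum a 0 (histAt ε 0 ω)) j
        (histAt ε (k - 1) ω) (ε k ω)) (ENNReal.ofReal r) P
        ≤ ENNReal.ofReal (D * ((j : ℝ) + 1) ^ (-θ)) := by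
  have := h.isProbabilityMeasure
  have := h.isProbabilityMeasure_law
  have hr0 : 0 < r := by linarith
  have hrp : r ≤ p := by nlinarith
  obtain ⟨B, hB0, hB⟩ := h.exists_eLpNorm_tailSum_le hp hp2 ha hs
  obtain ⟨E, hE0, hE⟩ := h.exists_abs_deriv_sub_linCoeff_le (CG := CG) hp hp2 ha hs hγ hγ1 C
  -- The largest Taylor exponent for which a finite `p`-th moment puts `|e|^q` in `L^r`; `hrγ` and
  -- `hpr` say that `1 + γ ≤ q ≤ 2`.
  set q := p / r with hq
  have hq1 : 1 + γ ≤ q := by rw [hq, le_div_iff₀ hr0]; linarith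
  have hq2 : q ≤ 2 := (div_le_iff₀ hr0).2 hpr
  have hqp : q ≤ p := by rw [hq, div_le_iff₀ hr0]; nlinarith
  set m := ∫ x, |x| ^ q ∂μ
  have hm0 : 0 ≤ m := integral_nonneg fun x => Real.rpow_nonneg (abs_nonneg _) _
  have hμq : Integrable (fun x => |x| ^ q) μ :=
    MemLp.integrable_abs_rpow (f := id) (by linarith)
      (h.memLp.mono_exponent (ENNReal.ofReal_le_ofReal hqp))
  set N := (eLpNorm (fun x => |x| ^ q + m) (ENNReal.ofReal r) μ).toReal
  set M := (eLpNorm id (ENNReal.ofReal p) μ).toReal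
  have hN0 : 0 ≤ N := ENNReal.toReal_nonneg
  have hM0 : 0 ≤ M := ENNReal.toReal_nonneg
  have hA := ha.nonneg
  -- The first summand belongs to the Taylor remainder, of order `|a_j|^q`, the second to the linear
  -- term, of order `|a_j| (j+1)^(1/p-s)`.
  refine ⟨|C| * A ^ q * (1 + B) * N + A * (E + |C| * B) * M, by positivity,
    fun G hG ⟨K', hK⟩ j hj k => ?_⟩
  have hKj := hK j hj
  have hC := hKj.const_nonneg
  rw [abs_of_nonneg hC]
  set c := linCoeff P G fun ω => tailSum a 0 (histAt ε 0 ω)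
  set w : ℝ := (j : ℝ) + 1 with hw
  have hw1 : 1 ≤ w := by simp [hw]
  have hexp : 1 / p - s < 0 := by
    have : 1 / p < s := by rw [div_lt_iff₀ (by linarith)]; exact hs
    linarith
  have haj : |a j| ≤ A * w ^ (-s) := ha j
  set β := E * w ^ (1 / p - s)
  have hβ0 : 0 ≤ β := by positivity
  have hY := hB (j + 1) (k - 1)
  have hYw : ((j + 1 : ℕ) : ℝ) + 1 = w + 1 := by push_cast; rfl
  have hYm : AEStronglyMeasurable (fun ω => tailSum a (j + 1) (histAt ε (k - 1) ω)) P :=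
    ((measurable_tailSum a (j + 1)).comp (h.measurable_histAt (k - 1))).aestronglyMeasurable
  rw [hYw] at hY
  have hw2 : (w + 1) ^ (1 / p - s) ≤ w ^ (1 / p - s) :=
    Real.rpow_le_rpow_of_nonpos (by linarith) (by linarith) hexp.le
  have hw3 : w ^ (1 / p - s) ≤ 1 := Real.rpow_le_one_of_one_le_of_nonpos hw1 hexp.le
  have hY1 := hY.trans (ENNReal.ofReal_le_ofReal (mul_le_mul_of_nonneg_left hw2 hB0))
  have hY2 := hY1.trans (ENNReal.ofReal_le_ofReal (mul_le_of_le_one_right hB0 hw3))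
  let f1 : (ℕ → ℝ) → ℝ := fun z =>
    C * |a j| ^ q + C * |a j| ^ q * |tailSum a (j + 1) z|
  let f2 : (ℕ → ℝ) → ℝ := fun z => |a j| * β + |a j| * C * |tailSum a (j + 1) z|
  have htm := measurable_tailSum a (j + 1)
  have hf1 : Measurable f1 := (htm.abs.const_mul _).const_add _
  have hf2 : Measurable f2 := (htm.abs.const_mul _).const_add _
  have hgm : Measurable fun x : ℝ => |x| ^ q + m := by fun_prop
  have hgm2 : Measurable fun x : ℝ => |x| := by fun_prop
  have hpt : ∀ ω, ‖innovation μ a G c j (histAt ε (k - 1) ω) (ε k ω)‖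
      ≤ f1 (histAt ε (k - 1) ω) * (|ε k ω| ^ q + m) + f2 (histAt ε (k - 1) ω) * |ε k ω| := by
    intro ω
    have := hKj.abs_centred_increment_le hγ hγ1 (h.integrable_id hp) h.mean (by linarith) hq1 hq2
      hμq (hE G (K' j) j hG hKj) (a j) (tailSum a (j + 1) (histAt ε (k - 1) ω)) (ε k ω)
    refine this.trans (le_of_eq ?_)
    simp only [f1, f2, m]
    ring
  refine (eLpNorm_mono_real hpt).trans ?_
  have hm1 : Measurable fun ω => f1 (histAt ε (k - 1) ω) * (|ε k ω| ^ q + m) :=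
    (hf1.comp (h.measurable_histAt _)).mul (hgm.comp (h.measurable k))
  have hm2 : Measurable fun ω => f2 (histAt ε (k - 1) ω) * |ε k ω| :=
    (hf2.comp (h.measurable_histAt _)).mul (hgm2.comp (h.measurable k))
  refine (eLpNorm_add_le hm1.aestronglyMeasurable hm2.aestronglyMeasurable
    (one_le_ofReal hr)).trans ?_
  rw [eLpNorm_mul_of_indepFun (h.measurable_histAt _) (h.measurable k) (h.indepFun_histAt k) hf1
    hgm hr0, eLpNorm_mul_of_indepFun (h.measurable_histAt _) (h.measurable k)
    (h.indepFun_histAt k) hf2 hgm2 hr0]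
  have e1 : eLpNorm (fun ω => f1 (histAt ε (k - 1) ω)) (ENNReal.ofReal r) P
      ≤ ENNReal.ofReal (C * |a j| ^ q + C * |a j| ^ q * B) :=
    eLpNorm_affine_abs_le hYm hr.le hrp (by positivity) (by positivity) hB0 hY2
  have e2 : eLpNorm (fun ω => f2 (histAt ε (k - 1) ω)) (ENNReal.ofReal r) P
      ≤ ENNReal.ofReal (|a j| * β + |a j| * C * (B * w ^ (1 / p - s))) :=
    eLpNorm_affine_abs_le hYm hr.le hrp (by positivity) (by positivity) (by positivity) hY1
  have e3 : eLpNorm (fun ω => |ε k ω| ^ q + m) (ENNReal.ofReal r) P = ENNReal.ofReal N := by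
    rw [h.eLpNorm_comp_coord hgm, ENNReal.ofReal_toReal
      (h.memLp_abs_rpow_add hr0 (by linarith) m).2.ne]
  have e4 : eLpNorm (fun ω => |ε k ω|) (ENNReal.ofReal r) P ≤ ENNReal.ofReal M := by
    have := eLpNorm_affine_abs_le (h.measurable k).aestronglyMeasurable hr.le hrp le_rfl
      zero_le_one hM0 (h.eLpNorm_coord_le k)
    simpa using this
  -- The two upper bounds on `θ` are exactly what this and the next estimate require.
  have hwq : |a j| ^ q ≤ A ^ q * w ^ (-θ) := by
    calc _ ≤ (A * w ^ (-s)) ^ q := Real.rpow_le_rpow (abs_nonneg _) haj (by linarith)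
      _ = A ^ q * w ^ (-s * q) := by
        rw [Real.mul_rpow hA (by positivity), ← Real.rpow_mul (by positivity)]
      _ ≤ _ := by
        gcongr
        linarith
  have hwb : |a j| * w ^ (1 / p - s) ≤ A * w ^ (-θ) := by
    calc _ ≤ A * w ^ (-s) * w ^ (1 / p - s) := by gcongr
      _ = A * w ^ (-s + (1 / p - s)) := by rw [mul_assoc, ← Real.rpow_add (by positivity)]
      _ ≤ _ := by
        gcongr
        linarith
  calc _ ≤ ENNReal.ofReal (C * |a j| ^ q + C * |a j| ^ q * B) * ENNReal.ofReal N
        + ENNReal.ofReal (|a j| * β + |a j| * C * (B * w ^ (1 / p - s))) * ENNReal.ofReal M := by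
        rw [e3]; gcongr
    _ = ENNReal.ofReal ((C * |a j| ^ q + C * |a j| ^ q * B) * N
        + (|a j| * β + |a j| * C * (B * w ^ (1 / p - s))) * M) := by
        rw [← ENNReal.ofReal_mul (by positivity), ← ENNReal.ofReal_mul (by positivity),
          ← ENNReal.ofReal_add (by positivity) (by positivity)]
    _ ≤ _ := by
        refine ENNReal.ofReal_le_ofReal ?_
        calc _ = (C * (1 + B) * N) * |a j| ^ q
              + ((E + C * B) * M) * (|a j| * w ^ (1 / p - s)) := by simp only [β]; ring
          _ ≤ (C * (1 + B) * N) * (A ^ q * w ^ (-θ)) + ((E + C * B) * M) * (A * w ^ (-θ)) := by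
              gcongr
          _ = _ := by ring

/-- A crude bound for the finitely many innovations before smoothing sets in. -/
theorem exists_eLpNorm_innovation_le_const (h : CenteredNoise P ε μ p) (hp : 1 < p)
    (hp2 : p ≤ 2) (ha : HyperbolicDecay a A s) (hs : 1 < s * p) (hγ : 0 ≤ γ) (hγ1 : γ ≤ 1)
    {r : ℝ} (hr : 1 < r) (hrp : r ≤ p) (c₀ : ℝ) (j : ℕ) :
    ∃ D, 0 ≤ D ∧ ∀ G, GrowthBound γ CG G → ∀ c, |c| ≤ c₀ → ∀ k,
      eLpNorm (fun ω => innovation μ a G c j (histAt ε (k - 1) ω) (ε k ω)) (ENNReal.ofReal r) P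
        ≤ ENNReal.ofReal D := by
  have := h.isProbabilityMeasure
  have := h.isProbabilityMeasure_law
  obtain ⟨B, hB0, hB⟩ := h.exists_eLpNorm_tailSum_le hp hp2 ha hs
  obtain ⟨C1, h1⟩ := GrowthBound.partialMean (h.integrable_id hp) a (CG := CG) hγ hγ1 j
  obtain ⟨C2, h2⟩ := GrowthBound.partialMean (h.integrable_id hp) a (CG := CG) hγ hγ1 (j + 1)
  set M := (eLpNorm id (ENNReal.ofReal p) μ).toReal
  have hM0 : 0 ≤ M := ENNReal.toReal_nonneg
  refine ⟨((|C1| + |C2|) + (|C1| + |C2|) * B) + (0 + (|C1| + |c₀|) * |a j| * M), by positivity,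
    fun G hG c hc k => ?_⟩
  have hexp : 1 / p - s < 0 := by
    have : 1 / p < s := by rw [div_lt_iff₀ (by linarith)]; exact hs
    linarith
  have hY := (hB (j + 1) (k - 1)).trans (ENNReal.ofReal_le_ofReal (mul_le_of_le_one_right hB0
    (Real.rpow_le_one_of_one_le_of_nonpos (by simp; positivity) hexp.le)))
  have htm : Measurable fun ω => tailSum a (j + 1) (histAt ε (k - 1) ω) :=
    (measurable_tailSum a (j + 1)).comp (h.measurable_histAt (k - 1))
  have hem := h.measurable k
  have hpt : ∀ ω, ‖innovation μ a G c j (histAt ε (k - 1) ω) (ε k ω)‖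
      ≤ ((|C1| + |C2|) + (|C1| + |C2|) * |tailSum a (j + 1) (histAt ε (k - 1) ω)|)
        + (0 + (|C1| + |c₀|) * |a j| * |ε k ω|) := by
    intro ω
    set y := tailSum a (j + 1) (histAt ε (k - 1) ω)
    set e := ε k ω
    have b1 : |partialMean μ a G j (y + a j * e)| ≤ |C1| * (1 + |y| + |a j| * |e|) := by
      refine ((h1 G hG).abs_le _).trans ?_
      rw [abs_of_nonneg (h1 G hG).nonneg]
      refine mul_le_mul_of_nonneg_left ?_ (h1 G hG).nonneg
      refine (one_add_abs_rpow_le_one_add_abs hγ1 _).trans ?_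
      have := abs_add_le y (a j * e)
      rw [abs_mul] at this
      linarith
    have b2 : |partialMean μ a G (j + 1) y| ≤ |C2| * (1 + |y|) := by
      refine ((h2 G hG).abs_le _).trans ?_
      rw [abs_of_nonneg (h2 G hG).nonneg]
      exact mul_le_mul_of_nonneg_left (one_add_abs_rpow_le_one_add_abs hγ1 _) (h2 G hG).nonneg
    have b3 : |c * (a j * e)| ≤ |c₀| * (|a j| * |e|) := by
      rw [abs_mul, abs_mul]
      exact mul_le_mul_of_nonneg_right (hc.trans (le_abs_self _)) (by positivity)
    have b4 := abs_sub (partialMean μ a G j (y + a j * e) - partialMean μ a G (j + 1) y)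
      (c * (a j * e))
    have b5 := abs_sub (partialMean μ a G j (y + a j * e)) (partialMean μ a G (j + 1) y)
    change |partialMean μ a G j (y + a j * e) - partialMean μ a G (j + 1) y - c * (a j * e)| ≤ _
    linarith
  refine (eLpNorm_mono_real hpt).trans ?_
  refine (eLpNorm_add_le ((htm.abs.const_mul _).const_add _).aestronglyMeasurable
    ((hem.abs.const_mul _).const_add _).aestronglyMeasurable (one_le_ofReal hr)).trans ?_
  rw [ENNReal.ofReal_add (by positivity) (by positivity)]
  exact add_le_add
    (eLpNorm_affine_abs_le htm.aestronglyMeasurable hr.le hrp (by positivity) (by positivity)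
      hB0 hY)
    (eLpNorm_affine_abs_le hem.aestronglyMeasurable hr.le hrp le_rfl (by positivity) hM0
      (h.eLpNorm_coord_le k))

/-- Uniform decay of all innovations. -/
theorem exists_eLpNorm_innovation_le (h : CenteredNoise P ε μ p) (hp : 1 < p)
    (hp2 : p ≤ 2) (ha : HyperbolicDecay a A s) (hs : 1 < s * p) (hγ : 0 ≤ γ) (hγ1 : γ ≤ 1)
    {r θ : ℝ} (hr : 1 < r) (hrγ : r * (1 + γ) ≤ p) (hpr : p ≤ 2 * r) (hθ1 : θ ≤ s * (p / r))
    (hθ2 : θ ≤ 2 * s - 1 / p) (J : ℕ) (C : ℝ) :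
    ∃ D, 0 ≤ D ∧ ∀ G, GrowthBound γ CG G →
      (∃ K' : ℕ → ℝ → ℝ, ∀ j, J ≤ j → SmoothGrowth γ C (partialMean μ a G j) (K' j)) →
      ∀ j k,
      eLpNorm (fun ω => innovation μ a G (linCoeff P G fun ω => tailSum a 0 (histAt ε 0 ω)) j
        (histAt ε (k - 1) ω) (ε k ω)) (ENNReal.ofReal r) P
        ≤ ENNReal.ofReal (D * ((j : ℝ) + 1) ^ (-θ)) := by
  obtain ⟨D, hD0, hD⟩ := h.exists_eLpNorm_innovation_le_of_le (CG := CG) hp hp2 ha hs hγ hγ1 hr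
    hrγ hpr hθ1 hθ2 J C
  obtain ⟨E, hE0, hE⟩ := h.exists_abs_deriv_sub_linCoeff_le (CG := CG) hp hp2 ha hs hγ hγ1 C
  have hrp : r ≤ p := by nlinarith
  choose F hF0 hF using fun j => h.exists_eLpNorm_innovation_le_const (CG := CG) hp hp2 ha hs hγ
    hγ1 hr hrp (C + E) j
  have hsum0 : ∀ j ∈ Finset.range J, 0 ≤ F j * ((j : ℝ) + 1) ^ θ := fun j _ =>
    mul_nonneg (hF0 j) (by positivity)
  -- The constants of the finitely many lags before `J` are rescaled to fit the rate `(j+1)^(-θ)`.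
  refine ⟨D + ∑ j ∈ Finset.range J, F j * ((j : ℝ) + 1) ^ θ,
    add_nonneg hD0 (Finset.sum_nonneg hsum0), fun G hG hK j k => ?_⟩
  by_cases hj : J ≤ j
  · refine (hD G hG hK j hj k).trans (ENNReal.ofReal_le_ofReal ?_)
    refine mul_le_mul_of_nonneg_right ?_ (by positivity)
    linarith [Finset.sum_nonneg hsum0]
  · obtain ⟨K', hK'⟩ := hK
    -- The linear coefficient is bounded uniformly in `G`: `|K' 0| ≤ C` at lag `J`, and it differs
    -- from `K' 0` by at most `E`.
    have hc : |linCoeff P G fun ω => tailSum a 0 (histAt ε 0 ω)| ≤ C + E := by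
      have h1 := hE G (K' J) J hG (hK' J le_rfl)
      have hexp : 1 / p - s ≤ 0 := by
        have : 1 / p < s := by rw [div_lt_iff₀ (by linarith)]; exact hs
        linarith
      have h2 : E * ((J : ℝ) + 1) ^ (1 / p - s) ≤ E := mul_le_of_le_one_right hE0
        (Real.rpow_le_one_of_one_le_of_nonpos (by simp) hexp)
      have h3 := (hK' J le_rfl).abs_deriv_le 0
      simp only [abs_zero, add_zero, Real.one_rpow, mul_one] at h3
      rw [abs_le] at *
      constructor <;> linarith
    refine (hF j G hG _ hc k).trans (ENNReal.ofReal_le_ofReal ?_)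
    have h4 := Finset.single_le_sum hsum0 (Finset.mem_range.2 (not_le.1 hj))
    calc F j = F j * ((j : ℝ) + 1) ^ θ * ((j : ℝ) + 1) ^ (-θ) := by
          rw [mul_assoc, ← Real.rpow_add (by positivity)]; simp
      _ ≤ _ := mul_le_mul_of_nonneg_right (by linarith) (by positivity)

end CenteredNoise

/-! ### Total weight of an innovation within a block. -/

/-- The total weight `∑_t (t + M - i + 1) ^ (-θ)` that the innovation with index `i` receives in a
block of length `n` with `M` past innovations. -/
noncomputable def blockWeight (θ : ℝ) (n M i : ℕ) : ℝ :=
  ∑ t ∈ Finset.range n, if i ≤ t + M then (((t + M - i : ℕ) : ℝ) + 1) ^ (-θ) else 0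

theorem sum_range_ite_sub_eq (f : ℕ → ℝ) (n u : ℕ) :
    ∑ t ∈ Finset.range n, (if u ≤ t then f (t - u) else 0) = ∑ t ∈ Finset.range (n - u), f t := by
  induction n with
  | zero => simp
  | succ n ih =>
    rw [Finset.sum_range_succ, ih]
    by_cases h : u ≤ n
    · rw [if_pos h, Nat.succ_sub h, Finset.sum_range_succ]
    · rw [if_neg h, show n + 1 - u = 0 by omega, show n - u = 0 by omega, add_zero]

theorem blockWeight_nonneg (θ : ℝ) (n M i : ℕ) : 0 ≤ blockWeight θ n M i := by
  refine Finset.sum_nonneg fun t _ => ?_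
  split_ifs <;> positivity

/-- For past innovations (`i ≤ M`) the lag is at least `t`; for an innovation `M + u` inside the
block the lags start at 0 and there are `n - u` of them. Either way the sum over lags `0, …, n-1`
dominates. -/
theorem blockWeight_le {θ : ℝ} (hθ0 : 0 ≤ θ) (hθ : θ < 1) (n M i : ℕ) :
    blockWeight θ n M i ≤ 1 / (1 - θ) * (n : ℝ) ^ (1 - θ) := by
  refine le_trans ?_ (sum_range_succ_rpow_neg_le hθ0 hθ n)
  rcases le_total i M with h | h
  · refine Finset.sum_le_sum fun t _ => ?_
    rw [if_pos (by omega)]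
    refine Real.rpow_le_rpow_of_nonpos (by positivity) ?_ (by linarith)
    have : t ≤ t + M - i := by omega
    have : (t : ℝ) ≤ ((t + M - i : ℕ) : ℝ) := by exact_mod_cast this
    linarith
  · obtain ⟨u, rfl⟩ := Nat.exists_eq_add_of_le h
    have h1 := sum_range_ite_sub_eq (fun t => ((t : ℝ) + 1) ^ (-θ)) n u
    have h2 : blockWeight θ n M (M + u) = ∑ t ∈ Finset.range (n - u), ((t : ℝ) + 1) ^ (-θ) := by
      rw [← h1]
      refine Finset.sum_congr rfl fun t _ => ?_
      by_cases hu : u ≤ t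
      · rw [if_pos hu, if_pos (by omega), show t + M - (M + u) = t - u by omega]
      · rw [if_neg hu, if_neg (by omega)]
    rw [h2]
    exact Finset.sum_le_sum_of_subset_of_nonneg (Finset.range_mono (Nat.sub_le n u))
      fun _ _ _ => by positivity

theorem blockWeight_le_of_le {θ : ℝ} (hθ0 : 0 ≤ θ) {n M i : ℕ} (hi : i ≤ M) :
    blockWeight θ n M i ≤ n * (((M - i : ℕ) : ℝ) + 1) ^ (-θ) := by
  calc _ ≤ ∑ _t ∈ Finset.range n, (((M - i : ℕ) : ℝ) + 1) ^ (-θ) := by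
        refine Finset.sum_le_sum fun t _ => ?_
        rw [if_pos (by omega)]
        refine Real.rpow_le_rpow_of_nonpos (by positivity) ?_ (by linarith)
        have : M - i ≤ t + M - i := by omega
        have : ((M - i : ℕ) : ℝ) ≤ ((t + M - i : ℕ) : ℝ) := by exact_mod_cast this
        linarith
    _ = _ := by simp

/-- Innovations in the block and up to `n` steps before it have weight at most of order `n^(1-θ)`,
in total `n · n^(r(1-θ))`. Older ones, at distance `m`, have weight at most `n m^(-θ)`; as `θ r >
1`, their `r`-th powers sum to order `n^r n^(1-θr)`, the same order, uniformly in `M`. -/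
theorem exists_sum_blockWeight_rpow_le {θ r : ℝ} (hθ0 : 0 ≤ θ) (hθ : θ < 1) (hr : 1 < r)
    (hθr : 1 < θ * r) : ∃ K, 0 ≤ K ∧ ∀ n M : ℕ, 1 ≤ n →
      ∑ i ∈ Finset.range (n + M), blockWeight θ n M i ^ r ≤ K * (n : ℝ) ^ (r * (1 - θ) + 1) := by
  have hr0 : 0 < r := by linarith
  have hθ1 : 0 < 1 - θ := by linarith
  have hθr1 : 0 < θ * r - 1 := by linarith
  set K₁ := (1 / (1 - θ)) ^ r
  set K₂ := 1 + 1 / (θ * r - 1)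
  have hK₂ : 0 ≤ K₂ := by positivity
  refine ⟨K₁ + (K₁ + K₂), by positivity, fun n M hn => ?_⟩
  have hn1 : (1 : ℝ) ≤ n := by exact_mod_cast hn
  have hn0 : (0 : ℝ) < n := by linarith
  have hunif : ∀ i, blockWeight θ n M i ^ r ≤ K₁ * (n : ℝ) ^ (r * (1 - θ)) := by
    intro i
    refine (Real.rpow_le_rpow (blockWeight_nonneg _ _ _ _) (blockWeight_le hθ0 hθ n M i)
      hr0.le).trans (le_of_eq ?_)
    rw [Real.mul_rpow (by positivity) (by positivity), ← Real.rpow_mul hn0.le, mul_comm r]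
  have hnn : (n : ℝ) * (n : ℝ) ^ (r * (1 - θ)) = (n : ℝ) ^ (r * (1 - θ) + 1) := by
    rw [Real.rpow_add_one hn0.ne', mul_comm]
  -- Reversing the index makes `m` measure the distance into the past.
  have hfar : ∀ m, m < M → blockWeight θ n M (M - 1 - m) ^ r
      ≤ (n : ℝ) ^ r * ((m : ℝ) + 1) ^ (-(θ * r)) := by
    intro m hm
    refine (Real.rpow_le_rpow (blockWeight_nonneg _ _ _ _)
      (blockWeight_le_of_le hθ0 (by omega)) hr0.le).trans ?_
    rw [Real.mul_rpow hn0.le (by positivity), ← Real.rpow_mul (by positivity), neg_mul]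
    refine mul_le_mul_of_nonneg_left ?_ (by positivity)
    refine Real.rpow_le_rpow_of_nonpos (by positivity) ?_ (by linarith)
    have : m ≤ M - (M - 1 - m) := by omega
    have : (m : ℝ) ≤ ((M - (M - 1 - m) : ℕ) : ℝ) := by exact_mod_cast this
    linarith
  have hmin : ∀ m, m < M → blockWeight θ n M (M - 1 - m) ^ r
      ≤ if m < n then K₁ * (n : ℝ) ^ (r * (1 - θ))
        else (n : ℝ) ^ r * ((m : ℝ) + 1) ^ (-(θ * r)) := by
    intro m hm
    split_ifs
    · exact hunif _
    · exact hfar m hm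
  set f : ℕ → ℝ := fun m => if m < n then K₁ * (n : ℝ) ^ (r * (1 - θ))
        else (n : ℝ) ^ r * ((m : ℝ) + 1) ^ (-(θ * r)) with hf
  have hf0 : ∀ m, 0 ≤ f m := fun m => by
    simp only [hf]; split_ifs <;> positivity
  have hpast : ∑ i ∈ Finset.range M, blockWeight θ n M i ^ r
      ≤ (K₁ + K₂) * (n : ℝ) ^ (r * (1 - θ) + 1) := by
    rw [← Finset.sum_range_reflect]
    calc _ ≤ ∑ m ∈ Finset.range M, f m :=
          Finset.sum_le_sum fun m hm => hmin m (Finset.mem_range.1 hm)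
      _ ≤ ∑ m ∈ Finset.range (n + M), f m := Finset.sum_le_sum_of_subset_of_nonneg
          (Finset.range_mono (Nat.le_add_left M n)) fun m _ _ => hf0 m
      _ = ∑ m ∈ Finset.range n, f m + ∑ m ∈ Finset.range M, f (n + m) :=
          Finset.sum_range_add f n M
      _ ≤ ∑ _m ∈ Finset.range n, K₁ * (n : ℝ) ^ (r * (1 - θ))
          + ∑ m ∈ Finset.range M, (n : ℝ) ^ r * ((n : ℝ) + m) ^ (-(θ * r)) := by
          refine add_le_add (Finset.sum_le_sum fun m hm => ?_) (Finset.sum_le_sum fun m _ => ?_)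
          · simp only [hf]
            rw [if_pos (Finset.mem_range.1 hm)]
          · simp only [hf]
            rw [if_neg (by omega)]
            refine mul_le_mul_of_nonneg_left ?_ (by positivity)
            refine Real.rpow_le_rpow_of_nonpos (by positivity) ?_ (by linarith)
            push_cast; linarith
      _ ≤ K₁ * (n : ℝ) ^ (r * (1 - θ) + 1) + (n : ℝ) ^ r * (K₂ * (n : ℝ) ^ (1 - θ * r)) := by
          refine add_le_add (le_of_eq ?_) ?_
          · rw [Finset.sum_const, Finset.card_range, nsmul_eq_mul, ← hnn]; ring
          · rw [← Finset.mul_sum]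
            exact mul_le_mul_of_nonneg_left (sum_range_add_rpow_neg_le hθr hn1 M)
              (by positivity)
      _ = _ := by
          have : (n : ℝ) ^ r * (n : ℝ) ^ (1 - θ * r) = (n : ℝ) ^ (r * (1 - θ) + 1) := by
            rw [← Real.rpow_add hn0]; congr 1; ring
          rw [← this]; ring
  rw [add_comm n M, Finset.sum_range_add]
  have hcur : ∑ i ∈ Finset.range n, blockWeight θ n M (M + i) ^ r
      ≤ K₁ * (n : ℝ) ^ (r * (1 - θ) + 1) := by
    calc _ ≤ ∑ _i ∈ Finset.range n, K₁ * (n : ℝ) ^ (r * (1 - θ)) :=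
          Finset.sum_le_sum fun i _ => hunif _
      _ = _ := by
          rw [Finset.sum_const, Finset.card_range, nsmul_eq_mul, ← hnn]; ring
  linarith

/-! ### Von Bahr–Esseen for functions of the history. -/

namespace CenteredNoise

variable {Ω : Type*} [MeasurableSpace Ω] {P : Measure Ω} {ε : ℤ → Ω → ℝ} {μ : Measure ℝ} {p : ℝ}
  {a : ℕ → ℝ} {A s γ CG : ℝ} {G : ℝ → ℝ}

/-- The von Bahr–Esseen inequality for functions of the history with vanishing conditional
means. -/
theorem integral_abs_sum_history_le (h : CenteredNoise P ε μ p) {r : ℝ} (hr : 1 < r)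
    (hr2 : r ≤ 2) {g : ℕ → (ℕ → ℝ) → ℝ → ℝ} (hg : ∀ i, Measurable (Function.uncurry (g i)))
    (hg0 : ∀ i z, ∫ e, g i z e ∂μ = 0) (k : ℤ)
    (hL : ∀ i : ℕ, MemLp (fun ω => g i (histAt ε (k + i - 1) ω) (ε (k + i) ω))
      (ENNReal.ofReal r) P) (m : ℕ) :
    ∫ ω, |∑ i ∈ Finset.range m, g i (histAt ε (k + i - 1) ω) (ε (k + i) ω)| ^ r ∂P
      ≤ 2 * r * ∑ i ∈ Finset.range m,
        ∫ ω, |g i (histAt ε (k + i - 1) ω) (ε (k + i) ω)| ^ r ∂P := by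
  have := h.isProbabilityMeasure
  -- The sum of the first `m` terms is a function of the history before time `k + m`, hence
  -- independent of `ε (k + m)`; this lets the one-step inequality be iterated.
  have hrep : ∀ m : ℕ, ∃ S : (ℕ → ℝ) → ℝ, Measurable S ∧ ∀ ω,
      ∑ i ∈ Finset.range m, g i (histAt ε (k + i - 1) ω) (ε (k + i) ω)
        = S (histAt ε (k + m - 1) ω) := by
    intro m
    induction m with
    | zero => exact ⟨fun _ => 0, measurable_const, fun ω => by simp⟩
    | succ m ih =>
      obtain ⟨S, hS, hSe⟩ := ih
      have hshift : Measurable fun (x : ℕ → ℝ) (i : ℕ) => x (i + 1) :=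
        measurable_pi_lambda _ fun i => measurable_pi_apply _
      refine ⟨fun x => S (fun i => x (i + 1)) + g m (fun i => x (i + 1)) (x 0),
        (hS.comp hshift).add ((hg m).comp (hshift.prodMk (measurable_pi_apply 0))), fun ω => ?_⟩
      have e1 : (fun i => histAt ε (k + (m + 1 : ℕ) - 1) ω (i + 1))
          = histAt ε (k + m - 1) ω := by
        funext i
        simp only [histAt]
        congr 1
        push_cast; ring
      have e2 : histAt ε (k + (m + 1 : ℕ) - 1) ω 0 = ε (k + m) ω := by
        simp only [histAt]
        congr 1
        push_cast; ring
      rw [Finset.sum_range_succ, hSe]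
      change _ = S (fun i => histAt ε (k + (m + 1 : ℕ) - 1) ω (i + 1))
        + g m (fun i => histAt ε (k + (m + 1 : ℕ) - 1) ω (i + 1))
          (histAt ε (k + (m + 1 : ℕ) - 1) ω 0)
      rw [e1, e2]
  induction m with
  | zero => simp [Real.zero_rpow (by linarith : r ≠ 0)]
  | succ m ih =>
    obtain ⟨S, hS, hSe⟩ := hrep m
    have hSL : MemLp (fun ω => S (histAt ε (k + m - 1) ω)) (ENNReal.ofReal r) P := by
      simp_rw [← hSe]
      exact memLp_finsetSum _ fun i _ => hL i
    have := integral_abs_add_rpow_le_of_indepFun (h.measurable_histAt (k + m - 1))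
      (h.measurable (k + m)) (h.indepFun_histAt (k + m)) hS (hg m)
      (fun z => by rw [h.law]; exact hg0 m z) hr hr2 hSL (hL m)
    simp_rw [← hSe] at this
    simp only [Finset.sum_range_succ]
    linarith

theorem eLpNorm_sum_history_le (h : CenteredNoise P ε μ p) {r : ℝ} (hr : 1 < r)
    (hr2 : r ≤ 2) {g : ℕ → (ℕ → ℝ) → ℝ → ℝ} (hg : ∀ i, Measurable (Function.uncurry (g i)))
    (hg0 : ∀ i z, ∫ e, g i z e ∂μ = 0) (k : ℤ) {d : ℕ → ℝ} (hd0 : ∀ i, 0 ≤ d i)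
    (hd : ∀ i : ℕ, eLpNorm (fun ω => g i (histAt ε (k + i - 1) ω) (ε (k + i) ω))
      (ENNReal.ofReal r) P ≤ ENNReal.ofReal (d i)) (m : ℕ) :
    eLpNorm (fun ω => ∑ i ∈ Finset.range m, g i (histAt ε (k + i - 1) ω) (ε (k + i) ω))
      (ENNReal.ofReal r) P
      ≤ ENNReal.ofReal ((2 * r * ∑ i ∈ Finset.range m, d i ^ r) ^ (1 / r)) := by
  have hr0 : 0 < r := by linarith
  have hL : ∀ i : ℕ, MemLp (fun ω => g i (histAt ε (k + i - 1) ω) (ε (k + i) ω))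
      (ENNReal.ofReal r) P := fun i =>
    ⟨((hg i).comp ((h.measurable_histAt _).prodMk (h.measurable _))).aestronglyMeasurable,
      (hd i).trans_lt ENNReal.ofReal_lt_top⟩
  have hS := memLp_finsetSum (Finset.range m) fun i _ => hL i
  rw [hS.eLpNorm_eq_ofReal_integral hr0]
  refine ENNReal.ofReal_le_ofReal (Real.rpow_le_rpow
    (integral_nonneg fun ω => Real.rpow_nonneg (abs_nonneg _) _) ?_ (by positivity))
  refine (h.integral_abs_sum_history_le hr hr2 hg hg0 k hL m).trans ?_
  refine mul_le_mul_of_nonneg_left (Finset.sum_le_sum fun i _ => ?_) (by positivity)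
  rw [(hL i).integral_abs_rpow_eq hr0]
  exact Real.rpow_le_rpow ENNReal.toReal_nonneg (ENNReal.toReal_le_of_le_ofReal (hd0 i) (hd i))
    hr0.le

end CenteredNoise

/-! ### Telescoping of the linearization error and the moment bound. -/

/-- Regroups a sum over times `t` and lags `j` by the innovation index `i = t + M - j`. -/
theorem sum_range_sum_range_eq (f : ℕ → ℕ → ℝ) (n M : ℕ) :
    ∑ t ∈ Finset.range n, ∑ j ∈ Finset.range (t + M + 1), f j (t + M - j)
      = ∑ i ∈ Finset.range (n + M), ∑ t ∈ Finset.range n,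
        if i ≤ t + M then f (t + M - i) i else 0 := by
  rw [Finset.sum_comm (s := Finset.range (n + M))]
  refine Finset.sum_congr rfl fun t ht => ?_
  have ht' := Finset.mem_range.1 ht
  rw [← Finset.sum_filter, ← Finset.sum_range_reflect]
  refine Finset.sum_congr ?_ fun i hi => ?_
  · ext i
    simp only [Finset.mem_range, Finset.mem_filter]
    omega
  · have hi' := (Finset.mem_filter.1 hi).2
    rw [show t + M + 1 - 1 - i = t + M - i by omega, show t + M - (t + M - i) = i by omega]

namespace CenteredNoise

variable {Ω : Type*} [MeasurableSpace Ω] {P : Measure Ω} {ε : ℤ → Ω → ℝ} {μ : Measure ℝ} {p : ℝ}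
  {a : ℕ → ℝ} {A s γ CG : ℝ} {G : ℝ → ℝ}

/-- The linearization error telescopes into innovations. -/
theorem ae_sub_eq_sum_innovation (h : CenteredNoise P ε μ p) (hp : 1 < p) (hp2 : p ≤ 2)
    (ha : HyperbolicDecay a A s) (hs : 1 < s * p) (G : ℝ → ℝ) (c : ℝ) :
    ∀ᵐ ω ∂P, ∀ (t : ℤ) (N : ℕ),
      G (tailSum a 0 (histAt ε t ω)) - c * tailSum a 0 (histAt ε t ω)
        = ∑ j ∈ Finset.range N, innovation μ a G c j (histAt ε (t - j - 1) ω) (ε (t - j) ω)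
          + (partialMean μ a G N (tailSum a N (histAt ε (t - N) ω))
            - c * tailSum a N (histAt ε (t - N) ω)) := by
  have hae : ∀ᵐ ω ∂P, ∀ (j : ℕ) (k : ℤ), tailSum a j (histAt ε k ω)
      = a j * ε k ω + tailSum a (j + 1) (histAt ε (k - 1) ω) :=
    ae_all_iff.2 fun j => ae_all_iff.2 fun k => h.ae_tailSum_eq hp hp2 ha hs j k
  filter_upwards [hae] with ω hω t N
  induction N with
  | zero => simp [partialMean]
  | succ N ih =>
    rw [ih, Finset.sum_range_succ, hω N (t - N), innovation,
      show t - ((N + 1 : ℕ) : ℤ) = t - N - 1 by push_cast; ring,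
      add_comm (a N * ε (t - N) ω)]
    ring

theorem integrable_innovation (h : CenteredNoise P ε μ p) (hp : 1 < p) (hγ : 0 ≤ γ)
    (hγ1 : γ ≤ 1) (hG : GrowthBound γ CG G) (c : ℝ) (j : ℕ) (z : ℕ → ℝ) :
    Integrable (innovation μ a G c j z) μ := by
  have := h.isProbabilityMeasure_law
  obtain ⟨_, h1⟩ := GrowthBound.partialMean (h.integrable_id hp) a (CG := CG) hγ hγ1 j
  exact (((h1 G hG).integrable_add hγ hγ1 ((h.integrable_id hp).const_mul (a j)) _).sub
    (integrable_const _)).sub (((h.integrable_id hp).const_mul (a j)).const_mul c)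

/-- The tail tends to zero in `L^p`, so its image under the `N`-th partial mean is close to the
value at 0, and by the tower property so is `E[G(X_0)]`. No rate is needed, since `N` is eventually
sent to infinity. -/
theorem exists_eLpNorm_remainder_le (h : CenteredNoise P ε μ p) (hp : 1 < p) (hp2 : p ≤ 2)
    (ha : HyperbolicDecay a A s) (hs : 1 < s * p) (hγ : 0 ≤ γ) (hγ1 : γ ≤ 1) {r : ℝ}
    (hr : 1 < r) (hrγ : r * (1 + γ) ≤ p) (hpr : p ≤ 2 * r) (hG : GrowthBound γ CG G) {J : ℕ}
    {C : ℝ} {K' : ℕ → ℝ → ℝ}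
    (hK : ∀ j, J ≤ j → SmoothGrowth γ C (partialMean μ a G j) (K' j)) (c : ℝ) :
    ∃ ρ : ℕ → ℝ, Tendsto ρ atTop (𝓝 0) ∧ ∀ N, J ≤ N → ∀ k,
      eLpNorm (fun ω => partialMean μ a G N (tailSum a N (histAt ε k ω))
        - c * tailSum a N (histAt ε k ω) - ∫ ω', G (tailSum a 0 (histAt ε 0 ω')) ∂P)
        (ENNReal.ofReal r) P ≤ ENNReal.ofReal (ρ N) := by
  have := h.isProbabilityMeasure
  obtain ⟨B, hB0, hB⟩ := h.exists_eLpNorm_tailSum_le hp hp2 ha hs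
  have hr0 : 0 < r := by linarith
  have hrp : r ≤ p := by nlinarith
  have hC : 0 ≤ C := (hK J le_rfl).const_nonneg
  set q := p / r with hq
  have hqγ : 1 + γ ≤ q := by rw [hq, le_div_iff₀ hr0]; linarith
  have hq1 : 1 ≤ q := by linarith
  have hq0 : 0 < q := by linarith
  have hq2 : q ≤ 2 := (div_le_iff₀ hr0).2 hpr
  -- Hence the `L^r` norm of `|Y|^q` is the `q`-th power of the `L^p` norm of `Y`.
  have hrq : ENNReal.ofReal r * ENNReal.ofReal q = ENNReal.ofReal p := by
    rw [← ENNReal.ofReal_mul hr0.le, hq, mul_div_cancel₀ _ hr0.ne']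
  set b : ℕ → ℝ := fun N => B * ((N : ℝ) + 1) ^ (1 / p - s) with hb
  have hb0 : ∀ N, 0 ≤ b N := fun N => by positivity
  have hbt : Tendsto b atTop (𝓝 0) := by
    have h1 : 1 / p - s < 0 := by
      have : 1 / p < s := by rw [div_lt_iff₀ (by linarith)]; exact hs
      linarith
    have h2 := (tendsto_rpow_neg_atTop (by linarith : 0 < -(1 / p - s))).comp
      (tendsto_atTop_add_const_right atTop (1 : ℝ) tendsto_natCast_atTop_atTop)
    simpa only [neg_neg, Function.comp_def, mul_zero] using h2.const_mul B
  refine ⟨fun N => (C + |c|) * b N + C * b N ^ q + (C * b N + C * b N ^ q), ?_,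
    fun N hN k => ?_⟩
  · have hbq : Tendsto (fun N => b N ^ q) atTop (𝓝 0) := by
      have := hbt.rpow_const (p := q) (Or.inr hq0.le)
      rwa [Real.zero_rpow hq0.ne'] at this
    have := ((hbt.const_mul (C + |c|)).add (hbq.const_mul C)).add
      ((hbt.const_mul C).add (hbq.const_mul C))
    simpa using this
  · have hKN := hK N hN
    set Y : ℤ → Ω → ℝ := fun k ω => tailSum a N (histAt ε k ω) with hY
    have hYm : ∀ k, Measurable (Y k) := fun k =>
      (measurable_tailSum a N).comp (h.measurable_histAt k)
    have hYr : ∀ k, eLpNorm (fun ω => |Y k ω|) (ENNReal.ofReal r) P ≤ ENNReal.ofReal (b N) := by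
      intro k
      have h3 := eLpNorm_norm (Y k) (p := ENNReal.ofReal r) (μ := P)
      simp only [Real.norm_eq_abs] at h3
      rw [h3]
      exact (eLpNorm_le_eLpNorm_of_exponent_le (ENNReal.ofReal_le_ofReal hrp)
        (hYm k).aestronglyMeasurable).trans (hB N k)
    have hYq : ∀ k, eLpNorm (fun ω => |Y k ω| ^ q) (ENNReal.ofReal r) P
        ≤ ENNReal.ofReal (b N ^ q) := by
      intro k
      have h3 := eLpNorm_norm_rpow (μ := P) (p := ENNReal.ofReal r) (Y k) hq0
      simp only [Real.norm_eq_abs] at h3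
      rw [h3, hrq, ← ENNReal.ofReal_rpow_of_nonneg (hb0 N) hq0.le]
      exact ENNReal.rpow_le_rpow (hB N k) hq0.le
    have h1r := one_le_ofReal hr
    have hmq : ∀ k, Measurable fun ω => |Y k ω| ^ q := fun k => (hYm k).abs.pow_const q
    have hY1 : ∀ k, Integrable (fun ω => |Y k ω|) P := fun k =>
      MemLp.integrable h1r ⟨(hYm k).abs.aestronglyMeasurable,
        (hYr k).trans_lt ENNReal.ofReal_lt_top⟩
    have hYq1 : ∀ k, Integrable (fun ω => |Y k ω| ^ q) P := fun k =>
      MemLp.integrable h1r ⟨(hmq k).aestronglyMeasurable,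
        (hYq k).trans_lt ENNReal.ofReal_lt_top⟩
    have hmean : |∫ ω, G (tailSum a 0 (histAt ε 0 ω)) ∂P - partialMean μ a G N 0|
        ≤ C * b N + C * b N ^ q := by
      have e1 := h.integral_partialMean_tailSum hp hp2 ha hs hγ hγ1 hG 0 0 N
      simp only [zero_add] at e1
      have hi : Integrable (fun ω => partialMean μ a G N (Y (0 - N) ω)) P := by
        have := (GrowthBound.mk hKN.continuous.measurable hKN.abs_le).integrable_add hγ hγ1
          ((h.memLp_tailSum hp hp2 ha hs N (0 - N)).integrable (one_le_ofReal hp)) 0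
        simpa only [zero_add] using this
      have e2 : ∫ ω, G (tailSum a 0 (histAt ε 0 ω)) ∂P - partialMean μ a G N 0
          = ∫ ω, (partialMean μ a G N (Y (0 - N) ω) - partialMean μ a G N 0) ∂P := by
        rw [e1, integral_sub hi (integrable_const _)]; simp [hY]
      rw [e2]
      refine (abs_integral_le_of_abs_le (((hY1 (0 - N)).const_mul C).add
        ((hYq1 (0 - N)).const_mul C)) fun ω => hKN.abs_sub_zero_le hq1 hqγ hq2 _).trans ?_
      simp only [Pi.add_apply]
      rw [integral_add ((hY1 (0 - N)).const_mul C) ((hYq1 (0 - N)).const_mul C),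
        integral_const_mul, integral_const_mul]
      have f1 := integral_abs_le_of_eLpNorm_le hr (hYm (0 - N)).abs.aestronglyMeasurable (hb0 N)
        (hYr (0 - N))
      have f2 := integral_abs_le_of_eLpNorm_le hr (hmq (0 - N)).aestronglyMeasurable
        (Real.rpow_nonneg (hb0 N) q) (hYq (0 - N))
      simp only [abs_abs, Real.abs_rpow_of_nonneg (abs_nonneg _)] at f1 f2
      gcongr
    have hpt : ∀ ω, ‖partialMean μ a G N (Y k ω) - c * Y k ω
        - ∫ ω', G (tailSum a 0 (histAt ε 0 ω')) ∂P‖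
        ≤ (C + |c|) * |Y k ω| + C * |Y k ω| ^ q + (C * b N + C * b N ^ q) := by
      intro ω
      have g1 := hKN.abs_sub_zero_le hq1 hqγ hq2 (Y k ω)
      have g2 : |c * Y k ω| = |c| * |Y k ω| := abs_mul _ _
      rw [Real.norm_eq_abs]
      have g3 : partialMean μ a G N (Y k ω) - c * Y k ω
          - ∫ ω', G (tailSum a 0 (histAt ε 0 ω')) ∂P
          = (partialMean μ a G N (Y k ω) - partialMean μ a G N 0) - c * Y k ω
            - (∫ ω', G (tailSum a 0 (histAt ε 0 ω')) ∂P - partialMean μ a G N 0) := by ring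
      rw [g3]
      have g4 := abs_sub ((partialMean μ a G N (Y k ω) - partialMean μ a G N 0) - c * Y k ω)
        (∫ ω', G (tailSum a 0 (histAt ε 0 ω')) ∂P - partialMean μ a G N 0)
      have g5 := abs_sub (partialMean μ a G N (Y k ω) - partialMean μ a G N 0) (c * Y k ω)
      linarith
    have hsm : ∀ (v : ℝ), 0 ≤ v → ∀ (f : Ω → ℝ) (β : ℝ),
        eLpNorm f (ENNReal.ofReal r) P ≤ ENNReal.ofReal β →
        eLpNorm (fun ω => v * f ω) (ENNReal.ofReal r) P ≤ ENNReal.ofReal (v * β) := by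
      intro v hv f β hf
      have h2 := eLpNorm_const_smul v f (ENNReal.ofReal r) P
      change eLpNorm (fun ω => v * f ω) _ P = _ at h2
      rw [h2, Real.enorm_of_nonneg hv, ENNReal.ofReal_mul hv]
      gcongr
    have hc0 : 0 ≤ C * b N + C * b N ^ q := by have := hb0 N; positivity
    have hbN := hb0 N
    have m1 : AEStronglyMeasurable (fun ω => (C + |c|) * |Y k ω|) P :=
      ((hYm k).abs.const_mul _).aestronglyMeasurable
    have m2 : AEStronglyMeasurable (fun ω => C * |Y k ω| ^ q) P :=
      ((hmq k).const_mul _).aestronglyMeasurable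
    calc _ ≤ eLpNorm (fun ω => (C + |c|) * |Y k ω| + C * |Y k ω| ^ q
          + (C * b N + C * b N ^ q)) (ENNReal.ofReal r) P := eLpNorm_mono_real hpt
      _ ≤ eLpNorm (fun ω => (C + |c|) * |Y k ω| + C * |Y k ω| ^ q) (ENNReal.ofReal r) P
          + eLpNorm (fun _ : Ω => C * b N + C * b N ^ q) (ENNReal.ofReal r) P :=
          eLpNorm_add_le (m1.add m2) aestronglyMeasurable_const h1r
      _ ≤ (eLpNorm (fun ω => (C + |c|) * |Y k ω|) (ENNReal.ofReal r) P
          + eLpNorm (fun ω => C * |Y k ω| ^ q) (ENNReal.ofReal r) P)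
          + eLpNorm (fun _ : Ω => C * b N + C * b N ^ q) (ENNReal.ofReal r) P := by
          gcongr
          exact eLpNorm_add_le m1 m2 h1r
      _ ≤ (ENNReal.ofReal ((C + |c|) * b N) + ENNReal.ofReal (C * b N ^ q))
          + ENNReal.ofReal (C * b N + C * b N ^ q) := by
          gcongr
          · exact hsm _ (by positivity) _ _ (hYr k)
          · exact hsm _ hC _ _ (hYq k)
          · rw [eLpNorm_const _ (by positivity) (NeZero.ne P)]
            simp [Real.enorm_of_nonneg hc0]
      _ = _ := by
          rw [← ENNReal.ofReal_add (by positivity) (by positivity),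
            ← ENNReal.ofReal_add (by positivity) hc0]

/-- The moment bound for the linearization error of partial sums of functionals of linear
processes. -/
theorem exists_eLpNorm_centeredSum_sub_le (h : CenteredNoise P ε μ p) (hp : 1 < p)
    (hp2 : p ≤ 2) (ha : HyperbolicDecay a A s) (hs : 1 < s * p) (hγ : 0 ≤ γ) (hγ1 : γ ≤ 1)
    {r θ : ℝ} (hr : 1 < r) (hr2 : r ≤ 2) (hrγ : r * (1 + γ) ≤ p) (hpr : p ≤ 2 * r)
    (hθ1 : θ ≤ s * (p / r)) (hθ2 : θ ≤ 2 * s - 1 / p) (hθ0 : 0 ≤ θ) (hθ : θ < 1)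
    (hθr : 1 < θ * r) (J : ℕ) (C : ℝ) :
    ∃ D, ∀ G, GrowthBound γ CG G →
      (∃ K' : ℕ → ℝ → ℝ, ∀ j, J ≤ j → SmoothGrowth γ C (partialMean μ a G j) (K' j)) →
      ∀ n : ℕ, 1 ≤ n →
      eLpNorm (fun ω => centeredSum P G (fun t ω => tailSum a 0 (histAt ε t ω)) n ω
        - linCoeff P G (fun ω => tailSum a 0 (histAt ε 0 ω))
          * partialSum (fun t ω => tailSum a 0 (histAt ε t ω)) n ω) (ENNReal.ofReal r) P
        ≤ ENNReal.ofReal (D * (n : ℝ) ^ (1 - θ + 1 / r)) := by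
  have := h.isProbabilityMeasure
  have hr0 : 0 < r := by linarith
  obtain ⟨D, hD0, hD⟩ := h.exists_eLpNorm_innovation_le (CG := CG) hp hp2 ha hs hγ hγ1 hr hrγ hpr
    hθ1 hθ2 J C
  obtain ⟨K, hK0, hK⟩ := exists_sum_blockWeight_rpow_le hθ0 hθ hr hθr
  refine ⟨(2 * r * (D ^ r * K)) ^ (1 / r), fun G hG hS n hn => ?_⟩
  have hD' := hD G hG hS
  obtain ⟨K', hK'⟩ := hS
  set c := linCoeff P G fun ω => tailSum a 0 (histAt ε 0 ω) with hc
  set m₀ := ∫ ω', G (tailSum a 0 (histAt ε 0 ω')) ∂P with hm₀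
  obtain ⟨ρ, hρt, hρ⟩ := h.exists_eLpNorm_remainder_le hp hp2 ha hs hγ hγ1 hr hrγ hpr hG hK' c
  have h1r := one_le_ofReal hr
  have hn0 : (0 : ℝ) < n := by exact_mod_cast hn
  have hm1 : ∀ j, Measurable (Function.uncurry (innovation μ a G c j)) :=
    h.measurable_innovation hp hγ hγ1 hG c
  -- Everything the innovation at time `1 - M + i` contributes to the block: at time `t + 1` its lag
  -- is `t + M - i`.
  let g : ℕ → ℕ → (ℕ → ℝ) → ℝ → ℝ := fun M i z e =>
    ∑ t ∈ Finset.range n, if i ≤ t + M then innovation μ a G c (t + M - i) z e else 0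
  have hgm : ∀ M i, Measurable (Function.uncurry (g M i)) := by
    intro M i
    have : Function.uncurry (g M i) = fun x => ∑ t ∈ Finset.range n,
        if i ≤ t + M then Function.uncurry (innovation μ a G c (t + M - i)) x else 0 := by
      funext x; rfl
    rw [this]
    refine Finset.measurable_sum _ fun t _ => ?_
    split_ifs
    · exact hm1 _
    · exact measurable_const
  have hii : ∀ j z, Integrable (innovation μ a G c j z) μ :=
    h.integrable_innovation hp hγ hγ1 hG c
  have hg0 : ∀ M i z, ∫ e, g M i z e ∂μ = 0 := by
    intro M i z
    have hsum : ∀ t ∈ Finset.range n, Integrable (fun e =>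
        if i ≤ t + M then innovation μ a G c (t + M - i) z e else 0) μ := by
      intro t _
      split_ifs
      · exact hii _ z
      · exact integrable_zero _ _ _
    rw [show (∫ e, g M i z e ∂μ) = ∫ e, ∑ t ∈ Finset.range n,
      (if i ≤ t + M then innovation μ a G c (t + M - i) z e else 0) ∂μ from rfl,
      integral_finsetSum _ hsum]
    refine Finset.sum_eq_zero fun t _ => ?_
    split_ifs
    · exact h.integral_innovation hp hγ hγ1 hG c _ z
    · simp
  -- Within one innovation the triangle inequality suffices; the martingale structure is used only
  -- across innovations.
  have hgb : ∀ M i : ℕ, ∀ k : ℤ, eLpNorm (fun ω => g M i (histAt ε (k - 1) ω) (ε k ω))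
      (ENNReal.ofReal r) P ≤ ENNReal.ofReal (D * blockWeight θ n M i) := by
    intro M i k
    have hfm : ∀ t ∈ Finset.range n, AEStronglyMeasurable (fun ω => if i ≤ t + M then
        innovation μ a G c (t + M - i) (histAt ε (k - 1) ω) (ε k ω) else 0) P := by
      intro t _
      split_ifs
      · exact ((hm1 _).comp
          ((h.measurable_histAt (k - 1)).prodMk (h.measurable k))).aestronglyMeasurable
      · exact aestronglyMeasurable_const
    have e1 : (fun ω => g M i (histAt ε (k - 1) ω) (ε k ω))
        = ∑ t ∈ Finset.range n, fun ω => if i ≤ t + M then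
          innovation μ a G c (t + M - i) (histAt ε (k - 1) ω) (ε k ω) else 0 := by
      funext ω
      rw [Finset.sum_apply]
    rw [e1]
    refine (eLpNorm_sum_le hfm h1r).trans ?_
    rw [blockWeight, Finset.mul_sum, ENNReal.ofReal_sum_of_nonneg]
    · refine Finset.sum_le_sum fun t _ => ?_
      split_ifs with hit
      · exact hD' _ k
      · simp
    · intro t _
      split_ifs <;> positivity
  -- The term at time `t + 1` is expanded up to lag `t + M`, so that all remainders depend on the
  -- history up to the same time `-M`.
  have hdec : ∀ M : ℕ, (fun ω => centeredSum P G (fun t ω => tailSum a 0 (histAt ε t ω)) n ω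
        - c * partialSum (fun t ω => tailSum a 0 (histAt ε t ω)) n ω)
      =ᵐ[P] (fun ω => ∑ i ∈ Finset.range (n + M), g M i (histAt ε ((1 - M : ℤ) + i - 1) ω)
          (ε ((1 - M : ℤ) + i) ω))
        + ∑ t ∈ Finset.range n, fun ω =>
          (partialMean μ a G (t + M + 1) (tailSum a (t + M + 1) (histAt ε (-M) ω))
            - c * tailSum a (t + M + 1) (histAt ε (-M) ω) - m₀) := by
    intro M
    filter_upwards [h.ae_sub_eq_sum_innovation hp hp2 ha hs G c] with ω hω
    rw [Pi.add_apply, Finset.sum_apply]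
    have e0 : centeredSum P G (fun t ω => tailSum a 0 (histAt ε t ω)) n ω
        - c * partialSum (fun t ω => tailSum a 0 (histAt ε t ω)) n ω
        = ∑ t ∈ Finset.range n, (G (tailSum a 0 (histAt ε ((t + 1 : ℕ) : ℤ) ω))
          - c * tailSum a 0 (histAt ε ((t + 1 : ℕ) : ℤ) ω) - m₀) := by
      rw [centeredSum, partialSum, Finset.mul_sum, ← Finset.sum_sub_distrib, Finset.range_eq_Ico,
        Finset.sum_Ico_add' (fun t : ℕ => G (tailSum a 0 (histAt ε (t : ℤ) ω))
          - c * tailSum a 0 (histAt ε (t : ℤ) ω) - m₀) 0 n 1]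
      refine Finset.sum_congr (by ext; simp) fun t _ => ?_
      ring
    rw [e0]
    have e2 := sum_range_sum_range_eq (fun j i =>
      innovation μ a G c j (histAt ε ((1 - M : ℤ) + i - 1) ω) (ε ((1 - M : ℤ) + i) ω)) n M
    have e3 : ∑ i ∈ Finset.range (n + M), g M i (histAt ε ((1 - M : ℤ) + i - 1) ω)
        (ε ((1 - M : ℤ) + i) ω)
        = ∑ i ∈ Finset.range (n + M), ∑ t ∈ Finset.range n,
        if i ≤ t + M then innovation μ a G c (t + M - i) (histAt ε ((1 - M : ℤ) + i - 1) ω)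
          (ε ((1 - M : ℤ) + i) ω) else 0 := rfl
    rw [e3, ← e2, ← Finset.sum_add_distrib]
    refine Finset.sum_congr rfl fun t _ => ?_
    rw [hω _ (t + M + 1), show ((t + 1 : ℕ) : ℤ) - ((t + M + 1 : ℕ) : ℤ) = -M by push_cast; ring,
      add_sub_assoc]
    congr 1
    refine Finset.sum_congr rfl fun j hj => ?_
    have hj' : j ≤ t + M := by have := Finset.mem_range.1 hj; omega
    have e4 : (1 - M : ℤ) + ((t + M - j : ℕ) : ℤ) = ((t + 1 : ℕ) : ℤ) - j := by
      push_cast [Nat.cast_sub hj']; ring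
    rw [e4]
  have hbound : ∀ M, J ≤ M →
      eLpNorm (fun ω => centeredSum P G (fun t ω => tailSum a 0 (histAt ε t ω)) n ω
        - c * partialSum (fun t ω => tailSum a 0 (histAt ε t ω)) n ω) (ENNReal.ofReal r) P
      ≤ ENNReal.ofReal ((2 * r * (D ^ r * K)) ^ (1 / r) * (n : ℝ) ^ (1 - θ + 1 / r))
        + ∑ t ∈ Finset.range n, ENNReal.ofReal (ρ (t + M + 1)) := by
    intro M hM
    have hm2 : ∀ t ∈ Finset.range n, AEStronglyMeasurable (fun ω =>
        (partialMean μ a G (t + M + 1) (tailSum a (t + M + 1) (histAt ε (-M) ω))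
            - c * tailSum a (t + M + 1) (histAt ε (-M) ω) - m₀)) P := by
      intro t _
      have hYm := (measurable_tailSum a (t + M + 1)).comp (h.measurable_histAt (-M))
      have hKm := (hK' (t + M + 1) (by omega)).continuous.measurable
      exact (((hKm.comp hYm).sub (hYm.const_mul c)).sub_const m₀).aestronglyMeasurable
    have hm3 : AEStronglyMeasurable (fun ω => ∑ i ∈ Finset.range (n + M),
        g M i (histAt ε ((1 - M : ℤ) + i - 1) ω) (ε ((1 - M : ℤ) + i) ω)) P :=
      (Finset.measurable_sum _ fun i _ => (hgm M i).comp
        ((h.measurable_histAt _).prodMk (h.measurable _))).aestronglyMeasurable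
    rw [eLpNorm_congr_ae (hdec M)]
    refine (eLpNorm_add_le hm3 (Finset.aestronglyMeasurable_sum _ hm2) h1r).trans
      (add_le_add ?_ ((eLpNorm_sum_le hm2 h1r).trans (Finset.sum_le_sum fun t _ =>
        hρ (t + M + 1) (by omega) (-M))))
    refine (h.eLpNorm_sum_history_le hr hr2 (hgm M) (hg0 M) (1 - M)
      (d := fun i => D * blockWeight θ n M i)
      (fun i => mul_nonneg hD0 (blockWeight_nonneg _ _ _ _)) (fun i => hgb M i _) (n + M)).trans
      (ENNReal.ofReal_le_ofReal ?_)
    have hexp : (n : ℝ) ^ (1 - θ + 1 / r) = ((n : ℝ) ^ (r * (1 - θ) + 1)) ^ (1 / r) := by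
      rw [← Real.rpow_mul hn0.le]
      congr 1
      field_simp
    rw [hexp, ← Real.mul_rpow (by positivity) (by positivity)]
    refine Real.rpow_le_rpow (mul_nonneg (by positivity) (Finset.sum_nonneg fun i _ =>
      Real.rpow_nonneg (mul_nonneg hD0 (blockWeight_nonneg _ _ _ _)) _)) ?_ (by positivity)
    simp_rw [Real.mul_rpow hD0 (blockWeight_nonneg _ _ _ _)]
    rw [← Finset.mul_sum]
    calc _ ≤ 2 * r * (D ^ r * (K * (n : ℝ) ^ (r * (1 - θ) + 1))) := by
          gcongr
          exact hK n M hn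
      _ = _ := by ring
  have hlim : Tendsto (fun M : ℕ =>
      ENNReal.ofReal ((2 * r * (D ^ r * K)) ^ (1 / r) * (n : ℝ) ^ (1 - θ + 1 / r))
        + ∑ t ∈ Finset.range n, ENNReal.ofReal (ρ (t + M + 1))) atTop
      (𝓝 (ENNReal.ofReal ((2 * r * (D ^ r * K)) ^ (1 / r) * (n : ℝ) ^ (1 - θ + 1 / r)) + 0)) := by
    refine tendsto_const_nhds.add ?_
    have : Tendsto (fun M : ℕ => ∑ t ∈ Finset.range n, ENNReal.ofReal (ρ (t + M + 1))) atTop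
        (𝓝 (∑ _t ∈ Finset.range n, 0)) := by
      refine tendsto_finsetSum _ fun t _ => ?_
      have h1 := ENNReal.tendsto_ofReal (hρt.comp (tendsto_atTop_mono
        (fun M : ℕ => (by omega : M ≤ t + M + 1)) tendsto_id))
      simpa [Function.comp_def] using h1
    simpa using this
  rw [add_zero] at hlim
  -- The left side does not depend on `M`, and the martingale bound is uniform in `M`, so the
  -- remainders disappear as `M → ∞`.
  exact ge_of_tendsto hlim (eventually_atTop.2 ⟨J, hbound⟩)

end CenteredNoise

/-! ### The choice of exponents. -/

/-- With `θ = α(1-d)/r` the rate is `1 - θ + 1/r`, subject to `θ ≤ 1`, i.e. `α(1-d) ≤ r`, and `θ ≤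
2(1-d) - 1/α`. In the first case `r = α(1-d)` gives `θ = 1`; otherwise `r` is the midpoint of `α`
and `1/(1-d)`. In both, `γ₀` solves `r (1 + γ₀) = α`. -/
theorem opt_exponents {α d : ℝ} (hα : 1 < α) (hα2 : α ≤ 2) (hd0 : 0 < d)
    (hd : d < 1 - 1 / α) :
    1 < rOpt α d ∧ rOpt α d < α ∧ α ≤ 2 * rOpt α d ∧ α * (1 - d) ≤ rOpt α d ∧
      rOpt α d * (1 + gammaOpt α d) = α ∧ gammaOpt α d < 1 ∧
      kappaOpt α d = 1 - α * (1 - d) / rOpt α d + 1 / rOpt α d ∧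
      α * (1 - d) / rOpt α d ≤ 2 * (1 - d) - 1 / α := by
  have hα0 : 0 < α := by linarith
  have hw : 1 < α * (1 - d) := by
    have : 1 / α < 1 - d := by linarith
    rw [div_lt_iff₀ hα0] at this
    linarith
  have hs : 1 / 2 < 1 - d := by nlinarith
  have hs0 : 0 < 1 - d := by linarith
  have hs2 : 0 < 1 - 2 * d := by linarith
  have h1s : 1 < 1 / (1 - d) := by rw [lt_div_iff₀ hs0]; linarith
  have h1sα : 1 / (1 - d) < α := by rw [div_lt_iff₀ hs0]; exact hw
  by_cases hc : 1 / ((1 - d) * (1 - 2 * d)) < α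
  · simp only [rOpt, gammaOpt, kappaOpt, if_pos hc]
    rw [div_lt_iff₀ (by positivity)] at hc
    -- This is the constraint `θ ≤ 2(1-d) - 1/α` at `θ = 1`.
    have h1 : 1 / α ≤ 1 - 2 * d := by
      rw [div_le_iff₀ hα0]
      have : 0 < α * (1 - 2 * d) := by positivity
      nlinarith
    refine ⟨hw, by nlinarith, by nlinarith, le_rfl, ?_, ?_, ?_, ?_⟩
    · field_simp; ring
    · rw [div_lt_one hs0]; linarith
    · rw [div_self (by positivity)]; ring
    · rw [div_self (by positivity)]; linarith
  · simp only [rOpt, gammaOpt, kappaOpt, if_neg hc]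
    rw [not_lt, le_div_iff₀ (by positivity)] at hc
    have hr : 1 / 2 * (α + 1 / (1 - d)) = (α * (1 - d) + 1) / (2 * (1 - d)) := by
      field_simp
    refine ⟨by linarith, by linarith, by linarith, ?_, ?_, ?_, ?_, ?_⟩
    · rw [hr, le_div_iff₀ (by positivity)]
      nlinarith
    · rw [hr]; field_simp; ring
    · rw [div_lt_one (by linarith)]; linarith
    · rw [hr]; field_simp; ring
    · rw [hr, div_div_eq_mul_div, div_le_iff₀ (by linarith), sub_mul, ← sub_nonneg]
      have : 2 * (1 - d) * (α * (1 - d) + 1) - 1 / α * (α * (1 - d) + 1)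
          - α * (1 - d) * (2 * (1 - d)) = (α * (1 - d) - 1) / α := by
        field_simp; ring
      rw [this]
      exact div_nonneg (by linarith) hα0.le

/-- At `p = α` and `θ = α(1-d)/r` the constraints hold, possibly with equality. Lowering `θ` by less
than `δ`, and using `γ < γ₀`, makes those involving `p` strict, so by continuity they persist for
`p` slightly below `α`, where moments are available. -/
theorem exists_exponents {α d γ δ : ℝ} (hα : 1 < α) (hα2 : α ≤ 2) (hd0 : 0 < d)
    (hd : d < 1 - 1 / α) (hγ : γ < gammaOpt α d) (hδ : 0 < δ) :
    ∃ θ p, 0 ≤ θ ∧ θ < 1 ∧ 1 < θ * rOpt α d ∧ 1 - θ + 1 / rOpt α d ≤ kappaOpt α d + δ ∧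
      1 < p ∧ p < α ∧ rOpt α d * (1 + γ) ≤ p ∧ 1 < (1 - d) * p ∧
      θ ≤ (1 - d) * (p / rOpt α d) ∧ θ ≤ 2 * (1 - d) - 1 / p := by
  obtain ⟨hr1, -, -, hwr, hrγ, -, hκ, hθ⟩ := opt_exponents hα hα2 hd0 hd
  set r := rOpt α d
  have hr0 : 0 < r := by linarith
  have hα0 : 0 < α := by linarith
  have hw : 1 < α * (1 - d) := by
    have : 1 / α < 1 - d := by linarith
    rw [div_lt_iff₀ hα0] at this
    linarith
  have hθ1 : α * (1 - d) / r ≤ 1 := (div_le_one hr0).2 hwr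
  obtain ⟨θ, hθl, hθu⟩ : ∃ θ, max (1 / r) (α * (1 - d) / r - δ) < θ ∧ θ < α * (1 - d) / r :=
    exists_between (max_lt (div_lt_div_of_pos_right hw hr0) (by linarith))
  have hθr := (le_max_left _ _).trans_lt hθl
  have hθδ := (le_max_right _ _).trans_lt hθl
  have hev : ∀ {f : ℝ → ℝ} {c : ℝ}, ContinuousAt f α → c < f α → ∀ᶠ p in 𝓝[<] α, c < f p :=
    fun hf hc => (hf.eventually_const_lt hc).filter_mono nhdsWithin_le_nhds
  have e1 := hev continuousAt_id hα
  have e2 : ∀ᶠ p in 𝓝[<] α, r * (1 + γ) < p := hev continuousAt_id (by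
    nlinarith)
  have e3 : ∀ᶠ p in 𝓝[<] α, 1 < (1 - d) * p :=
    hev (by fun_prop) (by linarith)
  have e4 : ∀ᶠ p in 𝓝[<] α, θ < (1 - d) * (p / r) :=
    hev (by fun_prop) (by rw [← mul_div_assoc, mul_comm]; exact hθu)
  have e5 : ∀ᶠ p in 𝓝[<] α, θ < 2 * (1 - d) - 1 / p :=
    hev (by fun_prop (disch := exact hα0.ne')) (by linarith)
  obtain ⟨p, h1, h2, h3, h4, h5, h6⟩ :=
    (e1.and (e2.and (e3.and (e4.and (e5.and self_mem_nhdsWithin))))).exists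
  refine ⟨θ, p, (by positivity : (0:ℝ) ≤ 1 / r).trans hθr.le, by linarith, ?_, by linarith, h1, h6,
    h2.le, h3, h4.le, h5.le⟩
  rwa [div_lt_iff₀ hr0] at hθr

/-! ### Reduction of the hypotheses to centred noise, and the theorem. -/

theorem exists_hyperbolicDecay {a : ℕ → ℝ} {s c : ℝ} (hs : 0 ≤ s)
    (h : Tendsto (fun n : ℕ => (n : ℝ) ^ s * a n) atTop (𝓝 c)) :
    ∃ A, HyperbolicDecay a A s := by
  obtain ⟨B, hB⟩ := h.abs.bddAbove_range
  have hB' : ∀ n : ℕ, |(n : ℝ) ^ s * a n| ≤ B := fun n => hB ⟨n, rfl⟩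
  have hB0 : 0 ≤ B := (abs_nonneg _).trans (hB' 0)
  refine ⟨|a 0| + B * 2 ^ s, fun j => ?_⟩
  rcases Nat.eq_zero_or_pos j with rfl | hj
  · simp only [Nat.cast_zero, zero_add, Real.one_rpow, mul_one]
    have : 0 ≤ B * (2 : ℝ) ^ s := by positivity
    linarith
  · have hj1 : (1 : ℝ) ≤ j := by exact_mod_cast hj
    have hj0 : (0 : ℝ) < j := by linarith
    have h1 := hB' j
    rw [abs_mul, abs_of_nonneg (by positivity : (0 : ℝ) ≤ (j : ℝ) ^ s)] at h1
    have h2 : ((j : ℝ) + 1) ^ s ≤ 2 ^ s * (j : ℝ) ^ s := by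
      rw [← Real.mul_rpow (by norm_num) hj0.le]
      exact Real.rpow_le_rpow (by positivity) (by linarith) hs
    rw [Real.rpow_neg (by positivity), ← div_eq_mul_inv, le_div_iff₀ (by positivity)]
    calc _ ≤ |a j| * (2 ^ s * (j : ℝ) ^ s) := by gcongr
      _ = (j : ℝ) ^ s * |a j| * 2 ^ s := by ring
      _ ≤ B * 2 ^ s := by gcongr
      _ ≤ _ := by
        have := abs_nonneg (a 0)
        linarith

theorem one_lt_tailIndex {Ω : Type*} [MeasurableSpace Ω] {P : Measure Ω} {Z : Ω → ℝ}
    (h : 1 < momentIndex P Z) : 1 < tailIndex P Z := by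
  have h1 : (1 : ℝ≥0∞) < min 2 (momentIndex P Z) := lt_min (by norm_num) h
  have h2 : min 2 (momentIndex P Z) ≠ ∞ := ((min_le_left _ _).trans_lt (by norm_num)).ne
  simpa [tailIndex] using (ENNReal.toReal_lt_toReal ENNReal.one_ne_top h2).2 h1

theorem tailIndex_le_two {Ω : Type*} [MeasurableSpace Ω] (P : Measure Ω) (Z : Ω → ℝ) :
    tailIndex P Z ≤ 2 :=
  ENNReal.toReal_le_of_le_ofReal (by norm_num) (by simp)

theorem memLp_of_lt_tailIndex {Ω : Type*} [MeasurableSpace Ω] {P : Measure Ω}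
    [IsProbabilityMeasure P] {Z : Ω → ℝ} (hZ : AEStronglyMeasurable Z P) {p : ℝ} (hp0 : 0 ≤ p)
    (hp : p < tailIndex P Z) : MemLp Z (ENNReal.ofReal p) P := by
  have h2 : min 2 (momentIndex P Z) ≠ ∞ := ((min_le_left _ _).trans_lt (by norm_num)).ne
  have h1 := ((ENNReal.ofReal_lt_iff_lt_toReal hp0 h2).2 hp).trans_le (min_le_right _ _)
  obtain ⟨q, ⟨-, -, hq⟩, hpq⟩ := lt_sSup_iff.1 h1
  exact MemLp.mono_exponent ⟨hZ, hq⟩ hpq.le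

/-- Independent copies of an integrable symmetric variable agree almost surely with a centred
noise. -/
theorem exists_centeredNoise {Ω : Type*} [MeasurableSpace Ω] {P : Measure Ω}
    [IsProbabilityMeasure P] {ε : ℤ → Ω → ℝ} (hindep : iIndepFun ε P)
    (hident : ∀ t : ℤ, IdentDistrib (ε t) (ε 0) P P)
    (hsymm : IdentDistrib (ε 0) (fun ω => -ε 0 ω) P P) :
    ∃ η : ℤ → Ω → ℝ, (∀ᵐ ω ∂P, ∀ t, ε t ω = η t ω) ∧
      ∀ p, 0 ≤ p → p < tailIndex P (ε 0) → CenteredNoise P η (P.map (ε 0)) p := by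
  have hm : ∀ t, AEMeasurable (ε t) P := fun t => (hident t).aemeasurable_fst
  -- The innovations are only a.e. measurable, so measurable modifications are taken simultaneously
  -- for all `t`.
  refine ⟨fun t => (hm t).mk, ae_all_iff.2 fun t => (hm t).ae_eq_mk, fun p hp0 hp => ?_⟩
  refine ⟨fun t => (hm t).measurable_mk, hindep.congr fun t => (hm t).ae_eq_mk, fun t => ?_,
    ?_, ?_⟩
  · rw [← Measure.map_congr (hm t).ae_eq_mk, (hident t).map_eq]
  · rw [memLp_map_measure_iff (by fun_prop) (hm 0)]
    exact memLp_of_lt_tailIndex (hm 0).aestronglyMeasurable hp0 hp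
  · rw [integral_map (hm 0) (by fun_prop)]
    -- By symmetry the mean equals its own negative.
    have := hsymm.integral_eq
    rw [integral_neg] at this
    linarith

/-- Smoothing by a density with weight exponent `β` requires `β > 1 + γ`. In the heavy-tailed case
`β = α`, covered by `hγα`; in the finite variance case Fourier inversion gives `β = 2`, covered by
`γ < 1`. -/
theorem CenteredNoise.exists_smoothGrowth_of_regularInnovation {Ω : Type*} [MeasurableSpace Ω]
    {P : Measure Ω} {η : ℤ → Ω → ℝ} {Z : Ω → ℝ} (hZ : AEMeasurable Z P) {p : ℝ}
    (h : CenteredNoise P η (P.map Z) p) (hp : 1 < p) (hreg : RegularInnovation P Z) {a : ℕ → ℝ}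
    (ha : ∀ᶠ i in atTop, a i ≠ 0) {γ : ℝ} (hγ : 0 ≤ γ) (hγ1 : γ < 1)
    (hγα : 1 + γ < tailIndex P Z) (CG : ℝ) :
    ∃ J C, ∀ G, GrowthBound γ CG G →
      ∃ K', SmoothGrowth γ C (partialMean (P.map Z) a G J) K' := by
  have := h.isProbabilityMeasure_law
  rcases hreg.cases with ⟨h2, δ, hδ, D, hD⟩ | ⟨-, -, -, hf, C, -, hf', hlip⟩
  · exact h.exists_smoothGrowth_of_charFun hp ((memLp_map_measure_iff (by fun_prop) hZ).2 h2) hδ hD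
      ha hγ hγ1
  · have hF : (fun x => (P.map Z).real (Set.Iic x)) = distFun P Z := by
      funext x
      rw [map_measureReal_apply_of_aemeasurable hZ measurableSet_Iic]
      rfl
    exact exists_smoothGrowth_of_contDiff_distFun (h.integrable_id hp) ha.exists hγ hγ1.le hγα
      (by rw [hF]; exact hreg.contDiff_distFun.of_le (by norm_num)) (by rw [hF]; rfl) hf hf' hlip

theorem theorem2 {Ω : Type*} [MeasurableSpace Ω] (P : Measure Ω) [IsProbabilityMeasure P]
    (ε : ℤ → Ω → ℝ) (hindep : iIndepFun ε P) (hident : ∀ t : ℤ, IdentDistrib (ε t) (ε 0) P P)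
    (a : ℕ → ℝ) (d : ℝ) (hmem : LongMemory P (ε 0) a d)
    (G : ℕ → ℝ → ℝ) (u : ℕ → ℝ) (γG : ℝ) (hG : RegularTransforms G u γG)
    (hε : RegularInnovation P (ε 0))
    (α : ℝ) (hα : α = tailIndex P (ε 0))
    (X : ℤ → Ω → ℝ) (hX : X = linearProcess a ε)
    (hγ : γG < gammaOpt α d) :
    -- all objects are well defined
    (∀ t : ℤ, ∀ᵐ ω ∂P,
      Tendsto (fun N : ℕ => ∑ j ∈ Finset.range N, a j * ε (t - (j : ℤ)) ω) atTop
        (𝓝 (X t ω))) ∧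
    (∀ n : ℕ, 1 ≤ n →
      (∀ x : ℝ, Integrable (fun ω => G n (X 0 ω + x)) P) ∧
      DifferentiableAt ℝ (shiftedMean P (G n) (X 0)) 0) ∧
    -- the moment bound
    (∀ δ : ℝ, 0 < δ → ∃ C : ℝ, ∀ n : ℕ, 1 ≤ n →
      eLpNorm (fun ω => centeredSum P (G n) X n ω
          - linCoeff P (G n) (X 0) * partialSum X n ω) (ENNReal.ofReal (rOpt α d)) P
        ≤ ENNReal.ofReal (C * (n : ℝ) ^ (kappaOpt α d + δ))) ∧
    -- the reduction principle
    ((∀ᶠ n : ℕ in atTop, linCoeff P (G n) (X 0) ≠ 0) →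
      (∃ δ : ℝ, 0 < δ ∧
        Tendsto (fun n : ℕ => (n : ℝ) ^ (kappaOpt α d + δ - d - 1 / α)
          / linCoeff P (G n) (X 0)) atTop (𝓝 0)) →
      Tendsto (fun n : ℕ =>
        eLpNorm (fun ω =>
            (n : ℝ) ^ (-d - 1 / α) / linCoeff P (G n) (X 0) * centeredSum P (G n) X n ω
              - (n : ℝ) ^ (-d - 1 / α) * partialSum X n ω)
          (ENNReal.ofReal (rOpt α d)) P) atTop (𝓝 0)) := by
  subst hα
  obtain ⟨c, hc0, hc⟩ := hmem.coeff
  set α := tailIndex P (ε 0) with hα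
  have hα1 : 1 < α := one_lt_tailIndex hmem.one_lt_momentIndex
  have hα2 : α ≤ 2 := tailIndex_le_two P (ε 0)
  have hd0 := hmem.d_pos
  have hd := hmem.d_lt
  have hd1 : 0 ≤ 1 - d := by
    have : 0 ≤ 1 / α := by positivity
    linarith
  obtain ⟨hr1, hrα, hαr, -, hrγ, hγ0, -, -⟩ := opt_exponents hα1 hα2 hd0 hd
  have hγ1 : γG < 1 := hγ.trans hγ0
  -- `1 + γ < r (1 + γ) < r (1 + γ₀) = α`, because `r > 1`.
  have hγα : 1 + γG < α := by nlinarith [hG.nonneg]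
  obtain ⟨A, ha⟩ := exists_hyperbolicDecay hd1 hc
  have ha0 : ∀ᶠ i in atTop, a i ≠ 0 := by
    filter_upwards [hc.eventually_ne hc0] with i hi h0
    exact hi (by rw [h0, mul_zero])
  obtain ⟨η, hη, hnoise⟩ := exists_centeredNoise hindep hident hε.symmetric
  obtain ⟨CG, hCG⟩ := hG.bound
  -- The indicator is at most 1, so one growth constant serves all `n`, and everything below is
  -- uniform in `n`.
  have hgrowth : ∀ n, 1 ≤ n → GrowthBound γG |CG| (G n) := by
    refine fun n hn => ⟨hG.measurable n hn, fun x => (hCG n hn x).trans ?_⟩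
    calc _ ≤ |CG| * (1 + |x|) ^ γG * 1 := by
          gcongr
          · exact Set.indicator_nonneg (fun _ _ => zero_le_one) _
          · exact le_abs_self CG
          · exact Set.indicator_le_self' (fun _ _ => zero_le_one) _
      _ = _ := mul_one _
  -- Both sides are `limUnder` of the same sequence once `ε` and `η` agree, so convergence is not
  -- needed here.
  have hXη : ∀ᵐ ω ∂P, ∀ t, X t ω = tailSum a 0 (histAt η t ω) := by
    filter_upwards [hη] with ω hω t
    simp only [hX, linearProcess, tailSum, histAt, zero_add, hω]
  have hsmooth : ∀ p, 1 < p → p < α → 1 < (1 - d) * p → ∃ J C, ∀ n, 1 ≤ n →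
      ∃ K' : ℕ → ℝ → ℝ, ∀ j, J ≤ j →
        SmoothGrowth γG C (partialMean (P.map (ε 0)) a (G n) j) (K' j) := by
    intro p hp hpα hsp
    have h := hnoise p (by linarith) hpα
    obtain ⟨J, C, hJ⟩ := h.exists_smoothGrowth_of_regularInnovation (hident 0).aemeasurable_fst hp
      hε ha0 hG.nonneg hγ1 hγα |CG|
    obtain ⟨C', hC'⟩ := h.exists_smoothGrowth_partialMean hp (by linarith) ha hsp hG.nonneg hγ1.le hJ
    exact ⟨J, C', fun n hn => hC' _ (hgrowth n hn)⟩
  have hshift : ∀ g : ℝ → ℝ, shiftedMean P g (X 0)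
      = shiftedMean P g fun ω => tailSum a 0 (histAt η 0 ω) := by
    intro g
    funext x
    exact integral_congr_ae (hXη.mono fun ω hω => by simp only [hω 0])
  have hlin : ∀ g : ℝ → ℝ, linCoeff P g (X 0)
      = linCoeff P g fun ω => tailSum a 0 (histAt η 0 ω) := fun g => by
    rw [linCoeff, hshift, linCoeff]
  have hbound : ∀ δ : ℝ, 0 < δ → ∃ C : ℝ, ∀ n : ℕ, 1 ≤ n →
      eLpNorm (fun ω => centeredSum P (G n) X n ω
          - linCoeff P (G n) (X 0) * partialSum X n ω) (ENNReal.ofReal (rOpt α d)) P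
        ≤ ENNReal.ofReal (C * (n : ℝ) ^ (kappaOpt α d + δ)) := by
    intro δ hδ
    obtain ⟨θ, p, hθ0, hθ1, hθr, hκ, hp, hpα, hpγ, hsp, hθp, hθs⟩ :=
      exists_exponents hα1 hα2 hd0 hd hγ hδ
    have h := hnoise p (by linarith) hpα
    obtain ⟨J, C, hJ⟩ := hsmooth p hp hpα hsp
    obtain ⟨D, hD⟩ := h.exists_eLpNorm_centeredSum_sub_le (CG := |CG|) hp (by linarith) ha hsp
      hG.nonneg hγ1.le hr1 (by linarith) hpγ (by linarith) hθp hθs hθ0 hθ1 hθr J C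
    refine ⟨|D|, fun n hn => ?_⟩
    have hn1 : (1 : ℝ) ≤ n := by exact_mod_cast hn
    have hae : (fun ω => centeredSum P (G n) X n ω - linCoeff P (G n) (X 0) * partialSum X n ω)
        =ᵐ[P] fun ω => centeredSum P (G n) (fun t ω => tailSum a 0 (histAt η t ω)) n ω
          - linCoeff P (G n) (fun ω => tailSum a 0 (histAt η 0 ω))
            * partialSum (fun t ω => tailSum a 0 (histAt η t ω)) n ω := by
      have hint : ∫ ω, G n (X 0 ω) ∂P = ∫ ω, G n (tailSum a 0 (histAt η 0 ω)) ∂P :=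
        integral_congr_ae (hXη.mono fun ω hω => by simp only [hω 0])
      filter_upwards [hXη] with ω hω
      simp only [centeredSum, partialSum, hω, hlin, hint]
    rw [eLpNorm_congr_ae hae]
    refine (hD (G n) (hgrowth n hn) (hJ n hn) n hn).trans (ENNReal.ofReal_le_ofReal ?_)
    gcongr
    exact le_abs_self D
  refine ⟨fun t => ?_, fun n hn => ?_, hbound, ?_⟩
  · obtain ⟨θ, p, -, -, -, -, hp, hpα, -, hsp, -, -⟩ :=
      exists_exponents hα1 hα2 hd0 hd hγ one_pos
    filter_upwards [hη, hXη, (hnoise p (by linarith) hpα).ae_tendsto_tailSum hp (by linarith) ha hsp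
      0 t] with ω h1 h2 h3
    simpa only [h1, h2, zero_add] using h3
  · obtain ⟨θ, p, -, -, -, -, hp, hpα, -, hsp, -, -⟩ :=
      exists_exponents hα1 hα2 hd0 hd hγ one_pos
    have h := hnoise p (by linarith) hpα
    refine ⟨fun x => ?_, ?_⟩
    · refine ((hgrowth n hn).integrable_add hG.nonneg hγ1.le
        ((h.memLp_tailSum hp (by linarith) ha hsp 0 0).integrable
          (CenteredNoise.one_le_ofReal hp)) x).congr (hXη.mono fun ω hω => ?_)
      simp only [hω 0, add_comm x]
    · obtain ⟨J, C, hJ⟩ := hsmooth p hp hpα hsp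
      obtain ⟨K', hK'⟩ := hJ n hn
      rw [hshift]
      exact (h.hasDerivAt_shiftedMean hp (by linarith) ha hsp hG.nonneg hγ1.le (hgrowth n hn)
        (hK' J le_rfl) 0).differentiableAt
  · rintro hne ⟨δ, hδ, hlim⟩
    obtain ⟨C, hC⟩ := hbound δ hδ
    have hzero : Tendsto (fun n : ℕ => ENNReal.ofReal (C * |(n : ℝ) ^ (kappaOpt α d + δ - d - 1 / α)
        / linCoeff P (G n) (X 0)|)) atTop (𝓝 0) := by
      simpa using ENNReal.tendsto_ofReal (hlim.abs.const_mul C)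
    refine tendsto_of_tendsto_of_tendsto_of_le_of_le' tendsto_const_nhds hzero
      (Eventually.of_forall fun _ => zero_le) ?_
    filter_upwards [hne, eventually_ge_atTop 1] with n hn hn1
    have hn0 : (0 : ℝ) < n := by exact_mod_cast hn1
    set l := linCoeff P (G n) (X 0)
    set b := (n : ℝ) ^ (-d - 1 / α) / l with hb
    -- Since `b * l` is the normalization `n^(-d-1/α)`, the reduction error is `b` times the
    -- linearization error, and the moment bound applies directly.
    have hfun : (fun ω => b * centeredSum P (G n) X n ω
        - (n : ℝ) ^ (-d - 1 / α) * partialSum X n ω)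
        = fun ω => b * (centeredSum P (G n) X n ω - l * partialSum X n ω) := by
      funext ω
      have : b * l = (n : ℝ) ^ (-d - 1 / α) := div_mul_cancel₀ _ hn
      rw [← this]; ring
    have hsmul := eLpNorm_const_smul b
      (fun ω => centeredSum P (G n) X n ω - l * partialSum X n ω) (ENNReal.ofReal (rOpt α d)) P
    change eLpNorm (fun ω => b * (centeredSum P (G n) X n ω - l * partialSum X n ω)) _ P = _
      at hsmul
    rw [hfun, hsmul, Real.enorm_eq_ofReal_abs]
    calc _ ≤ ENNReal.ofReal |b| * ENNReal.ofReal (C * (n : ℝ) ^ (kappaOpt α d + δ)) := by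
          gcongr
          exact hC n hn1
      _ = _ := by
          rw [← ENNReal.ofReal_mul (abs_nonneg b)]
          congr 1
          have e : (n : ℝ) ^ (kappaOpt α d + δ - d - 1 / α)
              = (n : ℝ) ^ (-d - 1 / α) * (n : ℝ) ^ (kappaOpt α d + δ) := by
            rw [← Real.rpow_add hn0]; congr 1; ring
          rw [e, hb, mul_div_right_comm, abs_mul _ ((n : ℝ) ^ (kappaOpt α d + δ)),
            abs_of_nonneg (by positivity : 0 ≤ (n : ℝ) ^ (kappaOpt α d + δ))]
          ring
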